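/- Theorem. Diagrams are diagrams of nonempty links in $S^2$, considered up to isotopy of $S^2$; a tied link diagram is a link diagram together with finitely many ties, each tie joining two points of the diagram. Two components are tied together if they are related by the equivalence relation generated by the ties; thus the ties define a partition of the set of components, and ties may be created or destroyed as long as this partition does not change. Two oriented tied link diagrams are ambient tie-isotopic if they are related by a finite sequence of isotopies of $S^2$, Reidemeister moves I, II, III, and creations or destructions of ties that do not change the partition of the set of components. There is a unique function $\mathcal{L}$ from unoriented tied link diagrams to $\mathbb{Z}[a^{\pm1},z^{\pm1},x^{-1}]$ that is invariant under isotopy of $S^2$ and under changes of the ties that preserve the partition of the set of components, and satisfies the following rules: (i) $\mathcal{L}(\bigcirc)=1$ for the zero-crossing diagram $\bigcirc$ of the circle; (ii) $\mathcal{L}(D\sqcup\bigcirc)=x^{-1}\mathcal{L}(D)$ for the disjoint union of a diagram $D$ with a circle that has no crossings and is not tied to $D$; (iii) $\mathcal{L}$ is invariant under Reidemeister moves II and III; (iv) if $D'$ is obtained from $D$ by adding a curl (a Reidemeister I loop) whose crossing is positive, then $\mathcal{L}(D')=a\,\mathcal{L}(D)$; (v) if $D'$ is obtained from $D$ by adding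 a curl whose crossing is negative, then $\mathcal{L}(D')=a^{-1}\mathcal{L}(D)$ (the sign of the crossing of a curl does not depend on the orientation); (vi) $\mathcal{L}(D_+)+\mathcal{L}(D_-)=z\bigl(\mathcal{L}(D_e)+\mathcal{L}(D_f)\bigr)$ whenever $D_+,D_-,D_e,D_f$ are identical except in a disc, where $D_+$ and $D_-$ are the two crossings of two strands, and $D_e$ and $D_f$ are the two smoothings of this crossing, each with a tie joining the two arcs in the disc. Moreover, for an oriented tied link diagram $\overrightarrow D$ with underlying unoriented diagram $D$ and writhe $w(D)$ (the sum of the signs of the crossings), the map $\overrightarrow D\mapsto a^{-w(D)}\mathcal{L}(D)$ is an ambient tie-isotopy invariant of oriented tied links: it takes the same value on any two ambient tie-isotopic oriented tied link diagrams. -/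

import Mathlib

namespace TiedLink

/-!  Sliced diagrams of tied links.

A diagram in general position with respect to the height function is a word of elementary slices,
read from bottom to top.  At every regular level the diagram meets the horizontal line in finitely
many points, numbered `0, 1, 2, …` from left to right.  A label in `α` is attached to every point of
a level: for `α = ℤˣ` it is the direction of the strand there (`1` up, `-1` down), so that words are
oriented diagrams; for `α = Unit` there is no information, and words are unoriented diagrams. -/

/-- An elementary slice.
* `cup i b`: a local minimum, whose left branch gets position `i` and label `b` and whose right
  branch gets position `i + 1` and label `-b`.
* `cap i`: a local maximum, joining the strands at positions `i` and `i + 1`.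
* `cross i ε`: the strands at positions `i` and `i + 1` cross; for `ε = 1` the strand that goes from
  bottom left to top right is the over-strand, for `ε = -1` it is the under-strand.
* `tie i j`: a tie (spring) between the points at positions `i` and `j` of the level. -/
inductive Slice (α : Type) : Type
  | cup (i : ℕ) (b : α) : Slice α
  | cap (i : ℕ) : Slice α
  | cross (i : ℕ) (ε : ℤˣ) : Slice α
  | tie (i j : ℕ) : Slice α

namespace Slice

/-- Move a slice `k` positions to the right. -/
def shift {α : Type} (k : ℕ) : Slice α → Slice α
  | cup i b => cup (i + k) b
  | cap i => cap (i + k)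
  | cross i ε => cross (i + k) ε
  | tie i j => tie (i + k) (j + k)

/-- Forget the labels. -/
def forget {α : Type} : Slice α → Slice Unit
  | cup i _ => cup i ()
  | cap i => cap i
  | cross i ε => cross i ε
  | tie i j => tie i j

/-- The labels above a slice in terms of the labels below it; `none` if the slice does not fit
(a position is out of range, or a cap joins strands with incompatible directions). -/
def act {α : Type} [Neg α] [DecidableEq α] : Slice α → List α → Option (List α)
  | cup i b, s => if i ≤ s.length then some (s.take i ++ b :: -b :: s.drop i) else none
  | cap i, s =>
    match s.drop i with
    | b :: c :: r => if c = -b then some (s.take i ++ r) else none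
    | _ => none
  | cross i _, s =>
    match s.drop i with
    | b :: c :: r => some (s.take i ++ c :: b :: r)
    | _ => none
  | tie i j, s => if i < s.length ∧ j < s.length then some s else none

/-- The sign of the crossing in an oriented slice above the directions `s`
(`0` if there is no crossing).  If both strands go up, the sign is `ε`; every reversal of one of the
two strands changes it. -/
def sign : Slice ℤˣ → List ℤˣ → ℤ
  | cross i ε, s =>
    match s.drop i with
    | b :: c :: _ => ((ε * b * c : ℤˣ) : ℤ)
    | _ => 0
  | _, _ => 0

end Slice

open Slice

/-- The labels above a word of slices in terms of the labels below it. -/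
def run {α : Type} [Neg α] [DecidableEq α] : List (Slice α) → List α → Option (List α)
  | [], s => some s
  | c :: w, s => (c.act s).bind (run w)

theorem act_forget {α : Type} [Neg α] [DecidableEq α] (c : Slice α) (s t : List α)
    (h : c.act s = some t) :
    c.forget.act (s.map fun _ => ()) = some (t.map fun _ => ()) := by
  cases c with
  | cup i b =>
    simp only [act] at h
    split_ifs at h with hi
    cases h
    simp [forget, act, hi]
  | cap i =>
    simp only [act] at h
    split at h
    · rename_i b c r hs
      split_ifs at h with hc
      cases h
      have hs' : (s.map fun _ => ()).drop i = () :: () :: r.map fun _ => () := by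
        rw [← List.map_drop, hs]; rfl
      simp only [forget, act, hs', List.map_append, List.map_take, if_true]
    · cases h
  | cross i ε =>
    simp only [act] at h
    split at h
    · rename_i b c r hs
      cases h
      have hs' : (s.map fun _ => ()).drop i = () :: () :: r.map fun _ => () := by
        rw [← List.map_drop, hs]; rfl
      simp only [forget, act, hs', List.map_append, List.map_take, List.map_cons]
    · cases h
  | tie i j =>
    simp only [act] at h
    split_ifs at h with hi
    cases h
    simp [forget, act, hi]

theorem run_forget {α : Type} [Neg α] [DecidableEq α] (w : List (Slice α)) :
    ∀ s t : List α, run w s = some t →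
      run (w.map Slice.forget) (s.map fun _ => ()) = some (t.map fun _ => ()) := by
  induction w with
  | nil =>
    intro s t h
    simp only [run, Option.some.injEq] at h
    subst h
    rfl
  | cons c w ih =>
    intro s t h
    simp only [run, Option.bind_eq_some_iff] at h
    obtain ⟨u, hu, h⟩ := h
    simp only [List.map_cons, run, act_forget c s u hu, Option.bind_some]
    exact ih u t h

/-- A (nonempty) tied link diagram. -/
structure Diagram (α : Type) [Neg α] [DecidableEq α] where
  word : List (Slice α)
  closed : run word [] = some []
  nonempty : word ≠ []

/-- Oriented tied link diagrams. -/
abbrev OrientedDiagram : Type := Diagram ℤˣ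

/-- Unoriented tied link diagrams. -/
abbrev UnorientedDiagram : Type := Diagram Unit

/-- The unoriented diagram associated to a diagram. -/
def Diagram.forget {α : Type} [Neg α] [DecidableEq α] (D : Diagram α) : UnorientedDiagram where
  word := D.word.map Slice.forget
  closed := run_forget D.word [] [] D.closed
  nonempty := by simpa using D.nonempty

/-- The sum of the signs of the crossings of an oriented word above the directions `s`. -/
def writheFrom : List (Slice ℤˣ) → List ℤˣ → ℤ
  | [], _ => 0
  | c :: w, s => c.sign s + ((c.act s).map (writheFrom w)).getD 0

/-- The writhe of an oriented diagram. -/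
def writhe (D : OrientedDiagram) : ℤ := writheFrom D.word []

/-! Components and ties. -/

/-- `(k, p)` is the point at position `p` of the level below the `k`-th slice of `w` (the level above
the last slice has number `w.length`).  Two points are linked if a slice of `w` contains an arc or a
tie between them. -/
inductive Linked {α : Type} (w : List (Slice α)) : ℕ × ℕ → ℕ × ℕ → Prop
  | cup_left (k i p : ℕ) (b : α) : w[k]? = some (cup i b) → p < i → Linked w (k, p) (k + 1, p)
  | cup_right (k i p : ℕ) (b : α) : w[k]? = some (cup i b) → i ≤ p →
      Linked w (k, p) (k + 1, p + 2)
  | cup_arc (k i : ℕ) (b : α) : w[k]? = some (cup i b) → Linked w (k + 1, i) (k + 1, i + 1)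
  | cap_left (k i p : ℕ) : w[k]? = some (cap i) → p < i → Linked w (k, p) (k + 1, p)
  | cap_right (k i p : ℕ) : w[k]? = some (cap i) → i ≤ p → Linked w (k, p + 2) (k + 1, p)
  | cap_arc (k i : ℕ) : w[k]? = some (cap i) → Linked w (k, i) (k, i + 1)
  | cross_other (k i p : ℕ) (ε : ℤˣ) : w[k]? = some (cross i ε) → p ≠ i → p ≠ i + 1 →
      Linked w (k, p) (k + 1, p)
  | cross_right (k i : ℕ) (ε : ℤˣ) : w[k]? = some (cross i ε) → Linked w (k, i) (k + 1, i + 1)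
  | cross_left (k i : ℕ) (ε : ℤˣ) : w[k]? = some (cross i ε) → Linked w (k, i + 1) (k + 1, i)
  | tie_other (k i j p : ℕ) : w[k]? = some (tie i j) → Linked w (k, p) (k + 1, p)
  | tie_spring (k i j : ℕ) : w[k]? = some (tie i j) → Linked w (k, i) (k, j)

/-- Two points lie on the same component, or on components that are in the same class of the
partition of the set of components defined by the ties. -/
def TiedTogether {α : Type} (w : List (Slice α)) : ℕ × ℕ → ℕ × ℕ → Prop :=
  Relation.EqvGen (Linked w)

section Moves

variable {α : Type} [Neg α] [DecidableEq α]

/-- `D` and `D'` are identical except for a disc, where they look like `u` and `v`. -/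
def Replace (u v : List (Slice α)) (D D' : Diagram α) : Prop :=
  ∃ (w₁ w₂ : List (Slice α)) (s t : List α),
    D.word = w₁ ++ u ++ w₂ ∧ D'.word = w₁ ++ v ++ w₂ ∧
    run w₁ [] = some s ∧ run u s = some t ∧ run v s = some t ∧ run w₂ t = some []

/-- Isotopies of the plane, in terms of sliced diagrams: two slices on disjoint sets of strands
exchange their heights; a local minimum and a local maximum cancel; a crossing passes a local minimum
or maximum of one of its two strands. -/
inductive PlaneMove : List (Slice α) → List (Slice α) → Prop
  | far_cup (c : Slice α) (i : ℕ) (b : α) :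
      PlaneMove [c.shift i, cup i b] [cup i b, c.shift (i + 2)]
  | far_cap (c : Slice α) (i : ℕ) :
      PlaneMove [c.shift (i + 2), cap i] [cap i, c.shift i]
  | far_cross (c : Slice α) (i : ℕ) (ε : ℤˣ) :
      PlaneMove [c.shift (i + 2), cross i ε] [cross i ε, c.shift (i + 2)]
  | zigzag_left (i : ℕ) (b : α) : PlaneMove [cup i b, cap (i + 1)] []
  | zigzag_right (i : ℕ) (b : α) : PlaneMove [cup (i + 1) b, cap i] []
  | cup_cross (i : ℕ) (b : α) (ε : ℤˣ) :
      PlaneMove [cup i b, cross (i + 1) ε] [cup (i + 1) b, cross i (-ε)]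
  | cross_cap (i : ℕ) (ε : ℤˣ) :
      PlaneMove [cross (i + 1) ε, cap i] [cross i (-ε), cap (i + 1)]

/-- An arc passes through the point at infinity of `S²`: the closure of the one-strand tangle `u` by
an arc on its right is replaced by the closure by an arc on its left. -/
def InfinityMove (D D' : Diagram α) : Prop :=
  ∃ (u : List (Slice α)) (b : α),
    run u [b] = some [b] ∧
    D.word = [cup 0 b] ++ u ++ [cap 0] ∧
    D'.word = [cup 0 (-b)] ++ u.map (Slice.shift 1) ++ [cap 0]

/-- Elementary isotopies of diagrams in `S²`. -/
def SphereMove (D D' : Diagram α) : Prop :=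
  (∃ u v, PlaneMove u v ∧ Replace u v D D') ∨ InfinityMove D D'

/-- A strand with a curl, on its right or on its left; the crossing of the curl has sign `ε`, for
both orientations of the strand. -/
inductive Curl (ε : ℤˣ) : List (Slice α) → Prop
  | right (i : ℕ) (b : α) : Curl ε [cup (i + 1) b, cross i ε, cap (i + 1)]
  | left (i : ℕ) (b : α) : Curl ε [cup i b, cross (i + 1) ε, cap i]

/-- Removal of a curl of sign `ε`. -/
def CurlMove (ε : ℤˣ) (D D' : Diagram α) : Prop := ∃ u, Curl ε u ∧ Replace u [] D D'

/-- Reidemeister move I. -/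
def Reidemeister1 (D D' : Diagram α) : Prop := ∃ ε, CurlMove ε D D'

/-- Reidemeister move II. -/
def Reidemeister2 (D D' : Diagram α) : Prop :=
  ∃ (i : ℕ) (ε : ℤˣ), Replace [cross i ε, cross i (-ε)] [] D D'

/-- Reidemeister move III. -/
def Reidemeister3 (D D' : Diagram α) : Prop :=
  ∃ (i : ℕ) (ε : ℤˣ), Replace [cross i ε, cross (i + 1) ε, cross i ε]
    [cross (i + 1) ε, cross i ε, cross (i + 1) ε] D D'

/-- Destruction of a tie between two points whose components coincide or belong, also without this
tie, to the same class.  (By creation and destruction of ties, the ties of a diagram can be replaced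
by any others that define the same partition of the set of components.) -/
def TieMove (D D' : Diagram α) : Prop :=
  ∃ (w₁ w₂ : List (Slice α)) (i j : ℕ),
    D.word = w₁ ++ [tie i j] ++ w₂ ∧ D'.word = w₁ ++ w₂ ∧
    TiedTogether D'.word (w₁.length, i) (w₁.length, j)

/-- One step of an ambient tie-isotopy. -/
def AmbientMove (D D' : Diagram α) : Prop :=
  SphereMove D D' ∨ Reidemeister1 D D' ∨ Reidemeister2 D D' ∨ Reidemeister3 D D' ∨ TieMove D D'

/-- Ambient tie-isotopy of diagrams. -/
def AmbientTieIsotopic : Diagram α → Diagram α → Prop := Relation.EqvGen AmbientMove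

end Moves

/-! The polynomial. -/

/-- The ring `ℤ[a^{±1}, z^{±1}, x^{-1}]`, as polynomials in `x^{-1}` over `ℤ[a^{±1}][z^{±1}]`. -/
abbrev Coeff : Type := Polynomial (LaurentPolynomial (LaurentPolynomial ℤ))

/-- The monomial `a ^ n`. -/
noncomputable def aPow (n : ℤ) : Coeff :=
  Polynomial.C (LaurentPolynomial.C (LaurentPolynomial.T n))

/-- The variable `z`. -/
noncomputable def z : Coeff := Polynomial.C (LaurentPolynomial.T 1)

/-- The variable `x^{-1}`. -/
noncomputable def xInv : Coeff := Polynomial.X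

/-- The defining rules of the Kauffman polynomial of tied links.  The first two say that it is a
function of diagrams in `S²` up to isotopy of `S²` and of the partition that the ties define. -/
structure IsTiedKauffman (L : UnorientedDiagram → Coeff) : Prop where
  sphere : ∀ D D', SphereMove D D' → L D = L D'
  tie : ∀ D D', TieMove D D' → L D = L D'
  /-- The circle. -/
  circle : ∀ D, D.word = [cup 0 (), cap 0] → L D = 1
  /-- The disjoint union `D` of `D'` with a circle that bounds a disc in a face of `D'`. -/
  union : ∀ D D', (∃ i, Replace [cup i (), cap i] [] D D') → L D = xInv * L D'
  reidemeister2 : ∀ D D', Reidemeister2 D D' → L D = L D'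
  reidemeister3 : ∀ D D', Reidemeister3 D D' → L D = L D'
  /-- A curl of sign `1` contributes `a`, a curl of sign `-1` contributes `a⁻¹`. -/
  curl : ∀ (ε : ℤˣ) D D', CurlMove ε D D' → L D = aPow (ε : ℤ) * L D'
  /-- The skein relation: `Dp` and `Dm` have opposite crossings, `De` has two vertical strands with a
  tie between them, and `Df` has a maximum below a minimum with a tie between the two arcs (in
  the sliced form the minimum is drawn beside the maximum, to the right of it, for the tie to be
  horizontal). -/
  skein : ∀ (w₁ w₂ : List (Slice Unit)) (i : ℕ) (Dp Dm De Df : UnorientedDiagram),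
    Dp.word = w₁ ++ [cross i 1] ++ w₂ →
    Dm.word = w₁ ++ [cross i (-1)] ++ w₂ →
    De.word = w₁ ++ [Slice.tie i (i + 1)] ++ w₂ →
    Df.word = w₁ ++ [cup (i + 2) (), Slice.tie (i + 1) (i + 2), cap i] ++ w₂ →
    L Dp + L Dm = z * (L De + L Df)

end TiedLink

namespace TiedLink

open Slice

/-! ### Levels of unoriented words -/

/-! Uniqueness is a reduction to normal form. A diagram cut at a level is viewed as a functional on
the words that can be put on top of it, so that slices act linearly (`act`). A layered diagram is a
pile of arcs, each in front of all earlier ones, with at most one tie added together with each arc.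
The span of the layered diagrams is stable under ties, minima, crossings and maxima (`ti_layered`,
`cu_layered`, `cr_layered`, `ca_layered`). The essential case is a crossing whose sign prevents it
from being absorbed into the pile: the skein relation trades it for the opposite crossing, and the
ties of the two smoothings do no harm because they slide along strands (`tied_smoothing`). A circle
tied to a strand contributes `z⁻¹ (a + a⁻¹) - 1`, by the skein relation at a curl
(`tied_circle_beside`); this is where `z` has to be invertible. Hence every nonempty closed diagram
is a multiple of the circle, in every module in which the local rules hold
(`exists_eq_smul_circle`). Two solutions, regarded as one functional with values in pairs, therefore
have the same coefficients. Passage of an arc through infinity is a consequence of the local rules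
(`infinity`).

Existence comes from state sums. A strand is labelled by one of `n` colours and by a basis vector of
the vector representation of the quantum symplectic group of rank `m`. A tie is the projection to
equal colours. Strands of the same colour cross by an R-matrix; strands of different colours cross
with signs whose product is `-1`, so that a crossing and its inverse add up to zero there, in
agreement with the vanishing of both tied smoothings. All operators except the inverse crossing are
shown to commute with the lowering operators. Consequently the basic identities between them need to
be checked only on words that begin with a bottom label (`eq_of_bottom`), where a crossing is a
weighted transposition (`crossOp_bottom`). The inverse crossing is defined by the skein relation,
and its properties follow formally.

One state sum yields only numbers. The parameters are chosen such that `a` takes infinitely many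
values, `z` infinitely many for each `a`, and `x⁻¹`, which is proportional to the number of colours,
infinitely many for each pair; these values separate the elements of `Coeff` (`eq_zero_of_evalX`).
All state sums together form one functional that satisfies the local rules over `Coeff`. The
reduction theorem writes its value at a diagram as `c` times its value at the circle, with a unique
`c` in `Coeff`, and this `c` is the polynomial of the diagram.

For oriented diagrams, every move except Reidemeister I preserves the writhe, and for a curl the
factor `a ^ ε` cancels against the change of the writhe by `ε` (`normalized_eq`). -/

/-- The number of strands above a slice in terms of the number of strands below it. -/
def Slice.level : Slice Unit → ℕ → Option ℕ
  | cup i _, n => if i ≤ n then some (n + 2) else none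
  | cap i, n => if i + 2 ≤ n then some (n - 2) else none
  | cross i _, n => if i + 2 ≤ n then some n else none
  | tie i j, n => if i < n ∧ j < n then some n else none

/-- The number of strands above a word in terms of the number of strands below it. -/
def levels : List (Slice Unit) → ℕ → Option ℕ
  | [], n => some n
  | c :: w, n => (c.level n).bind (levels w)

theorem level_eq_map_act (c : Slice Unit) (s : List Unit) :
    c.level s.length = (c.act s).map List.length := by
  cases c with
  | cup i b =>
    by_cases h : i ≤ s.length
    · simp [level, act, h]; omega
    · simp [level, act, h]
  | cap i =>
    rcases hd : s.drop i with _ | ⟨b, _ | ⟨c, r⟩⟩ <;>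
      have h := congrArg List.length hd <;>
      simp only [List.length_drop, List.length_cons, List.length_nil] at h <;>
      simp only [level, act, hd]
    · rw [if_neg (by omega)]; rfl
    · rw [if_neg (by omega)]; rfl
    · rw [if_pos (by omega), if_pos trivial]; simp; omega
  | cross i ε =>
    rcases hd : s.drop i with _ | ⟨b, _ | ⟨c, r⟩⟩ <;>
      have h := congrArg List.length hd <;>
      simp only [List.length_drop, List.length_cons, List.length_nil] at h <;>
      simp only [level, act, hd]
    · rw [if_neg (by omega)]; rfl
    · rw [if_neg (by omega)]; rfl
    · rw [if_pos (by omega)]; simp; omega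
  | tie i j =>
    by_cases h : i < s.length ∧ j < s.length
    · simp [level, act, h]
    · simp only [level, act, if_neg h]; rfl

theorem levels_eq_map_run (w : List (Slice Unit)) (s : List Unit) :
    levels w s.length = (run w s).map List.length := by
  induction w generalizing s with
  | nil => rfl
  | cons c w ih =>
    simp only [levels, run, level_eq_map_act]
    cases c.act s with
    | none => rfl
    | some t => simp [ih]

/-- A list over `Unit` is determined by its length, so for unoriented words only the number of
strands matters. -/
theorem run_eq_some_iff (w : List (Slice Unit)) (s t : List Unit) :
    run w s = some t ↔ levels w s.length = some t.length := by
  rw [levels_eq_map_run]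
  constructor
  · intro h; rw [h]; rfl
  · intro h
    rw [Option.map_eq_some_iff] at h
    obtain ⟨t', ht', hl⟩ := h
    rw [ht', List.ext_get hl (fun _ _ _ => rfl)]

theorem run_nil_iff (w : List (Slice Unit)) : run w [] = some [] ↔ levels w 0 = some 0 :=
  run_eq_some_iff w [] []

theorem levels_append (u v : List (Slice Unit)) (n : ℕ) :
    levels (u ++ v) n = (levels u n).bind (levels v) := by
  induction u generalizing n with
  | nil => rfl
  | cons c u ih =>
    simp only [List.cons_append, levels]
    cases c.level n with
    | none => rfl
    | some k => simp [ih]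

/-! ### Connectivity inside a word -/

theorem Linked.append_left {α : Type} (w : List (Slice α)) {u : List (Slice α)} {P Q : ℕ × ℕ}
    (h : Linked u P Q) : Linked (w ++ u) (w.length + P.1, P.2) (w.length + Q.1, Q.2) := by
  have key : ∀ k, (w ++ u)[w.length + k]? = u[k]? := fun k => by
    rw [List.getElem?_append_right (by omega)]; congr 1; omega
  cases h with
  | cup_left k i p b h h' => exact .cup_left _ i p b (by rw [key, h]) h'
  | cup_right k i p b h h' => exact .cup_right _ i p b (by rw [key, h]) h'
  | cup_arc k i b h => exact .cup_arc (w.length + k) i b (by rw [key, h])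
  | cap_left k i p h h' => exact .cap_left _ i p (by rw [key, h]) h'
  | cap_right k i p h h' => exact .cap_right _ i p (by rw [key, h]) h'
  | cap_arc k i h => exact .cap_arc _ i (by rw [key, h])
  | cross_other k i p ε h h' h'' => exact .cross_other _ i p ε (by rw [key, h]) h' h''
  | cross_right k i ε h => exact .cross_right _ i ε (by rw [key, h])
  | cross_left k i ε h => exact .cross_left _ i ε (by rw [key, h])
  | tie_other k i j p h => exact .tie_other _ i j p (by rw [key, h])
  | tie_spring k i j h => exact .tie_spring _ i j (by rw [key, h])

theorem Linked.append_right {α : Type} {u : List (Slice α)} (w : List (Slice α)) {P Q : ℕ × ℕ}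
    (h : Linked u P Q) : Linked (u ++ w) P Q := by
  have key : ∀ k c, u[k]? = some c → (u ++ w)[k]? = some c := fun k c hk => by
    rw [List.getElem?_append_left (List.getElem?_eq_some_iff.1 hk).1, hk]
  cases h with
  | cup_left k i p b h h' => exact .cup_left _ i p b (key _ _ h) h'
  | cup_right k i p b h h' => exact .cup_right _ i p b (key _ _ h) h'
  | cup_arc k i b h => exact .cup_arc _ i b (key _ _ h)
  | cap_left k i p h h' => exact .cap_left _ i p (key _ _ h) h'
  | cap_right k i p h h' => exact .cap_right _ i p (key _ _ h) h'
  | cap_arc k i h => exact .cap_arc _ i (key _ _ h)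
  | cross_other k i p ε h h' h'' => exact .cross_other _ i p ε (key _ _ h) h' h''
  | cross_right k i ε h => exact .cross_right _ i ε (key _ _ h)
  | cross_left k i ε h => exact .cross_left _ i ε (key _ _ h)
  | tie_other k i j p h => exact .tie_other _ i j p (key _ _ h)
  | tie_spring k i j h => exact .tie_spring _ i j (key _ _ h)

theorem TiedTogether.append_left {α : Type} (w : List (Slice α)) {u : List (Slice α)}
    {P Q : ℕ × ℕ} (h : TiedTogether u P Q) :
    TiedTogether (w ++ u) (w.length + P.1, P.2) (w.length + Q.1, Q.2) := by
  induction h with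
  | rel P Q h => exact .rel _ _ (h.append_left w)
  | refl P => exact .refl _
  | symm P Q _ ih => exact .symm _ _ ih
  | trans P Q T _ _ ih ih' => exact .trans _ _ _ ih ih'

theorem TiedTogether.append_right {α : Type} {u : List (Slice α)} (w : List (Slice α))
    {P Q : ℕ × ℕ} (h : TiedTogether u P Q) : TiedTogether (u ++ w) P Q :=
  h.mono fun _ _ h => h.append_right w

/-! ### Functionals on words that satisfy the local rules -/

/-- The local rules of the Kauffman polynomial of tied links, for a function on words
that vanishes on the words that are not closed diagrams. -/
structure IsTiedSkein {R : Type*} [CommRing R] (a : ℤˣ → R) (z y : R) {S : Type*} [AddCommGroup S]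
    [Module R S] (Z : List (Slice Unit) → S) : Prop where
  zero : ∀ w, levels w 0 ≠ some 0 → Z w = 0
  plane : ∀ u v, PlaneMove u v → ∀ w₁ w₂ n k, levels w₁ 0 = some n → levels u n = some k →
    levels v n = some k → Z (w₁ ++ u ++ w₂) = Z (w₁ ++ v ++ w₂)
  reidemeister2 : ∀ i ε w₁ w₂ n, levels w₁ 0 = some n → i + 2 ≤ n →
    Z (w₁ ++ [cross i ε, cross i (-ε)] ++ w₂) = Z (w₁ ++ w₂)
  reidemeister3 : ∀ i ε w₁ w₂ n, levels w₁ 0 = some n → i + 3 ≤ n →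
    Z (w₁ ++ [cross i ε, cross (i + 1) ε, cross i ε] ++ w₂) =
      Z (w₁ ++ [cross (i + 1) ε, cross i ε, cross (i + 1) ε] ++ w₂)
  curl : ∀ ε u, Curl ε u → ∀ w₁ w₂ n, levels w₁ 0 = some n → levels u n = some n →
    Z (w₁ ++ u ++ w₂) = a ε • Z (w₁ ++ w₂)
  union : ∀ i w₁ w₂ n, levels w₁ 0 = some n → i ≤ n →
    Z (w₁ ++ [cup i (), cap i] ++ w₂) = y • Z (w₁ ++ w₂)
  tie : ∀ i j w₁ w₂ n, levels w₁ 0 = some n → i < n → j < n →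
    TiedTogether (w₁ ++ w₂) (w₁.length, i) (w₁.length, j) →
    Z (w₁ ++ [tie i j] ++ w₂) = Z (w₁ ++ w₂)
  skein : ∀ i w₁ w₂ n, levels w₁ 0 = some n → i + 2 ≤ n →
    Z (w₁ ++ [cross i 1] ++ w₂) + Z (w₁ ++ [cross i (-1)] ++ w₂) =
      z • (Z (w₁ ++ [Slice.tie i (i + 1)] ++ w₂) +
        Z (w₁ ++ [cup (i + 2) (), Slice.tie (i + 1) (i + 2), cap i] ++ w₂))

section Functional

variable {R : Type*} [CommRing R] (z : R) (S : Type*) [AddCommGroup S] [Module R S]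

/-- The functionals that satisfy those local rules that hold on every number of strands. -/
def LocalFunctional : Submodule R (List (Slice Unit) → S) where
  carrier := {f | (∀ u v, PlaneMove u v → (∀ n, levels u n = levels v n) → ∀ w₁ w₂,
      f (w₁ ++ u ++ w₂) = f (w₁ ++ v ++ w₂)) ∧
    (∀ i ε w₁ w₂, f (w₁ ++ [cross i ε, cross (i + 1) ε, cross i ε] ++ w₂) =
      f (w₁ ++ [cross (i + 1) ε, cross i ε, cross (i + 1) ε] ++ w₂)) ∧
    (∀ i w₁ w₂, f (w₁ ++ [cross i 1] ++ w₂) + f (w₁ ++ [cross i (-1)] ++ w₂) =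
      z • (f (w₁ ++ [Slice.tie i (i + 1)] ++ w₂) +
        f (w₁ ++ [cup (i + 2) (), Slice.tie (i + 1) (i + 2), cap i] ++ w₂)))}
  add_mem' := by
    rintro f g ⟨h1, h2, h3⟩ ⟨h1', h2', h3'⟩
    refine ⟨fun u v h h' w₁ w₂ => ?_, fun i ε w₁ w₂ => ?_, fun i w₁ w₂ => ?_⟩
    · simp only [Pi.add_apply, h1 u v h h', h1' u v h h']
    · simp only [Pi.add_apply, h2, h2']
    · simp only [Pi.add_apply]
      rw [add_add_add_comm, h3, h3', ← smul_add, add_add_add_comm]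
  zero_mem' := by simp
  smul_mem' := by
    rintro c f ⟨h1, h2, h3⟩
    refine ⟨fun u v h h' w₁ w₂ => ?_, fun i ε w₁ w₂ => ?_, fun i w₁ w₂ => ?_⟩
    · simp only [Pi.smul_apply, h1 u v h h']
    · simp only [Pi.smul_apply, h2]
    · simp only [Pi.smul_apply]
      rw [← smul_add, h3, ← smul_add, smul_comm]

variable {z S}

/-- Precomposition of a functional with a word. -/
def act (u : List (Slice Unit)) : LocalFunctional z S →ₗ[R] LocalFunctional z S where
  toFun f := ⟨fun w => f.1 (u ++ w), by
    obtain ⟨f, h1, h2, h3⟩ := f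
    refine ⟨fun u' v h h' w₁ w₂ => ?_, fun i ε w₁ w₂ => ?_, fun i w₁ w₂ => ?_⟩
    · simpa using h1 u' v h h' (u ++ w₁) w₂
    · simpa using h2 i ε (u ++ w₁) w₂
    · simpa using h3 i (u ++ w₁) w₂⟩
  map_add' _ _ := rfl
  map_smul' _ _ := rfl

@[simp] theorem act_apply (u w : List (Slice Unit)) (f : LocalFunctional z S) :
    (act u f).1 w = f.1 (u ++ w) := rfl

theorem act_nil (f : LocalFunctional z S) : act [] f = f := rfl

/-- If `f` comes from a diagram with free ends at the top, then `act u f` comes from the same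
diagram with `u` stacked on it. Composites of operators, read from right to left, therefore list the
slices from bottom to top. -/
theorem act_append (u v : List (Slice Unit)) (f : LocalFunctional z S) :
    act (u ++ v) f = act v (act u f) :=
  Subtype.ext (funext fun w => by simp)

theorem act_cons (c : Slice Unit) (u : List (Slice Unit)) (f : LocalFunctional z S) :
    act (c :: u) f = act u (act [c] f) := act_append [c] u f

/-- A local minimum. -/
abbrev cu (i : ℕ) : LocalFunctional z S →ₗ[R] LocalFunctional z S := act [cup i ()]
/-- A local maximum. -/
abbrev ca (i : ℕ) : LocalFunctional z S →ₗ[R] LocalFunctional z S := act [cap i]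
/-- A crossing. -/
abbrev cr (i : ℕ) (ε : ℤˣ) : LocalFunctional z S →ₗ[R] LocalFunctional z S := act [cross i ε]
/-- A tie. -/
abbrev ti (i j : ℕ) : LocalFunctional z S →ₗ[R] LocalFunctional z S := act [Slice.tie i j]

/-- The second hypothesis excludes the zigzags: on too few strands one side of these is undefined
while the other is the empty word. -/
theorem act_eq_of_planeMove {u v : List (Slice Unit)} (h : PlaneMove u v)
    (h' : ∀ n, levels u n = levels v n) (f : LocalFunctional z S) : act u f = act v f :=
  Subtype.ext (funext fun w => f.2.1 u v h h' [] w)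

theorem cr_far {i j : ℕ} (h : i + 2 ≤ j) (ε ε' : ℤˣ) (f : LocalFunctional z S) :
    cr i ε (cr j ε' f) = cr j ε' (cr i ε f) := by
  obtain ⟨k, rfl⟩ := Nat.exists_eq_add_of_le' h
  simpa only [shift, act_cons _ [_]] using
    act_eq_of_planeMove (PlaneMove.far_cross (cross k ε') i ε) (fun n => Option.ext fun m => by
      simp [shift, levels, level, Option.bind_eq_some_iff]; omega) f

theorem cu_cr_far {i j : ℕ} (h : i ≤ j) (ε : ℤˣ) (f : LocalFunctional z S) :
    cu i (cr j ε f) = cr (j + 2) ε (cu i f) := by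
  obtain ⟨k, rfl⟩ := Nat.exists_eq_add_of_le' h
  simpa only [shift, act_cons _ [_], add_assoc] using
    act_eq_of_planeMove (PlaneMove.far_cup (cross k ε) i ()) (fun n => Option.ext fun m => by
      simp [shift, levels, level, Option.bind_eq_some_iff]; omega) f

theorem cr_cu_far {i j : ℕ} (h : i + 2 ≤ j) (ε : ℤˣ) (f : LocalFunctional z S) :
    cr i ε (cu j f) = cu j (cr i ε f) := by
  obtain ⟨k, rfl⟩ := Nat.exists_eq_add_of_le' h
  simpa only [shift, act_cons _ [_]] using
    act_eq_of_planeMove (PlaneMove.far_cross (cup k ()) i ε) (fun n => Option.ext fun m => by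
      simp [shift, levels, level, Option.bind_eq_some_iff]; omega) f

theorem cr_ca_far {i j : ℕ} (h : i + 2 ≤ j) (ε : ℤˣ) (f : LocalFunctional z S) :
    cr i ε (ca j f) = ca j (cr i ε f) := by
  obtain ⟨k, rfl⟩ := Nat.exists_eq_add_of_le' h
  simpa only [shift, act_cons _ [_]] using
    act_eq_of_planeMove (PlaneMove.far_cross (cap k) i ε) (fun n => Option.ext fun m => by
      simp [shift, levels, level, Option.bind_eq_some_iff]; omega) f

theorem cu_cu_far {i j : ℕ} (h : i ≤ j) (f : LocalFunctional z S) :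
    cu i (cu j f) = cu (j + 2) (cu i f) := by
  obtain ⟨k, rfl⟩ := Nat.exists_eq_add_of_le' h
  simpa only [shift, act_cons _ [_], add_assoc] using
    act_eq_of_planeMove (PlaneMove.far_cup (cup k ()) i ()) (fun n => Option.ext fun m => by
      simp [shift, levels, level, Option.bind_eq_some_iff]; omega) f

theorem ca_cr_far {i j : ℕ} (h : i ≤ j) (ε : ℤˣ) (f : LocalFunctional z S) :
    ca i (cr (j + 2) ε f) = cr j ε (ca i f) := by
  obtain ⟨k, rfl⟩ := Nat.exists_eq_add_of_le' h
  simpa only [shift, act_cons _ [_], add_assoc] using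
    act_eq_of_planeMove (PlaneMove.far_cap (cross k ε) i) (fun n => Option.ext fun m => by
      simp [shift, levels, level, Option.bind_eq_some_iff]; omega) f

theorem ca_cu_far {i j : ℕ} (h : i ≤ j) (f : LocalFunctional z S) :
    ca i (cu (j + 2) f) = cu j (ca i f) := by
  obtain ⟨k, rfl⟩ := Nat.exists_eq_add_of_le' h
  simpa only [shift, act_cons _ [_], add_assoc] using
    act_eq_of_planeMove (PlaneMove.far_cap (cup k ()) i) (fun n => Option.ext fun m => by
      simp [shift, levels, level, Option.bind_eq_some_iff]; omega) f

theorem ca_ca_far {i j : ℕ} (h : i ≤ j) (f : LocalFunctional z S) :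
    ca i (ca (j + 2) f) = ca j (ca i f) := by
  obtain ⟨k, rfl⟩ := Nat.exists_eq_add_of_le' h
  simpa only [shift, act_cons _ [_], add_assoc] using
    act_eq_of_planeMove (PlaneMove.far_cap (cap k) i) (fun n => Option.ext fun m => by
      simp [shift, levels, level, Option.bind_eq_some_iff]; omega) f

theorem cr_cu (i : ℕ) (ε : ℤˣ) (f : LocalFunctional z S) :
    cr (i + 1) ε (cu i f) = cr i (-ε) (cu (i + 1) f) := by
  simpa only [act_cons _ [_]] using
    act_eq_of_planeMove (PlaneMove.cup_cross i () ε) (fun n => Option.ext fun m => by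
      simp [levels, level, Option.bind_eq_some_iff]; omega) f

theorem ca_cr (i : ℕ) (ε : ℤˣ) (f : LocalFunctional z S) :
    ca i (cr (i + 1) ε f) = ca (i + 1) (cr i (-ε) f) := by
  simpa only [act_cons _ [_]] using
    act_eq_of_planeMove (PlaneMove.cross_cap i ε) (fun n => Option.ext fun m => by
      simp [levels, level, Option.bind_eq_some_iff]; omega) f

theorem cr_braid (i : ℕ) (ε : ℤˣ) (f : LocalFunctional z S) :
    cr i ε (cr (i + 1) ε (cr i ε f)) = cr (i + 1) ε (cr i ε (cr (i + 1) ε f)) := by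
  have : act [cross i ε, cross (i + 1) ε, cross i ε] f =
      act [cross (i + 1) ε, cross i ε, cross (i + 1) ε] f :=
    Subtype.ext (funext fun w => f.2.2.1 i ε [] w)
  simpa only [act_cons _ [_], act_cons _ [_, _]] using this

theorem cr_skein (i : ℕ) (f : LocalFunctional z S) :
    cr i 1 f + cr i (-1) f = z • (ti i (i + 1) f + ca i (ti (i + 1) (i + 2) (cu (i + 2) f))) := by
  have : cr i 1 f + cr i (-1) f = z • (ti i (i + 1) f +
      act [cup (i + 2) (), Slice.tie (i + 1) (i + 2), cap i] f) :=
    Subtype.ext (funext fun w => f.2.2.2 i [] w)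
  simpa only [act_cons _ [_], act_cons _ [_, _]] using this

end Functional

/-! ### The local rules as operator identities on diagrams with free ends -/

section Skein

variable {R : Type*} [CommRing R] {a : ℤˣ → R} {z y : R} {S : Type*} [AddCommGroup S]
  [Module R S] {Z : List (Slice Unit) → S}

theorem IsTiedSkein.eq_zero_of_levels (hZ : IsTiedSkein a z y Z) {w : List (Slice Unit)}
    (h : levels w 0 = none) : Z w = 0 := hZ.zero w (by simp [h])

/-- The rules need no condition on positions here: if the positions are out of range, all sides are
ill-formed words, on which `Z` vanishes. -/
theorem IsTiedSkein.mem_localFunctional (hZ : IsTiedSkein a z y Z) : Z ∈ LocalFunctional z S := by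
  refine ⟨fun u v h h' w₁ w₂ => ?_, fun i ε w₁ w₂ => ?_, fun i w₁ w₂ => ?_⟩
  · cases h₁ : levels w₁ 0 with
    | none => rw [hZ.eq_zero_of_levels, hZ.eq_zero_of_levels] <;> simp [levels_append, h₁]
    | some n =>
      cases hu : levels u n with
      | none =>
        have hv := hu
        rw [h'] at hv
        rw [hZ.eq_zero_of_levels, hZ.eq_zero_of_levels] <;> simp [levels_append, h₁, hu, hv]
      | some k => exact hZ.plane u v h w₁ w₂ n k h₁ hu (by rw [← h', hu])
  · cases h₁ : levels w₁ 0 with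
    | none => rw [hZ.eq_zero_of_levels, hZ.eq_zero_of_levels] <;> simp [levels_append, h₁]
    | some n =>
      by_cases hn : i + 3 ≤ n
      · exact hZ.reidemeister3 i ε w₁ w₂ n h₁ hn
      · rw [hZ.eq_zero_of_levels, hZ.eq_zero_of_levels] <;>
          refine Option.eq_none_iff_forall_ne_some.2 fun k hk => ?_ <;>
          simp [levels_append, h₁, levels, level, Option.bind_eq_some_iff] at hk <;> omega
  · cases h₁ : levels w₁ 0 with
    | none =>
      rw [hZ.eq_zero_of_levels, hZ.eq_zero_of_levels, hZ.eq_zero_of_levels,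
        hZ.eq_zero_of_levels] <;> simp [levels_append, h₁]
    | some n =>
      by_cases hn : i + 2 ≤ n
      · exact hZ.skein i w₁ w₂ n h₁ hn
      · rw [hZ.eq_zero_of_levels, hZ.eq_zero_of_levels, hZ.eq_zero_of_levels,
          hZ.eq_zero_of_levels]
        · simp
        all_goals
          refine Option.eq_none_iff_forall_ne_some.2 fun k hk => ?_
          simp [levels_append, h₁, levels, level, Option.bind_eq_some_iff] at hk
          omega

/-- `Z` as an element of the module of functionals. -/
def IsTiedSkein.base (hZ : IsTiedSkein a z y Z) : LocalFunctional z S := ⟨Z, hZ.mem_localFunctional⟩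

/-- The span of the functionals given by diagrams with `n` free ends at the top. -/
def IsTiedSkein.space (hZ : IsTiedSkein a z y Z) (n : ℕ) : Submodule R (LocalFunctional z S) :=
  Submodule.span R {f | ∃ w, levels w 0 = some n ∧ f = act w hZ.base}

variable (hZ : IsTiedSkein a z y Z) {f : LocalFunctional z S} {n : ℕ}
include hZ

theorem IsTiedSkein.base_mem : hZ.base ∈ hZ.space 0 := Submodule.subset_span ⟨[], rfl, rfl⟩

theorem IsTiedSkein.act_mem (hf : f ∈ hZ.space n) {u : List (Slice Unit)} {k : ℕ}
    (hu : levels u n = some k) : act u f ∈ hZ.space k := by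
  induction hf using Submodule.span_induction with
  | mem f h =>
    obtain ⟨w, hw, rfl⟩ := h
    exact Submodule.subset_span ⟨w ++ u, by simp [levels_append, hw, hu], by rw [act_append]⟩
  | zero => simp
  | add f g _ _ hf hg => rw [map_add]; exact add_mem hf hg
  | smul c f _ hf => rw [map_smul]; exact Submodule.smul_mem _ _ hf

/-- Linear relations between words need only be checked on diagrams. -/
theorem IsTiedSkein.ext_of_words {A B : LocalFunctional z S →ₗ[R] LocalFunctional z S}
    (h : ∀ w, levels w 0 = some n → ∀ w₂, (A (act w hZ.base)).1 w₂ = (B (act w hZ.base)).1 w₂)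
    (hf : f ∈ hZ.space n) : A f = B f :=
  LinearMap.eqOn_span (by rintro _ ⟨w, hw, rfl⟩; exact Subtype.ext (funext (h w hw))) hf

theorem IsTiedSkein.cu_mem (hf : f ∈ hZ.space n) {i : ℕ} (h : i ≤ n) :
    cu i f ∈ hZ.space (n + 2) :=
  hZ.act_mem hf (by simp [levels, level, h])

theorem IsTiedSkein.ca_mem (hf : f ∈ hZ.space (n + 2)) {i : ℕ} (h : i ≤ n) :
    ca i f ∈ hZ.space n :=
  hZ.act_mem hf (by simp [levels, level, h])

theorem IsTiedSkein.cr_mem (hf : f ∈ hZ.space n) {i : ℕ} (h : i + 2 ≤ n) (ε : ℤˣ) :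
    cr i ε f ∈ hZ.space n :=
  hZ.act_mem hf (by simp [levels, level, h])

theorem IsTiedSkein.ti_mem (hf : f ∈ hZ.space n) {i j : ℕ} (hi : i < n) (hj : j < n) :
    ti i j f ∈ hZ.space n :=
  hZ.act_mem hf (by simp [levels, level, hi, hj])

theorem IsTiedSkein.zigzag_left (hf : f ∈ hZ.space n) {i : ℕ} (h : i + 1 ≤ n) :
    ca (i + 1) (cu i f) = f :=
  hZ.ext_of_words (A := ca (i + 1) ∘ₗ cu i) (B := LinearMap.id) (fun w hw w₂ => by
    simpa [IsTiedSkein.base] using hZ.plane _ _ (.zigzag_left i ()) w w₂ n n hw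
      (by simp [levels, level, Option.bind_eq_some_iff]; omega) rfl) hf

theorem IsTiedSkein.zigzag_right (hf : f ∈ hZ.space n) {i : ℕ} (h : i + 1 ≤ n) :
    ca i (cu (i + 1) f) = f :=
  hZ.ext_of_words (A := ca i ∘ₗ cu (i + 1)) (B := LinearMap.id) (fun w hw w₂ => by
    simpa [IsTiedSkein.base] using hZ.plane _ _ (.zigzag_right i ()) w w₂ n n hw
      (by simp [levels, level, Option.bind_eq_some_iff]; omega) rfl) hf

theorem IsTiedSkein.cr_cr_neg (hf : f ∈ hZ.space n) {i : ℕ} (h : i + 2 ≤ n) (ε : ℤˣ) :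
    cr i (-ε) (cr i ε f) = f :=
  hZ.ext_of_words (A := cr i (-ε) ∘ₗ cr i ε) (B := LinearMap.id) (fun w hw w₂ => by
    simpa [IsTiedSkein.base] using hZ.reidemeister2 i ε w w₂ n hw h) hf

theorem IsTiedSkein.cr_neg_cr (hf : f ∈ hZ.space n) {i : ℕ} (h : i + 2 ≤ n) (ε : ℤˣ) :
    cr i ε (cr i (-ε) f) = f := by
  simpa using hZ.cr_cr_neg hf h (-ε)

theorem IsTiedSkein.curl_right (hf : f ∈ hZ.space n) {i : ℕ} (h : i + 1 ≤ n) (ε : ℤˣ) :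
    ca (i + 1) (cr i ε (cu (i + 1) f)) = a ε • f :=
  hZ.ext_of_words (A := ca (i + 1) ∘ₗ cr i ε ∘ₗ cu (i + 1)) (B := a ε • LinearMap.id)
    (fun w hw w₂ => by
      simpa [IsTiedSkein.base] using hZ.curl ε _ (.right i ()) w w₂ n hw
        (by simp [levels, level, Option.bind_eq_some_iff]; omega)) hf

theorem IsTiedSkein.curl_left (hf : f ∈ hZ.space n) {i : ℕ} (h : i + 1 ≤ n) (ε : ℤˣ) :
    ca i (cr (i + 1) ε (cu i f)) = a ε • f :=
  hZ.ext_of_words (A := ca i ∘ₗ cr (i + 1) ε ∘ₗ cu i) (B := a ε • LinearMap.id)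
    (fun w hw w₂ => by
      simpa [IsTiedSkein.base] using hZ.curl ε _ (.left i ()) w w₂ n hw
        (by simp [levels, level, Option.bind_eq_some_iff]; omega)) hf

theorem IsTiedSkein.ca_cu (hf : f ∈ hZ.space n) {i : ℕ} (h : i ≤ n) :
    ca i (cu i f) = y • f :=
  hZ.ext_of_words (A := ca i ∘ₗ cu i) (B := y • LinearMap.id) (fun w hw w₂ => by
    simpa [IsTiedSkein.base] using hZ.union i w w₂ n hw h) hf

/-- A tie between connected points may be removed. -/
theorem IsTiedSkein.act_ti (hf : f ∈ hZ.space n) (u v : List (Slice Unit)) {k i j : ℕ}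
    (hu : levels u n = some k) (hi : i < k) (hj : j < k)
    (h : TiedTogether (u ++ v) (u.length, i) (u.length, j)) :
    act v (ti i j (act u f)) = act v (act u f) :=
  hZ.ext_of_words (A := act v ∘ₗ ti i j ∘ₗ act u) (B := act v ∘ₗ act u) (fun w hw w₂ => by
    simpa [IsTiedSkein.base] using hZ.tie i j (w ++ u) (v ++ w₂) k
      (by simp [levels_append, hw, hu]) hi hj (by
        simpa using (h.append_left w).append_right w₂)) hf

end Skein
end TiedLink

namespace TiedLink

open Slice

/-! ### Curls, slides and ties -/

/-- The strand at position `q` passes over `k` strands to its right. -/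
def slide (q : ℕ) : ℕ → List (Slice Unit)
  | 0 => []
  | k + 1 => slide q k ++ [cross (q + k) 1]

@[simp] theorem length_slide (q k : ℕ) : (slide q k).length = k := by
  induction k with
  | zero => rfl
  | succ k ih => simp [slide, ih]

theorem levels_slide {q k n : ℕ} (h : q + k + 1 ≤ n) : levels (slide q k) n = some n := by
  induction k with
  | zero => rfl
  | succ k ih => simp [slide, levels_append, ih (by omega), levels, level]; omega

/-- The position above `slide q k` of the strand that is at position `p` below it. -/
def slidePos (q k p : ℕ) : ℕ := if p = q then q + k else if q < p ∧ p ≤ q + k then p - 1 else p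

theorem Linked.tiedTogether {α : Type} {w : List (Slice α)} {P Q : ℕ × ℕ} (h : Linked w P Q) :
    TiedTogether w P Q := .rel _ _ h

theorem TiedTogether.refl' {α : Type} (w : List (Slice α)) (P : ℕ × ℕ) :
    TiedTogether w P P := .refl _

theorem TiedTogether.trans {α : Type} {w : List (Slice α)} {P Q T : ℕ × ℕ}
    (h : TiedTogether w P Q) (h' : TiedTogether w Q T) : TiedTogether w P T :=
  Relation.EqvGen.trans _ _ _ h h'

theorem TiedTogether.symm {α : Type} {w : List (Slice α)} {P Q : ℕ × ℕ}
    (h : TiedTogether w P Q) : TiedTogether w Q P :=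
  Relation.EqvGen.symm _ _ h

theorem TiedTogether.comp {α : Type} {u v : List (Slice α)} {P Q T : ℕ × ℕ} {p : ℕ}
    (h : TiedTogether u P (u.length, p)) (h' : TiedTogether v (0, p) Q)
    (hT : T = (u.length + Q.1, Q.2)) : TiedTogether (u ++ v) P T := by
  subst hT
  exact (h.append_right v).trans (by simpa using h'.append_left u)

theorem tiedTogether_slide (q k p : ℕ) :
    TiedTogether (slide q k) (0, p) (k, slidePos q k p) := by
  induction k with
  | zero =>
    have : slidePos q 0 p = p := by unfold slidePos; split_ifs <;> omega
    rw [this]; exact .refl _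
  | succ k ih =>
    refine TiedTogether.comp (p := slidePos q k p) (Q := (1, slidePos q (k + 1) p))
      (by simpa using ih) ?_ (by simp)
    by_cases h1 : p = q
    · have e1 : slidePos q k p = q + k := by simp [slidePos, h1]
      have e2 : slidePos q (k + 1) p = q + k + 1 := by simp [slidePos, h1]; omega
      rw [e1, e2]
      exact (Linked.cross_right 0 (q + k) 1 rfl).tiedTogether
    by_cases h2 : p = q + k + 1
    · have e1 : slidePos q k p = q + k + 1 := by unfold slidePos; split_ifs <;> omega
      have e2 : slidePos q (k + 1) p = q + k := by unfold slidePos; split_ifs <;> omega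
      rw [e1, e2]
      exact (Linked.cross_left 0 (q + k) 1 rfl).tiedTogether
    · have e : slidePos q (k + 1) p = slidePos q k p := by
        unfold slidePos; split_ifs <;> omega
      rw [e]
      refine (Linked.cross_other 0 (q + k) _ 1 rfl ?_ ?_).tiedTogether <;>
        (unfold slidePos; split_ifs <;> omega)

/-- The position above a crossing. -/
theorem tiedTogether_cross (i p : ℕ) (ε : ℤˣ) :
    TiedTogether [cross (α := Unit) i ε] (0, p) (1, Equiv.swap i (i + 1) p) := by
  by_cases h1 : p = i
  · subst h1; rw [Equiv.swap_apply_left]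
    exact (Linked.cross_right 0 p ε rfl).tiedTogether
  by_cases h2 : p = i + 1
  · subst h2; rw [Equiv.swap_apply_right]
    exact (Linked.cross_left 0 i ε rfl).tiedTogether
  · rw [Equiv.swap_apply_of_ne_of_ne h1 h2]
    exact (Linked.cross_other 0 i p ε rfl h1 h2).tiedTogether

/-! ### Over-strands and ties sliding along words -/

section Skein

variable {R : Type*} [CommRing R] {a : ℤˣ → R} {z y : R} {S : Type*} [AddCommGroup S]
  [Module R S] {Z : List (Slice Unit) → S}

theorem act_slide_succ (q k : ℕ) (f : LocalFunctional z S) :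
    act (slide q (k + 1)) f = cr (q + k) 1 (act (slide q k) f) := act_append _ _ _

theorem slide_cr_far {q k i : ℕ} (h : q + k + 1 ≤ i) (ε : ℤˣ) (f : LocalFunctional z S) :
    act (slide q k) (cr i ε f) = cr i ε (act (slide q k) f) := by
  induction k with
  | zero => rfl
  | succ k ih => rw [act_slide_succ, act_slide_succ, ih (by omega), cr_far (by omega)]

theorem slide_cu_far {q k i : ℕ} (h : q + k + 1 ≤ i) (f : LocalFunctional z S) :
    act (slide q k) (cu i f) = cu i (act (slide q k) f) := by
  induction k with
  | zero => rfl
  | succ k ih => rw [act_slide_succ, act_slide_succ, ih (by omega), cr_cu_far (by omega)]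

theorem slide_ca_far {q k i : ℕ} (h : q + k + 1 ≤ i) (f : LocalFunctional z S) :
    act (slide q k) (ca i f) = ca i (act (slide q k) f) := by
  induction k with
  | zero => rfl
  | succ k ih => rw [act_slide_succ, act_slide_succ, ih (by omega), cr_ca_far (by omega)]

variable (hZ : IsTiedSkein a z y Z) {f : LocalFunctional z S} {n : ℕ}
include hZ

theorem IsTiedSkein.slide_mem (hf : f ∈ hZ.space n) {q k : ℕ} (h : q + k + 1 ≤ n) :
    act (slide q k) f ∈ hZ.space n := hZ.act_mem hf (levels_slide h)

/-- A curl of sign `-ε` on the right branch of a maximum is pulled over the top; its crossing then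
lies below the maximum with sign `ε`, and the rest is a zigzag that straightens. -/
theorem IsTiedSkein.ca_cr_self (hf : f ∈ hZ.space (n + 2)) {i : ℕ} (h : i ≤ n) (ε : ℤˣ) :
    ca i (cr i ε f) = a (-ε) • ca i f := by
  have h1 := congrArg (ca i) (hZ.curl_right hf (i := i + 1) (by omega) (-ε))
  rw [ca_ca_far le_rfl, ca_cr, cr_cu_far le_rfl, neg_neg,
    hZ.zigzag_right (hZ.cr_mem hf (by omega) ε) (by omega), map_smul] at h1
  exact h1

theorem IsTiedSkein.cr_cu_self (hf : f ∈ hZ.space n) {i : ℕ} (h : i ≤ n) (ε : ℤˣ) :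
    cr i ε (cu i f) = a (-ε) • cu i f := by
  have hg := hZ.cu_mem hf h
  have h1 := hZ.curl_right hg (i := i + 1) (by omega) (-ε)
  rw [← cu_cu_far le_rfl, cr_cu, ← cr_ca_far le_rfl, hZ.zigzag_left hg (by omega), neg_neg] at h1
  exact h1

/-- Reidemeister III is only postulated for three equal signs. For `ε = -1` it is obtained from the
case of sign `1` by cancelling crossings with Reidemeister II. -/
theorem IsTiedSkein.cr_braid_mixed (hf : f ∈ hZ.space n) {i : ℕ} (h : i + 3 ≤ n) (ε : ℤˣ) :
    cr (i + 1) 1 (cr i 1 (cr (i + 1) ε f)) = cr i ε (cr (i + 1) 1 (cr i 1 f)) := by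
  rcases Int.units_eq_one_or ε with rfl | rfl
  · exact (cr_braid i 1 f).symm
  · have hg := hZ.cr_mem hf (i := i + 1) (by omega) (-1)
    have h2 := cr_braid i 1 (cr (i + 1) (-1) f)
    rw [hZ.cr_neg_cr hf (by omega)] at h2
    rw [← h2, hZ.cr_cr_neg (hZ.cr_mem (hZ.cr_mem hg (by omega) _) (by omega) _) (by omega)]

/-- The strand in front passes a crossing of either sign. The last two crossings of the slide do
this when the crossing is rightmost; all later crossings of the slide are far away from it, which is
the induction on `d`. -/
theorem IsTiedSkein.slide_cr (hf : f ∈ hZ.space n) {q k i : ℕ} (h : q + k + 1 ≤ n) (hi : q ≤ i)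
    (hik : i + 2 ≤ q + k) (ε : ℤˣ) :
    act (slide q k) (cr (i + 1) ε f) = cr i ε (act (slide q k) f) := by
  obtain ⟨d, hd⟩ := Nat.exists_eq_add_of_le hik
  induction d generalizing k with
  | zero =>
    obtain ⟨l, rfl⟩ : ∃ l, k = l + 2 := ⟨k - 2, by omega⟩
    obtain rfl : i = q + l := by omega
    have hg := hZ.slide_mem hf (q := q) (k := l) (by omega)
    simp only [act_slide_succ]
    rw [slide_cr_far (by omega), ← add_assoc, hZ.cr_braid_mixed hg (by omega)]
  | succ d ih =>
    obtain ⟨l, rfl⟩ : ∃ l, k = l + 1 := ⟨k - 1, by omega⟩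
    rw [act_slide_succ, act_slide_succ, ih (by omega) (by omega) (by omega),
      ← cr_far (i := i) (by omega)]

/-- Passing over both branches of a minimum creates two crossings; after one of them is rotated
around the minimum, they cancel by Reidemeister II. -/
theorem IsTiedSkein.slide_cu (hf : f ∈ hZ.space n) {q k i : ℕ} (h : q + k + 1 ≤ n) (hi : q ≤ i)
    (hik : i ≤ q + k) :
    act (slide q (k + 2)) (cu (i + 1) f) = cu i (act (slide q k) f) := by
  obtain ⟨d, hd⟩ := Nat.exists_eq_add_of_le hik
  induction d generalizing k with
  | zero =>
    obtain rfl : i = q + k := by omega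
    have hg := hZ.slide_mem hf (q := q) (k := k) (by omega)
    simp only [act_slide_succ]
    have h1 := cr_cu (q + k) (-1) (act (slide q k) f)
    rw [neg_neg] at h1
    rw [slide_cu_far (by omega), ← h1, ← add_assoc,
      hZ.cr_neg_cr (hZ.cu_mem hg (by omega)) (by omega)]
  | succ d ih =>
    obtain ⟨l, rfl⟩ : ∃ l, k = l + 1 := ⟨k - 1, by omega⟩
    rw [act_slide_succ, act_slide_succ q l, ih (by omega) (by omega) (by omega),
      cu_cr_far (by omega), ← add_assoc]

theorem IsTiedSkein.slide_ca (hf : f ∈ hZ.space n) {q k i : ℕ} (h : q + k + 3 ≤ n) (hi : q ≤ i)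
    (hik : i ≤ q + k) :
    act (slide q k) (ca (i + 1) f) = ca i (act (slide q (k + 2)) f) := by
  obtain ⟨d, hd⟩ := Nat.exists_eq_add_of_le hik
  induction d generalizing k with
  | zero =>
    obtain rfl : i = q + k := by omega
    have hg := hZ.slide_mem hf (q := q) (k := k) (by omega)
    simp only [act_slide_succ]
    rw [slide_ca_far (by omega), ← add_assoc, ca_cr, hZ.cr_cr_neg hg (by omega)]
  | succ d ih =>
    obtain ⟨l, rfl⟩ : ∃ l, k = l + 1 := ⟨k - 1, by omega⟩
    rw [act_slide_succ, act_slide_succ q (l + 2), ih (by omega) (by omega) (by omega),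
      ← ca_cr_far (by omega), ← add_assoc]

/-- Two ties that define the same partition may be exchanged. -/
theorem IsTiedSkein.ti_congr (hf : f ∈ hZ.space n) (u v : List (Slice Unit)) {k i j i' j' : ℕ}
    (hu : levels u n = some k) (hi : i < k) (hj : j < k) (hi' : i' < k) (hj' : j' < k)
    (h : TiedTogether (u ++ [Slice.tie i j] ++ v) (u.length + 1, i') (u.length + 1, j'))
    (h' : TiedTogether (u ++ [Slice.tie i' j'] ++ v) (u.length, i) (u.length, j)) :
    act v (ti i j (act u f)) = act v (ti i' j' (act u f)) := by
  have h1 := hZ.act_ti hf (u ++ [Slice.tie i j]) v (i := i') (j := j') (k := k)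
    (by simp [levels_append, hu, levels, level, hi, hj]) hi' hj' (by simpa using h)
  have h2 := hZ.act_ti hf u ([Slice.tie i' j'] ++ v) (i := i) (j := j) (k := k) hu hi hj
    (by simpa using h')
  rw [act_append] at h1 h2
  rw [← h1, h2, act_append]

/-- A tie slides along the strands of a word. -/
theorem IsTiedSkein.act_ti_eq (hf : f ∈ hZ.space n) (u : List (Slice Unit)) {k i j i' j' : ℕ}
    (hu : levels u n = some k) (hi : i < n) (hj : j < n) (hi' : i' < k) (hj' : j' < k)
    (h : TiedTogether u (0, i) (u.length, i')) (h' : TiedTogether u (0, j) (u.length, j')) :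
    act u (ti i j f) = ti i' j' (act u f) := by
  have h1 := hZ.act_ti hf ([Slice.tie i j] ++ u) [] (i := i') (j := j') (k := k)
    (by simp [levels, level, hi, hj, hu]) hi' hj' (by
      have e := fun p => (Linked.tie_other (w := [Slice.tie (α := Unit) i j] ++ u)
        0 i j p rfl).tiedTogether
      have s := (Linked.tie_spring (w := [Slice.tie (α := Unit) i j] ++ u) 0 i j rfl).tiedTogether
      have a1 := h.append_left [Slice.tie i j]
      have a2 := h'.append_left [Slice.tie i j]
      simp only [List.length_append, List.length_singleton, add_zero, List.append_nil] at a1 a2 ⊢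
      exact a1.symm.trans ((e i).symm.trans (s.trans ((e j).trans a2))))
  have h2 := hZ.act_ti hf [] (u ++ [Slice.tie i' j']) (i := i) (j := j) (k := n) rfl hi hj (by
      have s := (Linked.tie_spring (w := u ++ [Slice.tie (α := Unit) i' j']) u.length i' j'
        (by simp)).tiedTogether
      exact (h.append_right _).trans (s.trans (h'.append_right _).symm))
  simp only [act_append, act_nil] at h1 h2
  exact h1.symm.trans h2

theorem IsTiedSkein.ti_self (hf : f ∈ hZ.space n) {i : ℕ} (hi : i < n) : ti i i f = f :=
  hZ.act_ti hf [] [] rfl hi hi (.refl' _ _)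

theorem IsTiedSkein.ti_symm (hf : f ∈ hZ.space n) {i j : ℕ} (hi : i < n) (hj : j < n) :
    ti i j f = ti j i f :=
  hZ.ti_congr hf [] [] rfl hi hj hj hi
    ((Linked.tie_other 0 i j j rfl).tiedTogether.symm.trans
      ((Linked.tie_spring 0 i j rfl).tiedTogether.symm.trans
        (Linked.tie_other 0 i j i rfl).tiedTogether))
    (Linked.tie_spring 0 j i rfl).tiedTogether.symm

theorem IsTiedSkein.ti_comm (hf : f ∈ hZ.space n) {i j k l : ℕ} (hi : i < n) (hj : j < n)
    (hk : k < n) (hl : l < n) : ti i j (ti k l f) = ti k l (ti i j f) :=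
  hZ.act_ti_eq hf [Slice.tie i j] (by simp [levels, level, hi, hj]) hk hl hk hl
    (Linked.tie_other 0 i j k rfl).tiedTogether (Linked.tie_other 0 i j l rfl).tiedTogether

/-- The end of a tie slides along a strand of the word below. -/
theorem IsTiedSkein.ti_move_below (hf : f ∈ hZ.space n) (u : List (Slice Unit)) {k i i' j : ℕ}
    (hu : levels u n = some k) (hi : i < k) (hi' : i' < k) (hj : j < k)
    (h : TiedTogether u (u.length, i) (u.length, i')) :
    ti i j (act u f) = ti i' j (act u f) := by
  refine hZ.ti_congr hf u [] hu hi hj hi' hj ?_ ?_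
  · rw [List.append_nil]
    have e := fun p => (Linked.tie_other (w := u ++ [Slice.tie (α := Unit) i j])
      u.length i j p (by simp)).tiedTogether
    have s := (Linked.tie_spring (w := u ++ [Slice.tie (α := Unit) i j])
      u.length i j (by simp)).tiedTogether
    exact (e i').symm.trans ((h.append_right _).symm.trans (s.trans (e j)))
  · rw [List.append_nil]
    have s := (Linked.tie_spring (w := u ++ [Slice.tie (α := Unit) i' j])
      u.length i' j (by simp)).tiedTogether
    exact (h.append_right _).trans s

/-- The end of a tie slides along a cap above. -/
theorem IsTiedSkein.ca_ti_move (hf : f ∈ hZ.space n) {i j : ℕ} (hi : i + 2 ≤ n) (hj : j < n) :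
    ca i (ti (i + 1) j f) = ca i (ti i j f) := by
  refine hZ.ti_congr hf [] [cap i] rfl (by omega) hj (by omega) hj ?_ ?_
  · exact (Linked.cap_arc 1 i rfl).tiedTogether.trans
      ((Linked.tie_other 0 (i + 1) j (i + 1) rfl).tiedTogether.symm.trans
        ((Linked.tie_spring 0 (i + 1) j rfl).tiedTogether.trans
        (Linked.tie_other 0 (i + 1) j j rfl).tiedTogether))
  · exact (Linked.tie_other 0 i j (i + 1) rfl).tiedTogether.trans
      ((Linked.cap_arc 1 i rfl).tiedTogether.symm.trans
      ((Linked.tie_other 0 i j i rfl).tiedTogether.symm.trans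
        (Linked.tie_spring 0 i j rfl).tiedTogether))

omit hZ in
theorem swap_lt {i p : ℕ} (h : i + 2 ≤ n) (hp : p < n) : Equiv.swap i (i + 1) p < n := by
  rw [Equiv.swap_apply_def]; split_ifs <;> omega

theorem IsTiedSkein.cr_ti (hf : f ∈ hZ.space n) {i p q : ℕ} (h : i + 2 ≤ n) (hp : p < n)
    (hq : q < n) (ε : ℤˣ) :
    cr i ε (ti p q f) = ti (Equiv.swap i (i + 1) p) (Equiv.swap i (i + 1) q) (cr i ε f) :=
  hZ.act_ti_eq hf [cross i ε] (by simp [levels, level, h]) hp hq (swap_lt h hp) (swap_lt h hq)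
    (tiedTogether_cross i p ε) (tiedTogether_cross i q ε)

/-- The position above a cup. -/
def cupPos (i p : ℕ) : ℕ := if p < i then p else p + 2

omit hZ in
theorem tiedTogether_cup (i p : ℕ) :
    TiedTogether [cup i ()] (0, p) (1, cupPos i p) := by
  unfold cupPos
  split_ifs with h
  · exact (Linked.cup_left 0 i p () rfl h).tiedTogether
  · exact (Linked.cup_right 0 i p () rfl (by omega)).tiedTogether

omit hZ in
theorem tiedTogether_cap (i p : ℕ) :
    TiedTogether [cap (α := Unit) i] (0, cupPos i p) (1, p) := by
  unfold cupPos
  split_ifs with h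
  · exact (Linked.cap_left 0 i p rfl h).tiedTogether
  · exact (Linked.cap_right 0 i p rfl (by omega)).tiedTogether

omit hZ in
theorem cupPos_lt {i p : ℕ} (hp : p < n) : cupPos i p < n + 2 := by
  unfold cupPos; split_ifs <;> omega

theorem IsTiedSkein.cu_ti (hf : f ∈ hZ.space n) {i p q : ℕ} (h : i ≤ n) (hp : p < n)
    (hq : q < n) : cu i (ti p q f) = ti (cupPos i p) (cupPos i q) (cu i f) :=
  hZ.act_ti_eq hf [cup i ()] (by simp [levels, level, h]) hp hq (cupPos_lt hp) (cupPos_lt hq)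
    (tiedTogether_cup i p) (tiedTogether_cup i q)

theorem IsTiedSkein.ca_ti (hf : f ∈ hZ.space (n + 2)) {i p q : ℕ} (h : i ≤ n) (hp : p < n)
    (hq : q < n) : ca i (ti (cupPos i p) (cupPos i q) f) = ti p q (ca i f) :=
  hZ.act_ti_eq hf [cap i] (by simp [levels, level, h]) (cupPos_lt hp) (cupPos_lt hq) hp hq
    (tiedTogether_cap i p) (tiedTogether_cap i q)

theorem IsTiedSkein.slide_ti (hf : f ∈ hZ.space n) {q k i j : ℕ} (h : q + k + 1 ≤ n) (hi : i < n)
    (hj : j < n) :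
    act (slide q k) (ti i j f) = ti (slidePos q k i) (slidePos q k j) (act (slide q k) f) := by
  refine hZ.act_ti_eq hf (slide q k) (levels_slide h) hi hj ?_ ?_ ?_ ?_
  · unfold slidePos; split_ifs <;> omega
  · unfold slidePos; split_ifs <;> omega
  · simpa using tiedTogether_slide q k i
  · simpa using tiedTogether_slide q k j

/-- An over-strand passes from the left to the right of a word. -/
theorem IsTiedSkein.slide_act_shift (u : List (Slice Unit)) {k : ℕ} (hf : f ∈ hZ.space (n + 1))
    (hu : levels u n = some k) :
    act (slide 0 k) (act (u.map (Slice.shift 1)) f) = act u (act (slide 0 n) f) := by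
  induction u generalizing f n with
  | nil => obtain rfl : n = k := by simpa [levels] using hu
           rfl
  | cons c u ih =>
    simp only [levels, Option.bind_eq_some_iff] at hu
    obtain ⟨l, hl, hu⟩ := hu
    have key : act (slide 0 l) (act [c.shift 1] f) = act [c] (act (slide 0 n) f) ∧
        act [c.shift 1] f ∈ hZ.space (l + 1) := by
      cases c with
      | cup i b =>
        simp only [level, Option.ite_none_right_eq_some, Option.some.injEq] at hl
        obtain ⟨hi, rfl⟩ := hl
        exact ⟨hZ.slide_cu hf (by omega) (by omega) (by omega), hZ.cu_mem hf (by omega)⟩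
      | cap i =>
        simp only [level, Option.ite_none_right_eq_some, Option.some.injEq] at hl
        obtain ⟨hi, rfl⟩ := hl
        obtain ⟨n, rfl⟩ : ∃ m, n = m + 2 := ⟨n - 2, by omega⟩
        exact ⟨hZ.slide_ca hf (by simp) (by omega) (by simp; omega), hZ.ca_mem hf (by simp; omega)⟩
      | cross i ε =>
        simp only [level, Option.ite_none_right_eq_some, Option.some.injEq] at hl
        obtain ⟨hi, rfl⟩ := hl
        exact ⟨hZ.slide_cr hf (by omega) (by omega) (by omega) ε, hZ.cr_mem hf (by omega) ε⟩
      | tie i j =>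
        simp only [level, Option.ite_none_right_eq_some, Option.some.injEq] at hl
        obtain ⟨hi, rfl⟩ := hl
        refine ⟨?_, hZ.ti_mem hf (by omega) (by omega)⟩
        have := hZ.slide_ti hf (q := 0) (k := n) (i := i + 1) (j := j + 1) (by omega) (by omega)
          (by omega)
        have e : ∀ i, i < n → slidePos 0 n (i + 1) = i := fun i hi => by
          rw [slidePos, if_neg (by omega), if_pos (by omega), Nat.add_sub_cancel]
        rw [e i hi.1, e j hi.2] at this
        exact this
    rw [List.map_cons, act_cons, ih key.2 hu, key.1, ← act_cons]

/-- An arc may pass through the point at infinity. -/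
theorem IsTiedSkein.infinity (ha : a 1 * a (-1) = 1) {u : List (Slice Unit)}
    (hu : levels u 1 = some 1) :
    Z ([cup 0 ()] ++ u.map (Slice.shift 1) ++ [cap 0]) = Z ([cup 0 ()] ++ u ++ [cap 0]) := by
  have hf := hZ.cu_mem hZ.base_mem (i := 0) le_rfl
  have h1 := hZ.slide_act_shift u (n := 1) hf hu
  have hm : act (u.map (Slice.shift 1)) (cu 0 hZ.base) ∈ hZ.space 2 := by
    refine hZ.act_mem hf ?_
    clear h1 hf
    have : ∀ (u : List (Slice Unit)) n k, levels u n = some k →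
        levels (u.map (Slice.shift 1)) (n + 1) = some (k + 1) := by
      intro u
      induction u with
      | nil => simp [levels]
      | cons c u ih =>
        intro n k h
        simp only [levels, Option.bind_eq_some_iff] at h
        obtain ⟨l, hl, hu⟩ := h
        simp only [List.map_cons, levels, Option.bind_eq_some_iff]
        refine ⟨l + 1, ?_, ih l k hu⟩
        cases c <;> simp [level, Slice.shift] at hl ⊢ <;> omega
    exact this u 1 1 hu
  have e : ∀ g : LocalFunctional z S, act (slide 0 1) g = cr 0 1 g := fun g => rfl
  -- The arc has been swept in front of `u`. The crossing left over is absorbed by the minimum on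
  -- one side and by the maximum on the other; both give the factor `a (-1)`, which is invertible
  -- and cancels.
  rw [e, e, hZ.cr_cu_self hZ.base_mem le_rfl] at h1
  have h2 := hZ.ca_cr_self (i := 0) hm le_rfl 1
  rw [h1, map_smul, map_smul] at h2
  have h3 := congrArg (fun g => a 1 • g) h2
  simp only [smul_smul, ha, one_smul] at h3
  simpa [IsTiedSkein.base] using (congrArg (fun g => g.1 []) h3).symm

end Skein
end TiedLink

namespace TiedLink

open Slice

/-! ### Layered arcs -/

/-- An arc that joins position `0` to position `j + 1` and passes over all other strands. -/
def arcWord (j : ℕ) : List (Slice Unit) := [cup 0 ()] ++ slide 1 j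

@[simp] theorem length_arcWord (j : ℕ) : (arcWord j).length = j + 1 := by
  simp [arcWord]

theorem levels_arcWord {j n : ℕ} (h : j ≤ n) : levels (arcWord j) n = some (n + 2) := by
  rw [arcWord, levels_append]
  simp only [levels, level, Nat.zero_le, if_true, Option.bind_some]
  exact levels_slide (by omega)

/-- The position above `arcWord j` of the strand that is at position `p` below it. -/
def arcPos (j p : ℕ) : ℕ := if p < j then p + 1 else p + 2

theorem arcPos_lt {j p n : ℕ} (h : p < n) : arcPos j p < n + 2 := by
  unfold arcPos; split_ifs <;> omega

theorem arc_position {j p n : ℕ} (hj : j ≤ n) (h : p < n + 2) :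
    p = 0 ∨ p = j + 1 ∨ ∃ q < n, p = arcPos j q := by
  by_cases h0 : p = 0
  · exact .inl h0
  by_cases h1 : p = j + 1
  · exact .inr (.inl h1)
  refine .inr (.inr ?_)
  by_cases h2 : p < j + 1
  · exact ⟨p - 1, by omega, by unfold arcPos; split_ifs <;> omega⟩
  · exact ⟨p - 2, by omega, by unfold arcPos; split_ifs <;> omega⟩

theorem tiedTogether_arc (j p : ℕ) :
    TiedTogether (arcWord j) (0, p) (j + 1, arcPos j p) := by
  refine TiedTogether.comp (u := [cup 0 ()]) (p := p + 2) (Q := (j, arcPos j p))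
    (Linked.cup_right 0 0 p () rfl (by omega)).tiedTogether ?_ (by simp [add_comm])
  have := tiedTogether_slide 1 j (p + 2)
  have e : slidePos 1 j (p + 2) = arcPos j p := by
    unfold slidePos arcPos; split_ifs <;> omega
  rwa [e] at this

theorem tiedTogether_arc_ends (j : ℕ) :
    TiedTogether (arcWord j) (j + 1, 0) (j + 1, j + 1) := by
  have h0 := (tiedTogether_slide 1 j 0).append_left [cup 0 ()]
  have h1 := (tiedTogether_slide 1 j 1).append_left [cup 0 ()]
  have h := (Linked.cup_arc (w := [cup 0 ()] ++ slide 1 j) 0 0 () rfl).tiedTogether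
  have e0 : slidePos 1 j 0 = 0 := by rw [slidePos, if_neg (by omega), if_neg (by omega)]
  have e1 : slidePos 1 j 1 = j + 1 := by rw [slidePos, if_pos rfl, add_comm]
  rw [e0] at h0
  rw [e1] at h1
  simp only [List.length_singleton, add_zero, add_comm 1 j] at h0 h1
  exact h0.symm.trans (h.trans h1)

/-! ### Layered arcs as operators -/

section Skein

variable {R : Type*} [CommRing R] {a : ℤˣ → R} {z y : R} {S : Type*} [AddCommGroup S]
  [Module R S] {Z : List (Slice Unit) → S}

/-- The functional given by a layered arc. -/
abbrev arc (j : ℕ) : LocalFunctional z S →ₗ[R] LocalFunctional z S := act (arcWord j)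

theorem arc_eq (j : ℕ) (f : LocalFunctional z S) : arc j f = act (slide 1 j) (cu 0 f) :=
  act_append _ _ _

theorem arc_zero (f : LocalFunctional z S) : arc 0 f = cu 0 f := rfl

theorem arc_succ (j : ℕ) (f : LocalFunctional z S) : arc (j + 1) f = cr (j + 1) 1 (arc j f) := by
  rw [arc_eq, arc_eq, act_slide_succ, add_comm]

theorem arc_cr_far {i j : ℕ} (h : j ≤ i) (ε : ℤˣ) (f : LocalFunctional z S) :
    arc j (cr i ε f) = cr (i + 2) ε (arc j f) := by
  rw [arc_eq, arc_eq, cu_cr_far (Nat.zero_le _), slide_cr_far (by omega)]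

theorem arc_cu_far {i j : ℕ} (h : j ≤ i) (f : LocalFunctional z S) :
    arc j (cu i f) = cu (i + 2) (arc j f) := by
  rw [arc_eq, arc_eq, cu_cu_far (Nat.zero_le _), slide_cu_far (by omega)]

variable (hZ : IsTiedSkein a z y Z) {f : LocalFunctional z S} {n : ℕ}
include hZ

theorem IsTiedSkein.arc_mem (hf : f ∈ hZ.space n) {j : ℕ} (h : j ≤ n) :
    arc j f ∈ hZ.space (n + 2) := hZ.act_mem hf (levels_arcWord h)

theorem IsTiedSkein.arc_cr (hf : f ∈ hZ.space n) {i j : ℕ} (h : i + 2 ≤ j) (hj : j ≤ n) (ε : ℤˣ) :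
    arc j (cr i ε f) = cr (i + 1) ε (arc j f) := by
  rw [arc_eq, arc_eq, cu_cr_far (Nat.zero_le _)]
  exact hZ.slide_cr (hZ.cu_mem hf (Nat.zero_le _)) (by omega) (by omega) (by omega) ε

theorem IsTiedSkein.arc_cu (hf : f ∈ hZ.space n) {i j : ℕ} (h : i ≤ j) (hj : j ≤ n) :
    arc (j + 2) (cu i f) = cu (i + 1) (arc j f) := by
  rw [arc_eq, arc_eq, cu_cu_far (Nat.zero_le _)]
  exact hZ.slide_cu (hZ.cu_mem hf (Nat.zero_le _)) (by omega) (by omega) (by omega)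

theorem IsTiedSkein.arc_ti (hf : f ∈ hZ.space n) {p q j : ℕ} (hj : j ≤ n) (hp : p < n)
    (hq : q < n) : arc j (ti p q f) = ti (arcPos j p) (arcPos j q) (arc j f) :=
  hZ.act_ti_eq hf _ (levels_arcWord hj) hp hq (arcPos_lt hp) (arcPos_lt hq)
    (by simpa using tiedTogether_arc j p) (by simpa using tiedTogether_arc j q)

theorem IsTiedSkein.ti_arc_move (hf : f ∈ hZ.space n) {q j : ℕ} (hj : j ≤ n) (hq : q < n + 2) :
    ti (j + 1) q (arc j f) = ti 0 q (arc j f) :=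
  hZ.ti_move_below hf _ (levels_arcWord hj) (by omega) (by omega) hq
    (by simpa using (tiedTogether_arc_ends j).symm)

theorem IsTiedSkein.ti_arc_ends (hf : f ∈ hZ.space n) {j : ℕ} (hj : j ≤ n) :
    ti 0 (j + 1) (arc j f) = arc j f := by
  have hg := hZ.arc_mem hf hj
  rw [hZ.ti_symm hg (by omega) (by omega), hZ.ti_arc_move hf hj (by omega), hZ.ti_self hg (by omega)]

/-- Two arcs exchange their left ends. -/
theorem IsTiedSkein.cr_arc_arc (hf : f ∈ hZ.space n) {k l : ℕ} (hkl : k ≤ l) (hl : l ≤ n) :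
    cr 0 (-1) (arc (l + 2) (arc k f)) = arc (k + 1) (arc l f) := by
  obtain ⟨d, rfl⟩ := Nat.exists_eq_add_of_le hkl
  clear hkl
  induction k generalizing d with
  | zero =>
    induction d with
    | zero =>
      -- The front arc is pulled off the minimum behind it; then the crossing is rotated around a
      -- minimum.
      rw [arc_zero, hZ.arc_cu hf le_rfl (by omega), arc_zero, arc_succ, arc_zero]
      exact (cr_cu 0 1 _).symm
    | succ d ih =>
      rw [zero_add, add_right_comm, arc_succ, cr_far (by omega), ← zero_add d, ih (by omega),
        zero_add, zero_add, arc_succ d, arc_cr_far (by omega)]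
  | succ k ih =>
    have e : k + 1 + d = k + (d + 1) := by omega
    have hg := hZ.arc_mem hf (j := k) (by omega)
    rw [arc_succ k, hZ.arc_cr hg (by omega) (by omega), cr_far (by omega), e,
      ih (d + 1) (by omega), ← arc_succ]

/-- A crossing next to a doubled arc, tied, in terms of the arc turned back. -/
theorem IsTiedSkein.tied_smoothing (hf : f ∈ hZ.space n) (u : List (Slice Unit)) {k i s : ℕ}
    (hu : levels u n = some (k + 2)) (hi : i ≤ k) (hs : s < k + 2) (hsi : s ≠ i) (hsi' : s ≠ i + 1)
    (h : TiedTogether u (u.length, i) (u.length, s) ∨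
      TiedTogether u (u.length, i + 1) (u.length, s)) :
    ca i (ti (i + 1) (i + 2) (cu (i + 2) (act u f))) = ti s i (cu i (ca i (act u f))) := by
  have hg := hZ.act_mem hf hu
  have hg' := hZ.cu_mem hg (i := i + 2) (by omega)
  have hc := fun p => (tiedTogether_cup (i + 2) p).append_left u
  simp only [add_zero] at hc
  have hcu : levels (u ++ [cup (i + 2) ()]) n = some (k + 2 + 2) := by
    simp [levels_append, hu, levels, level, hi]
  have ei : cupPos (i + 2) i = i := by simp [cupPos]
  have ei' : cupPos (i + 2) (i + 1) = i + 1 := by simp [cupPos]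
  -- The end of the tie leaves the maximum: it moves along `u` from the branch at `p` to the
  -- position `s`, which the maximum does not touch.
  have key : ∀ p, TiedTogether u (u.length, p) (u.length, s) → cupPos (i + 2) p = p →
      p < k + 2 →
      ti p (i + 2) (cu (i + 2) (act u f)) = ti (cupPos (i + 2) s) (i + 2)
        (cu (i + 2) (act u f)) := fun p hp e hpk => by
    have := hZ.ti_move_below hf (u ++ [cup (i + 2) ()]) hcu (i := p) (i' := cupPos (i + 2) s)
      (j := i + 2) (by omega) (cupPos_lt hs) (by omega) (by
        have h1 := hc p
        rw [e] at h1
        simp only [List.length_append, List.length_singleton]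
        exact h1.symm.trans ((hp.append_right _).trans (hc s)))
    simpa only [act_append] using this
  have e2 : cupPos i s = cupPos (i + 2) s := by
    unfold cupPos; split_ifs <;> omega
  have e3 : cupPos i i = i + 2 := by simp [cupPos]
  have goal : ca i (ti (cupPos (i + 2) s) (i + 2) (cu (i + 2) (act u f))) =
      ti s i (cu i (ca i (act u f))) := by
    have := hZ.ca_ti (n := k + 2) hg' (i := i) (p := s) (q := i) (by omega) hs (by omega)
    rw [e2, e3] at this
    rw [this, ca_cu_far le_rfl]
  rcases h with h | h
  · rw [hZ.ca_ti_move hg' (by omega) (by omega), key i h ei (by omega), goal]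
  · rw [key (i + 1) h ei' (by omega), goal]

/-- A circle next to a strand to which it is tied. -/
theorem IsTiedSkein.tied_circle_beside {zi : R} (hz : zi * z = 1) (hf : f ∈ hZ.space n) {p : ℕ}
    (hp : p < n) : ca (p + 1) (ti (p + 1) p (cu (p + 1) f)) = (zi * (a 1 + a (-1)) - 1) • f := by
  have hg := hZ.cu_mem hf (i := p + 1) (by omega)
  -- Skein relation at the crossing of a curl: the crossings give `a 1` and `a (-1)`, one smoothing
  -- is the tied circle, the other is the strand itself.
  have h1 := hZ.curl_right hf (i := p) hp 1
  have h2 := hZ.curl_right hf (i := p) hp (-1)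
  have h3 := congrArg (ca (p + 1)) (cr_skein p (cu (p + 1) f))
  rw [map_add, h1, h2, map_smul, map_add] at h3
  -- In the second smoothing both ends of the tie lie on one strand, so the tie may be dropped, and
  -- two zigzags remain.
  have h4 : ca (p + 1) (ca p (ti (p + 1) (p + 2) (cu (p + 2) (cu (p + 1) f)))) = f := by
    have h5 := hZ.act_ti hf [cup (p + 1) (), cup (p + 2) ()] [cap p, cap (p + 1)] (i := p + 1)
      (j := p + 2) (k := n + 2 + 2) (by simp [levels, level, Option.bind_eq_some_iff]; omega)
      (by omega) (by omega) (by
        let w : List (Slice Unit) := [cup (p + 1) (), cup (p + 2) (), cap p, cap (p + 1)]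
        change TiedTogether w (2, p + 1) (2, p + 2)
        have s1 : TiedTogether w (1, p + 1) (2, p + 1) :=
          (Linked.cup_left 1 (p + 2) (p + 1) () rfl (by omega)).tiedTogether
        have s2 : TiedTogether w (1, p + 1) (1, p + 2) :=
          (Linked.cup_arc 0 (p + 1) () rfl).tiedTogether
        have s3 : TiedTogether w (1, p + 2) (2, p + 4) :=
          (Linked.cup_right 1 (p + 2) (p + 2) () rfl (by omega)).tiedTogether
        have s4 : TiedTogether w (2, p + 4) (3, p + 2) :=
          (Linked.cap_right 2 p (p + 2) rfl (by omega)).tiedTogether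
        have s5 : TiedTogether w (3, p + 1) (3, p + 2) :=
          (Linked.cap_arc 3 (p + 1) rfl).tiedTogether
        have s6 : TiedTogether w (2, p + 3) (3, p + 1) :=
          (Linked.cap_right 2 p (p + 1) rfl (by omega)).tiedTogether
        have s7 : TiedTogether w (2, p + 2) (2, p + 3) :=
          (Linked.cup_arc 1 (p + 2) () rfl).tiedTogether
        exact s1.symm.trans (s2.trans (s3.trans (s4.trans (s5.symm.trans
          (s6.symm.trans s7.symm))))))
    simp only [act_cons _ [_]] at h5
    rw [h5, ca_cu_far le_rfl, hZ.zigzag_right hf hp, hZ.zigzag_left hf hp]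
  rw [h4, hZ.ti_symm hg (by omega) (by omega)] at h3
  have h5 := congrArg (fun g => zi • g) h3
  simp only [smul_smul, hz, one_smul, ← add_smul] at h5
  refine (eq_sub_of_add_eq h5.symm).trans ?_
  conv_lhs => rw [← one_smul R f, smul_smul, mul_one]
  exact (sub_smul _ _ _).symm

/-- A circle on the left that is tied to a strand. -/
theorem IsTiedSkein.tied_circle {zi : R} (hz : zi * z = 1) (hf : f ∈ hZ.space n) {p : ℕ}
    (hp : p < n) : ca 0 (ti 0 (p + 2) (cu 0 f)) = (zi * (a 1 + a (-1)) - 1) • f := by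
  -- The circle passes one strand to its left by a pair of Reidemeister II crossings, which carry
  -- along the tie.
  have step : ∀ i P, i + 1 ≤ n → P < n + 2 → P ≠ i + 1 →
      ca (i + 1) (ti (i + 1) P (cu (i + 1) f)) = ca i (ti i
        (Equiv.swap (i + 1) (i + 1 + 1) (Equiv.swap i (i + 1) P)) (cu i f)) := by
    intro i P hi hP hPi
    have hg := hZ.cu_mem hf (i := i) (by omega)
    have hg1 := hZ.cr_mem hg (i := i + 1) (by omega) (-1)
    have hg2 := hZ.cr_mem hg1 (i := i) (by omega) (-1)
    have e1 : cu (i + 1) f = cr i (-1) (cr (i + 1) (-1) (cu i f)) := by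
      rw [cr_cu, hZ.cr_neg_cr (hZ.cu_mem hf hi) (by omega) (-1)]
    have e2 : ∀ g ∈ hZ.space (n + 2), ca (i + 1) g = ca i (cr (i + 1) 1 (cr i 1 g)) := by
      intro g hg
      rw [ca_cr, hZ.cr_cr_neg hg (by omega)]
    have c1 := hZ.cr_neg_cr hg1 (i := i) (by omega) 1
    have c2 := hZ.cr_neg_cr hg (i := i + 1) (by omega) 1
    rw [e1, e2 _ (hZ.ti_mem hg2 (by omega) hP), hZ.cr_ti hg2 (by omega) (by omega) hP, c1,
      hZ.cr_ti hg1 (by omega) (swap_lt (by omega) (by omega)) (swap_lt (by omega) hP),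
      c2, Equiv.swap_apply_right,
      Equiv.swap_apply_of_ne_of_ne (a := i + 1) (b := i + 1 + 1) (by omega) (by omega)]
  have main : ∀ i ≤ p, ca i (ti i (p + 2) (cu i f)) = ca 0 (ti 0 (p + 2) (cu 0 f)) := by
    intro i
    induction i with
    | zero => intro _; rfl
    | succ i ih =>
      intro hi
      rw [step i (p + 2) (by omega) (by omega) (by omega),
        Equiv.swap_apply_of_ne_of_ne (a := i) (by omega) (by omega),
        Equiv.swap_apply_of_ne_of_ne (a := i + 1) (by omega) (by omega), ih (by omega)]
  -- Next to the strand at `p` the circle is known; passing that very strand moves the other end of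
  -- the tie to `p + 2`.
  have last := step p p (by omega) (by omega) (by omega)
  rw [hZ.tied_circle_beside hz hf hp, Equiv.swap_apply_left, Equiv.swap_apply_left,
    main p le_rfl] at last
  exact last.symm

/-! ### Normal forms -/

/-- The span of the layered diagrams without closed components with `2 * m` ends. -/
def IsTiedSkein.layered : ℕ → Submodule R (LocalFunctional z S)
  | 0 => Submodule.span R {hZ.base}
  | m + 1 => Submodule.span R {g | ∃ t ∈ IsTiedSkein.layered m, ∃ j ≤ 2 * m,
      g = arc j t ∨ ∃ p < 2 * m + 2, g = ti 0 p (arc j t)}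

theorem IsTiedSkein.arc_layered {m j : ℕ} (hf : f ∈ hZ.layered m) (hj : j ≤ 2 * m) :
    arc j f ∈ hZ.layered (m + 1) := Submodule.subset_span ⟨f, hf, j, hj, .inl rfl⟩

theorem IsTiedSkein.layered_induction {m : ℕ} (P : Submodule R (LocalFunctional z S))
    (h : ∀ t ∈ hZ.layered m, ∀ j ≤ 2 * m, arc j t ∈ P)
    (h' : ∀ t ∈ hZ.layered m, ∀ j ≤ 2 * m, arc j t ∈ P → ∀ p < 2 * m + 2, ti 0 p (arc j t) ∈ P)
    (hf : f ∈ hZ.layered (m + 1)) : f ∈ P := by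
  refine (Submodule.span_le.2 ?_ : hZ.layered (m + 1) ≤ P) hf
  rintro g ⟨t, ht, j, hj, rfl | ⟨p, hp, rfl⟩⟩
  · exact h t ht j hj
  · exact h' t ht j hj (h t ht j hj) p hp

theorem IsTiedSkein.mem_space_of_layered {m : ℕ} (hf : f ∈ hZ.layered m) :
    f ∈ hZ.space (2 * m) := by
  induction m generalizing f with
  | zero =>
    refine (Submodule.span_le.2 ?_ : hZ.layered 0 ≤ hZ.space 0) hf
    rintro _ rfl
    exact hZ.base_mem
  | succ m ih =>
    refine hZ.layered_induction _ (fun t ht j hj => hZ.arc_mem (ih ht) hj)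
      (fun t ht j hj h p hp => hZ.ti_mem h (by omega) hp) hf

/-- One optional tie per layer suffices. A tie that avoids the newest arc belongs to the layers
behind it, and if the newest arc is already tied to an older strand, then any further tie that ends
on it can be moved to that strand. -/
theorem IsTiedSkein.ti_layered {m p q : ℕ} (hp : p < 2 * m) (hq : q < 2 * m)
    (hf : f ∈ hZ.layered m) : ti p q f ∈ hZ.layered m := by
  induction m generalizing f p q with
  | zero => omega
  | succ m ih =>
    have tie0 : ∀ t ∈ hZ.layered m, ∀ j ≤ 2 * m, ∀ r < 2 * m + 2,
        ti 0 r (arc j t) ∈ hZ.layered (m + 1) := fun t ht j hj r hr =>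
      Submodule.subset_span ⟨t, ht, j, hj, .inr ⟨r, hr, rfl⟩⟩
    have one : ∀ t ∈ hZ.layered m, ∀ j ≤ 2 * m, ∀ p < 2 * m + 2, ∀ q < 2 * m + 2,
        ti p q (arc j t) ∈ hZ.layered (m + 1) := by
      intro t ht j hj p hp q hq
      have hs := hZ.mem_space_of_layered ht
      have hg := hZ.arc_mem hs hj
      have ends : ∀ q < 2 * m + 2, ∀ p, p = 0 ∨ p = j + 1 →
          ti p q (arc j t) ∈ hZ.layered (m + 1) := by
        rintro q hq _ (rfl | rfl)
        · exact tie0 t ht j hj q hq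
        · rw [hZ.ti_arc_move hs hj hq]; exact tie0 t ht j hj q hq
      rcases arc_position hj hp with h | h | ⟨p', hp', rfl⟩
      · exact ends q hq p (.inl h)
      · exact ends q hq p (.inr h)
      rcases arc_position hj hq with h | h | ⟨q', hq', rfl⟩
      · rw [hZ.ti_symm hg hp hq]; exact ends _ hp q (.inl h)
      · rw [hZ.ti_symm hg hp hq]; exact ends _ hp q (.inr h)
      · rw [← hZ.arc_ti hs hj hp' hq']
        exact hZ.arc_layered (ih hp' hq' ht) hj
    refine hZ.layered_induction ((hZ.layered (m + 1)).comap (ti p q))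
      (fun t ht j hj => one t ht j hj p hp q hq) (fun t ht j hj _ r hr => ?_) hf
    rw [Submodule.mem_comap]
    have hs := hZ.mem_space_of_layered ht
    have hg := hZ.arc_mem hs hj
    have hg' := hZ.ti_mem hg (i := 0) (j := r) (by omega) hr
    rcases arc_position hj hr with rfl | rfl | ⟨r', hr', rfl⟩
    · rw [hZ.ti_self hg (by omega)]; exact one t ht j hj p hp q hq
    · rw [hZ.ti_arc_ends hs hj]; exact one t ht j hj p hp q hq
    have lifts : ∀ p' < 2 * m, ∀ q' < 2 * m,
        ti (arcPos j p') (arcPos j q') (ti 0 (arcPos j r') (arc j t)) ∈ hZ.layered (m + 1) := by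
      intro p' hp' q' hq'
      rw [hZ.ti_comm hg (arcPos_lt hp') (arcPos_lt hq') (by omega) hr, ← hZ.arc_ti hs hj hp' hq']
      exact tie0 _ (ih hp' hq' ht) j hj _ hr
    have hw : levels (arcWord j ++ [Slice.tie 0 (arcPos j r')]) (2 * m) = some (2 * m + 2) := by
      rw [levels_append, levels_arcWord hj]
      simp [levels, level, hr]
    have e := fun i => (Linked.tie_other (w := arcWord j ++ [Slice.tie 0 (arcPos j r')])
      (j + 1) 0 (arcPos j r') i (by simp)).tiedTogether
    have toR : ∀ p, p = 0 ∨ p = j + 1 →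
        TiedTogether (arcWord j ++ [Slice.tie 0 (arcPos j r')]) (j + 2, p) (j + 2, arcPos j r') := by
      have s := (Linked.tie_spring (w := arcWord j ++ [Slice.tie 0 (arcPos j r')])
        (j + 1) 0 (arcPos j r') (by simp)).tiedTogether
      rintro _ (rfl | rfl)
      · exact (e _).symm.trans (s.trans (e _))
      · exact (e _).symm.trans (((tiedTogether_arc_ends j).append_right _).symm.trans
          (s.trans (e _)))
    have move : ∀ p, p = 0 ∨ p = j + 1 → ∀ q < 2 * m + 2,
        ti p q (ti 0 (arcPos j r') (arc j t)) =
          ti (arcPos j r') q (ti 0 (arcPos j r') (arc j t)) := by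
      intro p hp q hq
      have := hZ.ti_move_below hs _ hw (i := p) (i' := arcPos j r') (j := q) (by omega) hr hq
        (by simpa using toR p hp)
      simpa only [act_append] using this
    -- Both ends of the new tie are moved, if necessary, to strands of the older layers; `lifts`
    -- then applies.
    have red : ∀ p < 2 * m + 2, ∃ p' < 2 * m, ∀ q < 2 * m + 2,
        ti p q (ti 0 (arcPos j r') (arc j t)) =
          ti (arcPos j p') q (ti 0 (arcPos j r') (arc j t)) := by
      intro p hp
      rcases arc_position hj hp with h | h | ⟨p', hp', rfl⟩
      · exact ⟨r', hr', move p (.inl h)⟩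
      · exact ⟨r', hr', move p (.inr h)⟩
      · exact ⟨p', hp', fun _ _ => rfl⟩
    obtain ⟨p', hp', h1⟩ := red p hp
    obtain ⟨q', hq', h2⟩ := red q hq
    rw [h1 q hq, hZ.ti_symm hg' (arcPos_lt hp') hq, h2 _ (arcPos_lt hp')]
    exact lifts q' hq' p' hp'

/-- A minimum at the far left is a layer of its own. Any other one passes behind the newest arc, or
lies to the right of it, and reaches the older layers. -/
theorem IsTiedSkein.cu_layered {m i : ℕ} (hi : i ≤ 2 * m) (hf : f ∈ hZ.layered m) :
    cu i f ∈ hZ.layered (m + 1) := by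
  induction m generalizing f i with
  | zero =>
    obtain rfl : i = 0 := by omega
    exact hZ.arc_layered hf le_rfl
  | succ m ih =>
    rcases i with _ | i
    · exact hZ.arc_layered hf (Nat.zero_le _)
    have hc : ∀ t ∈ hZ.layered m, ∀ j ≤ 2 * m, cu (i + 1) (arc j t) ∈ hZ.layered (m + 2) := by
      intro t ht j hj
      have hs := hZ.mem_space_of_layered ht
      by_cases h : i ≤ j
      · rw [← hZ.arc_cu hs h hj]
        exact hZ.arc_layered (ih (by omega) ht) (by omega)
      · obtain ⟨i, rfl⟩ : ∃ k, i = k + 1 := ⟨i - 1, by omega⟩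
        rw [← arc_cu_far (by omega)]
        exact hZ.arc_layered (ih (by omega) ht) (by omega)
    refine hZ.layered_induction ((hZ.layered (m + 2)).comap (cu (i + 1))) hc
      (fun t ht j hj _ p hp => ?_) hf
    have hg := hZ.arc_mem (hZ.mem_space_of_layered ht) hj
    rw [Submodule.mem_comap, hZ.cu_ti hg hi (by omega) hp]
    exact hZ.ti_layered (cupPos_lt (n := 2 * m + 2) (by omega)) (cupPos_lt hp) (hc t ht j hj)

end Skein
end TiedLink

namespace TiedLink

open Slice

section Skein

variable {R : Type*} [CommRing R] {a : ℤˣ → R} {z y : R} {S : Type*} [AddCommGroup S]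
  [Module R S] {Z : List (Slice Unit) → S}

variable (hZ : IsTiedSkein a z y Z) {f : LocalFunctional z S} {n : ℕ}
include hZ

/-! ### Layered diagrams are closed under crossings and maxima -/

/-- The maximum joins the right end of the front arc to the strand next to it. Retracting the arc to
its minimum, where a zigzag disappears, turns its crossings into crossings of the older layers,
which `hm` allows. -/
theorem IsTiedSkein.ca_arc_layered {m : ℕ}
    (hm : ∀ f ∈ hZ.layered m, ∀ i, i + 2 ≤ 2 * m → ∀ ε, cr i ε f ∈ hZ.layered m) {j : ℕ}
    (hj : j + 1 ≤ 2 * m) (hf : f ∈ hZ.layered m) : ca (j + 1) (arc j f) ∈ hZ.layered m := by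
  induction j generalizing f with
  | zero =>
    rw [arc_zero, hZ.zigzag_left (hZ.mem_space_of_layered hf) hj]
    exact hf
  | succ j ih =>
    have h := ca_cr (j + 1) (-1) (arc j f)
    rw [neg_neg] at h
    rw [arc_succ, ← h, ← arc_cr_far le_rfl]
    exact ih (by omega) (hm f hf j (by omega) _)

/-- The maximum closes the left end of the arc. For `j = 0` this produces a circle and for `j = 1` a
curl; the remaining crossings of a longer arc lie to the right and become crossings of the older
layers. -/
theorem IsTiedSkein.ca_zero_arc_layered {m : ℕ}
    (hm : ∀ f ∈ hZ.layered m, ∀ i, i + 2 ≤ 2 * m → ∀ ε, cr i ε f ∈ hZ.layered m) {j : ℕ}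
    (hj : j ≤ 2 * m) (hf : f ∈ hZ.layered m) : ca 0 (arc j f) ∈ hZ.layered m := by
  rcases j with _ | j
  · rw [arc_zero, hZ.ca_cu (hZ.mem_space_of_layered hf) (Nat.zero_le _)]
    exact Submodule.smul_mem _ _ hf
  induction j with
  | zero =>
    rw [arc_succ, arc_zero, hZ.curl_left (hZ.mem_space_of_layered hf) (by omega)]
    exact Submodule.smul_mem _ _ hf
  | succ j ih =>
    rw [arc_succ, ca_cr_far (Nat.zero_le _)]
    exact hm _ (ih (by omega)) j (by omega) 1

/-- If one crossing can be removed, the opposite crossing can be removed too. -/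
theorem IsTiedSkein.cr_layered_of_sign {m i j s : ℕ} (hf : f ∈ hZ.layered m) (hj : j ≤ 2 * m)
    (hi : i ≤ 2 * m) (hs : s < 2 * m + 2) (hsi : s ≠ i) (hsi' : s ≠ i + 1)
    (h : TiedTogether (arcWord j) (j + 1, i) (j + 1, s) ∨
      TiedTogether (arcWord j) (j + 1, i + 1) (j + 1, s))
    (hca : ca i (arc j f) ∈ hZ.layered m) {ε₀ : ℤˣ}
    (h₀ : cr i ε₀ (arc j f) ∈ hZ.layered (m + 1)) (ε : ℤˣ) :
    cr i ε (arc j f) ∈ hZ.layered (m + 1) := by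
  -- In the skein relation one smoothing is the tied arc. In the other, the tie slides along the arc
  -- to its end at `s`, and what remains is a tie and a minimum on top of the diagram in `hca`.
  have key := hZ.tied_smoothing (hZ.mem_space_of_layered hf) (arcWord j) (levels_arcWord hj) hi hs
    hsi hsi' (by simpa using h)
  have h1 : cr i 1 (arc j f) + cr i (-1) (arc j f) ∈ hZ.layered (m + 1) := by
    rw [cr_skein, key]
    refine Submodule.smul_mem _ _ (add_mem ?_ ?_)
    · exact hZ.ti_layered (by omega) (by omega) (hZ.arc_layered hf hj)
    · exact hZ.ti_layered hs (by omega) (hZ.cu_layered hi hca)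
  rcases Int.units_eq_one_or ε₀ with rfl | rfl <;> rcases Int.units_eq_one_or ε with rfl | rfl
  · exact h₀
  · exact (Submodule.add_mem_iff_right _ h₀).1 h1
  · exact (Submodule.add_mem_iff_left _ h₀).1 h1
  · exact h₀

/-- For `j > 0` the crossing joins the left ends of the two newest arcs. For one of its signs,
determined by the order of their right ends, `cr_arc_arc` exchanges the two layers; the other sign
follows by the skein relation. -/
theorem IsTiedSkein.cr_zero_arc_layered {m j : ℕ}
    (hm : ∀ f ∈ hZ.layered m, ∀ i, i + 2 ≤ 2 * m → ∀ ε, cr i ε f ∈ hZ.layered m)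
    (hj : j ≤ 2 * m) (hf : f ∈ hZ.layered m) (ε : ℤˣ) :
    cr 0 ε (arc j f) ∈ hZ.layered (m + 1) := by
  rcases j with _ | j
  · rw [arc_zero, hZ.cr_cu_self (hZ.mem_space_of_layered hf) (Nat.zero_le _)]
    exact Submodule.smul_mem _ _ (hZ.arc_layered hf (Nat.zero_le _))
  obtain ⟨m, rfl⟩ : ∃ k, m = k + 1 := ⟨m - 1, by omega⟩
  have hc : ∀ t ∈ hZ.layered m, ∀ k ≤ 2 * m,
      cr 0 ε (arc (j + 1) (arc k t)) ∈ hZ.layered (m + 2) := by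
    intro t ht k hk
    have hs := hZ.mem_space_of_layered ht
    have hkl := hZ.arc_layered ht hk
    have sign : ∀ ε₀, cr 0 ε₀ (arc (j + 1) (arc k t)) ∈ hZ.layered (m + 2) →
        cr 0 ε (arc (j + 1) (arc k t)) ∈ hZ.layered (m + 2) := fun ε₀ h₀ =>
      hZ.cr_layered_of_sign (s := j + 2) hkl hj (Nat.zero_le _) (by omega) (by omega) (by omega)
        (.inl (tiedTogether_arc_ends (j + 1))) (hZ.ca_zero_arc_layered hm hj hkl) h₀ ε
    rcases lt_or_ge j (k + 1) with h | h
    · refine sign 1 ?_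
      have e := hZ.cr_arc_arc hs (k := j) (l := k) (by omega) hk
      have hb := hZ.arc_mem (hZ.arc_mem hs (j := j) (by omega)) (j := k + 2) (by omega)
      rw [← e, hZ.cr_neg_cr hb (by omega)]
      exact hZ.arc_layered (hZ.arc_layered ht (by omega)) (by omega)
    · refine sign (-1) ?_
      obtain ⟨l, rfl⟩ : ∃ l, j = l + 1 := ⟨j - 1, by omega⟩
      rw [hZ.cr_arc_arc hs (by omega) (by omega)]
      exact hZ.arc_layered (hZ.arc_layered ht (by omega)) (by omega)
  refine hZ.layered_induction ((hZ.layered (m + 2)).comap (cr 0 ε ∘ₗ arc (j + 1))) hc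
    (fun t ht k hk _ r hr => ?_) hf
  have hg := hZ.arc_mem (hZ.mem_space_of_layered ht) hk
  have hg' := hZ.arc_mem hg hj
  simp only [Submodule.mem_comap, LinearMap.comp_apply]
  rw [hZ.arc_ti hg hj (by omega) hr, hZ.cr_ti hg' (by omega) (arcPos_lt (by omega)) (arcPos_lt hr)]
  exact hZ.ti_layered (swap_lt (by omega) (arcPos_lt (n := 2 * m + 2) (by omega)))
    (swap_lt (by omega) (arcPos_lt (n := 2 * m + 2) hr)) (hc t ht k hk)

/-- Away from the ends of the newest arc the crossing passes to the older layers. Just left of its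
right end, the crossing `-1` undoes the last crossing of the arc; just right of it, the crossing `1`
prolongs the arc. In both cases the opposite sign follows by the skein relation. -/
theorem IsTiedSkein.cr_layered {m : ℕ} : ∀ f ∈ hZ.layered m, ∀ i, i + 2 ≤ 2 * m →
    ∀ ε, cr i ε f ∈ hZ.layered m := by
  induction m with
  | zero => intro f _ i hi; omega
  | succ m ih =>
    intro f hf i hi ε
    have hc : ∀ t ∈ hZ.layered m, ∀ j ≤ 2 * m, cr i ε (arc j t) ∈ hZ.layered (m + 1) := by
      intro t ht j hj
      have hs := hZ.mem_space_of_layered ht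
      rcases i with _ | i
      · exact hZ.cr_zero_arc_layered ih hj ht ε
      rcases Nat.lt_or_ge (i + 1) j with h1 | h1
      · rw [← hZ.arc_cr hs h1 hj]
        exact hZ.arc_layered (ih t ht i (by omega) ε) hj
      rcases Nat.eq_or_lt_of_le h1 with rfl | h2
      · refine hZ.cr_layered_of_sign (s := 0) ht hj (by omega) (by omega) (by omega) (by omega)
          (.inr (tiedTogether_arc_ends (i + 1)).symm) ?_ (ε₀ := -1) ?_ ε
        · rw [arc_succ, hZ.ca_cr_self (hZ.arc_mem hs (by omega)) hj]
          exact Submodule.smul_mem _ _ (hZ.ca_arc_layered ih hj ht)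
        · rw [arc_succ, hZ.cr_cr_neg (hZ.arc_mem hs (by omega)) (by omega)]
          exact hZ.arc_layered ht (by omega)
      rcases Nat.eq_or_lt_of_le (Nat.le_of_lt_succ h2) with rfl | h3
      · refine hZ.cr_layered_of_sign (s := 0) ht hj (by omega) (by omega) (by omega) (by omega)
          (.inl (tiedTogether_arc_ends j).symm) (hZ.ca_arc_layered ih (by omega) ht) (ε₀ := 1) ?_ ε
        rw [← arc_succ]
        exact hZ.arc_layered ht (by omega)
      · obtain ⟨i, rfl⟩ : ∃ k, i = k + 1 := ⟨i - 1, by omega⟩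
        rw [← arc_cr_far (by omega)]
        exact hZ.arc_layered (ih t ht i (by omega) ε) hj
    refine hZ.layered_induction ((hZ.layered (m + 1)).comap (cr i ε)) hc
      (fun t ht j hj _ p hp => ?_) hf
    have hg := hZ.arc_mem (hZ.mem_space_of_layered ht) hj
    rw [Submodule.mem_comap, hZ.cr_ti hg hi (by omega) hp]
    exact hZ.ti_layered (swap_lt hi (by omega)) (swap_lt hi hp) (hc t ht j hj)

theorem IsTiedSkein.ca_layered {zi : R} (hz : zi * z = 1) {m i : ℕ} (hi : i ≤ 2 * m)
    (hf : f ∈ hZ.layered (m + 1)) : ca i f ∈ hZ.layered m := by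
  induction i generalizing f with
  | zero =>
    refine hZ.layered_induction ((hZ.layered m).comap (ca 0))
      (fun t ht j hj => hZ.ca_zero_arc_layered hZ.cr_layered hj ht)
      (fun t ht j hj hc r hr => ?_) hf
    rw [Submodule.mem_comap] at hc ⊢
    have hs := hZ.mem_space_of_layered ht
    have hg := hZ.arc_mem hs hj
    rcases r with _ | _ | r
    · rwa [hZ.ti_self hg (by omega)]
    · rw [hZ.ti_symm hg (by omega) (by omega), hZ.ca_ti_move hg (by omega) (by omega),
        hZ.ti_self hg (by omega)]
      exact hc
    -- If the tied arc is closed without crossings, it is a circle tied to another strand. Otherwise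
    -- the tie is moved to the right end of the arc, which survives the maximum.
    rcases j with _ | j
    · rw [arc_zero, add_assoc, hZ.tied_circle hz hs (by omega)]
      exact Submodule.smul_mem _ _ ht
    · rw [← hZ.ti_arc_move hs hj hr]
      have := hZ.ca_ti (n := 2 * m) hg (i := 0) (p := j) (q := r) (by omega) (by omega) (by omega)
      simp only [cupPos, Nat.not_lt_zero, if_false] at this
      rw [add_assoc, add_assoc, this]
      exact hZ.ti_layered (by omega) (by omega) hc
  | succ i ih =>
    have hs := hZ.mem_space_of_layered hf
    -- A maximum is moved one place to the left at the cost of two crossings, which preserve layered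
    -- diagrams.
    have h := ca_cr i 1 (cr i 1 f)
    rw [hZ.cr_cr_neg hs (by omega)] at h
    rw [← h]
    exact ih (by omega) (hZ.cr_layered _ (hZ.cr_layered _ hf i (by omega) 1) _ (by omega) 1)

theorem IsTiedSkein.act_base_layered {zi : R} (hz : zi * z = 1) (w : List (Slice Unit)) {n : ℕ}
    (hw : levels w 0 = some n) : ∃ m, n = 2 * m ∧ act w hZ.base ∈ hZ.layered m := by
  induction w using List.reverseRecOn generalizing n with
  | nil =>
    obtain rfl : 0 = n := by simpa [levels] using hw
    exact ⟨0, rfl, Submodule.subset_span rfl⟩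
  | append_singleton w c ih =>
    rw [levels_append, Option.bind_eq_some_iff] at hw
    obtain ⟨k, hk, hc⟩ := hw
    obtain ⟨m, rfl, hm⟩ := ih hk
    simp only [levels, Option.bind_fun_some] at hc
    rw [act_append]
    cases c with
    | cup i b =>
      simp only [level, Option.ite_none_right_eq_some, Option.some.injEq] at hc
      exact ⟨m + 1, by omega, hZ.cu_layered hc.1 hm⟩
    | cap i =>
      simp only [level, Option.ite_none_right_eq_some, Option.some.injEq] at hc
      obtain ⟨m, rfl⟩ : ∃ k, m = k + 1 := ⟨m - 1, by omega⟩
      exact ⟨m, by omega, hZ.ca_layered hz (by omega) hm⟩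
    | cross i ε =>
      simp only [level, Option.ite_none_right_eq_some, Option.some.injEq] at hc
      exact ⟨m, by omega, hZ.cr_layered _ hm i hc.1 ε⟩
    | tie i j =>
      simp only [level, Option.ite_none_right_eq_some, Option.some.injEq] at hc
      exact ⟨m, by omega, hZ.ti_layered hc.1.1 hc.1.2 hm⟩

/-- The local rules express the value of every diagram in terms of the value of the circle. -/
theorem IsTiedSkein.exists_eq_smul_circle {zi : R} (hz : zi * z = 1) {w : List (Slice Unit)}
    (hw : levels w 0 = some 0) (hne : w ≠ []) : ∃ c : R, Z w = c • Z [cup 0 (), cap 0] := by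
  -- The last slice is set aside. It has to be a maximum closing a single arc, so the circle appears
  -- instead of the empty diagram, and the coefficient needs no inverse of `y`.
  obtain ⟨w, c, rfl⟩ := (List.eq_nil_or_concat' w).resolve_left hne
  rw [levels_append, Option.bind_eq_some_iff] at hw
  obtain ⟨k, hk, hc⟩ := hw
  obtain ⟨m, rfl, hm⟩ := hZ.act_base_layered hz w hk
  simp only [levels, Option.bind_fun_some] at hc
  cases c with
  | cup i b => simp [level] at hc
  | cross i ε => simp only [level, Option.ite_none_right_eq_some, Option.some.injEq] at hc; omega
  | tie i j => simp only [level, Option.ite_none_right_eq_some, Option.some.injEq] at hc; omega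
  | cap i =>
    simp only [level, Option.ite_none_right_eq_some, Option.some.injEq] at hc
    obtain rfl : m = 1 := by omega
    obtain rfl : i = 0 := by omega
    have hle : hZ.layered 1 ≤ Submodule.span R {cu 0 hZ.base} := by
      have h0 : ∀ t ∈ hZ.layered 0, ∀ j ≤ 2 * 0, arc j t ∈ Submodule.span R {cu 0 hZ.base} := by
        intro t ht j hj
        obtain rfl : j = 0 := by omega
        obtain ⟨c, rfl⟩ := Submodule.mem_span_singleton.1 ht
        rw [arc_zero, map_smul]
        exact Submodule.smul_mem _ _ (Submodule.mem_span_singleton_self _)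
      intro f hf
      refine hZ.layered_induction _ h0 (fun t ht j hj h p hp => ?_) hf
      obtain rfl : j = 0 := by omega
      have hs := hZ.mem_space_of_layered ht
      have hg := hZ.arc_mem hs hj
      rcases p with _ | _ | p
      · rwa [hZ.ti_self hg (by omega)]
      · have := hZ.ti_arc_ends hs (j := 0) hj
        rw [zero_add] at this ⊢
        rwa [this]
      · omega
    obtain ⟨c, hc⟩ := Submodule.mem_span_singleton.1 (hle hm)
    refine ⟨c, ?_⟩
    have := congrArg (fun g => (ca 0 g).1 []) hc
    simpa [IsTiedSkein.base] using this.symm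

end Skein
end TiedLink

namespace TiedLink

/-! ### Boltzmann weights

A label consists of a colour and of a basis vector of the vector representation of the quantum
symplectic group. -/

namespace Vertex

/-- Labels of the strands. -/
abbrev Label (n m : ℕ) : Type := Fin n × Fin (2 * m)

variable {K : Type*} [Field K] (p : K) {n m : ℕ}

/-- The label on the other side of a local extremum. -/
def dual (x : Label n m) : Label n m := (x.1, x.2.rev)

/-- The next label of the same colour. -/
def next (x : Label n m) : Label n m :=
  (x.1, if h : x.2.val + 1 < 2 * m then ⟨x.2.val + 1, h⟩ else x.2)

/-- The weight of a minimum whose left branch has a given label. -/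
def cupWeight (x : Label n m) : K := (-(p⁻¹ ^ 2)) ^ (x.2.val + 1 - m)

/-- The weight of a maximum whose left branch has a given label. -/
def capWeight (x : Label n m) : K := (cupWeight p (dual x))⁻¹

/-- The weight of a crossing at which the labels continue straight ahead, within one colour. -/
def labelWeight (m i j : ℕ) : K :=
  if i = j then p else if i + j + 1 = 2 * m then p⁻¹
  else if (i < j ↔ i + j + 1 < 2 * m) then 1 else -1

/-- The weight of a crossing at which the labels continue straight ahead. -/
def crossWeight (x y : Label n m) : K :=
  if x.1 = y.1 then labelWeight p m x.2 y.2 else if x.1 < y.1 then 1 else -1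

/-- The value of `z`. -/
def zWeight : K := p + p⁻¹

/-- The matrix coefficients of the lowering operator number `s`. -/
def lowerCoeff (m s i : ℕ) : K := if i = s then 1 else if i + s + 2 = 2 * m then -p⁻¹ else 0

/-- The group-like element that belongs to the lowering operator number `s`. -/
def lowerTwist (m s i : ℕ) : K :=
  if s + 1 = m then (if i = s then p⁻¹ ^ 2 else if i = s + 1 then p ^ 2 else 1)
  else if i = s then -p⁻¹ else if i = s + 1 then p
  else if i + s + 2 = 2 * m then p⁻¹ else if i + s + 1 = 2 * m then -p else 1

/-- The coefficients of the lowering operator `s` of colour `c`. -/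
def lowerC (c : Fin n) (s : ℕ) (x : Label n m) : K := if x.1 = c then lowerCoeff p m s x.2 else 0

/-- The group-like element of the lowering operator `s` of colour `c`. -/
def lowerT (c : Fin n) (s : ℕ) (x : Label n m) : K := if x.1 = c then lowerTwist p m s x.2 else 1

@[simp] theorem dual_fst (x : Label n m) : (dual x).1 = x.1 := rfl
@[simp] theorem next_fst (x : Label n m) : (next x).1 = x.1 := rfl
theorem dual_snd (x : Label n m) : ((dual x).2 : ℕ) = 2 * m - 1 - x.2 := by
  simp [dual, Fin.val_rev]; omega
theorem next_snd {x : Label n m} (h : x.2.val + 1 < 2 * m) : ((next x).2 : ℕ) = x.2 + 1 := by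
  simp [next, h]

@[simp] theorem dual_dual (x : Label n m) : dual (dual x) = x := by simp [dual]

theorem ext_label {x y : Label n m} : x = y ↔ x.1 = y.1 ∧ (x.2 : ℕ) = y.2 := by
  rw [Prod.ext_iff, Fin.ext_iff (a := x.2)]

theorem next_dual_next {x : Label n m} (h : x.2.val + 1 < 2 * m) :
    next (dual (next x)) = dual x := by
  have h1 := dual_snd (next x)
  rw [next_snd h] at h1
  rw [ext_label]
  refine ⟨rfl, ?_⟩
  rw [next_snd (by omega), h1, dual_snd]; omega

theorem labelWeight_self (i : ℕ) : labelWeight p m i i = p := if_pos rfl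

theorem labelWeight_opp {i j : ℕ} (h : i + j + 1 = 2 * m) : labelWeight p m i j = p⁻¹ := by
  rw [labelWeight, if_neg (by omega), if_pos h]

theorem labelWeight_one {i j : ℕ} (h : i ≠ j) (h' : i + j + 1 ≠ 2 * m)
    (h'' : i < j ↔ i + j + 1 < 2 * m) : labelWeight p m i j = 1 := by
  rw [labelWeight, if_neg h, if_neg h', if_pos h'']

theorem labelWeight_neg {i j : ℕ} (h : i ≠ j) (h' : i + j + 1 ≠ 2 * m)
    (h'' : ¬(i < j ↔ i + j + 1 < 2 * m)) : labelWeight p m i j = -1 := by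
  rw [labelWeight, if_neg h, if_neg h', if_neg h'']

theorem labelWeight_congr {i j k l : ℕ} (h : i ≠ j) (h' : i + j + 1 ≠ 2 * m)
    (hk : k ≠ l) (hk' : k + l + 1 ≠ 2 * m)
    (h'' : (i < j ↔ i + j + 1 < 2 * m) ↔ (k < l ↔ k + l + 1 < 2 * m)) :
    labelWeight p m i j = labelWeight p m k l := by
  rw [labelWeight, labelWeight, if_neg h, if_neg h', if_neg hk, if_neg hk']
  exact if_congr h'' rfl rfl

theorem lowerTwist_mid {m : ℕ} : lowerTwist p (m + 1) m m = p⁻¹ ^ 2 := by simp [lowerTwist]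

theorem lowerTwist_mid' {m : ℕ} : lowerTwist p (m + 1) m (m + 1) = p ^ 2 := by simp [lowerTwist]

theorem lowerTwist_one {m s : ℕ} (h : s + 1 < m) : lowerTwist p m s s = -p⁻¹ := by
  rw [lowerTwist, if_neg (by omega), if_pos rfl]

theorem lowerTwist_two {m s : ℕ} (h : s + 1 < m) : lowerTwist p m s (s + 1) = p := by
  rw [lowerTwist, if_neg (by omega), if_neg (by omega), if_pos rfl]

theorem lowerTwist_three {m s i : ℕ} (h : s + 1 < m) (hi : i + s + 2 = 2 * m) :
    lowerTwist p m s i = p⁻¹ := by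
  rw [lowerTwist, if_neg (by omega), if_neg (by omega), if_neg (by omega), if_pos hi]

theorem lowerTwist_four {m s i : ℕ} (h : s + 1 < m) (hi : i + s + 1 = 2 * m) :
    lowerTwist p m s i = -p := by
  rw [lowerTwist, if_neg (by omega), if_neg (by omega), if_neg (by omega), if_neg (by omega),
    if_pos hi]

theorem lowerTwist_other {m s i : ℕ} (h1 : i ≠ s) (h2 : i ≠ s + 1) (h3 : i + s + 2 ≠ 2 * m)
    (h4 : i + s + 1 ≠ 2 * m) : lowerTwist p m s i = 1 := by
  rw [lowerTwist, if_neg h1, if_neg h2, if_neg h3, if_neg h4, if_neg h1, if_neg h2, ite_self]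

/-- Compatibility of the diagonal weights with lowering: moving the first label up by one step
changes its weight against `j` by the group-like factor of `j`. All possible positions of `j`
relative to the steps `s → s + 1` and `2m - 2 - s → 2m - 1 - s` are compared. -/
theorem labelWeight_succ {p : K} (hp : p ≠ 0) {m s i j : ℕ} (hs : s < m)
    (hi : i = s ∨ i + s + 2 = 2 * m) (hj : j < 2 * m) :
    labelWeight p m (i + 1) j = labelWeight p m i j * lowerTwist p m s j := by
  by_cases hm : s + 1 = m
  · subst hm
    obtain rfl : i = s := by omega
    by_cases h1 : j = i
    · subst h1
      rw [labelWeight_opp p (by omega), labelWeight_self, lowerTwist_mid]; field_simp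
    by_cases h2 : j = i + 1
    · subst h2
      rw [labelWeight_self, labelWeight_opp p (by omega), lowerTwist_mid']; field_simp
    rw [lowerTwist_other p h1 h2 (by omega) (by omega), mul_one]
    exact labelWeight_congr p (by omega) (by omega) (by omega) (by omega) (by omega)
  have hm : s + 1 < m := by omega
  by_cases h1 : j = s
  · subst h1
    rw [lowerTwist_one p hm]
    rcases hi with rfl | hi
    · rw [labelWeight_self, labelWeight_neg p (by omega) (by omega) (by omega)]; field_simp
    · rw [labelWeight_opp p (by omega), labelWeight_neg p (by omega) (by omega) (by omega)]
      field_simp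
  by_cases h2 : j = s + 1
  · subst h2
    rw [lowerTwist_two p hm]
    rcases hi with rfl | hi
    · rw [labelWeight_self, labelWeight_one p (by omega) (by omega) (by omega)]; field_simp
    · rw [labelWeight_one p (by omega) (by omega) (by omega), labelWeight_opp p (by omega)]
      field_simp
  by_cases h3 : j + s + 2 = 2 * m
  · rw [lowerTwist_three p hm h3]
    rcases hi with rfl | hi
    · rw [labelWeight_opp p (by omega), labelWeight_one p (by omega) (by omega) (by omega)]
      field_simp
    · obtain rfl : i = j := by omega
      rw [labelWeight_self, labelWeight_one p (by omega) (by omega) (by omega)]; field_simp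
  by_cases h4 : j + s + 1 = 2 * m
  · rw [lowerTwist_four p hm h4]
    rcases hi with rfl | hi
    · rw [labelWeight_opp p (i := i) (by omega),
        labelWeight_neg p (by omega) (by omega) (by omega)]
      field_simp
    · obtain rfl : j = i + 1 := by omega
      rw [labelWeight_self, labelWeight_neg p (by omega) (by omega) (by omega)]; field_simp
  rw [lowerTwist_other p h1 h2 h3 h4, mul_one]
  rcases hi with rfl | hi
  · exact labelWeight_congr p (by omega) (by omega) (by omega) (by omega) (by omega)
  · exact labelWeight_congr p (by omega) (by omega) (by omega) (by omega) (by omega)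

/-- When the second label is moved, the diagonal weights alone do not match; the terms with
`zWeight` compensate for the non-diagonal parts of the crossing. -/
theorem lowerTwist_mul_labelWeight {p : K} (hp : p ≠ 0) {m s i j : ℕ} (hs : s < m)
    (hj : j = s ∨ j + s + 2 = 2 * m) (hi : i ≠ s) (hi' : i + s + 2 ≠ 2 * m) :
    lowerTwist p m s i * labelWeight p m i (j + 1) =
      labelWeight p m i j + (if i = j + 1 then zWeight p * lowerTwist p m s i else 0) -
        (if i + j + 1 = 2 * m then zWeight p else 0) := by
  unfold zWeight
  by_cases hm : s + 1 = m
  · subst hm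
    obtain rfl : j = s := by omega
    by_cases h2 : i = j + 1
    · subst h2
      rw [lowerTwist_mid', labelWeight_self, labelWeight_opp p (by omega), if_pos rfl,
        if_pos (by omega)]
      field_simp; ring
    rw [lowerTwist_other p hi h2 hi' (by omega), if_neg h2, if_neg (by omega), one_mul, add_zero,
      sub_zero]
    exact labelWeight_congr p (by omega) (by omega) (by omega) (by omega) (by omega)
  have hm : s + 1 < m := by omega
  by_cases h2 : i = s + 1
  · subst h2
    rw [lowerTwist_two p hm]
    rcases hj with rfl | hj
    · rw [labelWeight_self, labelWeight_neg p (by omega) (by omega) (by omega), if_pos rfl,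
        if_neg (by omega)]
      field_simp; ring
    · rw [labelWeight_neg p (by omega) (by omega) (by omega), labelWeight_opp p (by omega),
        if_neg (by omega), if_pos (by omega)]
      ring
  by_cases h4 : i + s + 1 = 2 * m
  · rw [lowerTwist_four p hm h4]
    rcases hj with rfl | hj
    · rw [labelWeight_one p (by omega) (by omega) (by omega), labelWeight_opp p (by omega),
        if_neg (by omega), if_pos (by omega)]
      ring
    · obtain rfl : i = j + 1 := by omega
      rw [labelWeight_self, labelWeight_one p (by omega) (by omega) (by omega), if_pos rfl,
        if_neg (by omega)]
      field_simp; ring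
  rw [lowerTwist_other p hi h2 hi' h4, if_neg (by omega), if_neg (by omega), one_mul, add_zero,
    sub_zero]
  exact labelWeight_congr p (by omega) (by omega) (by omega) (by omega) (by omega)

/-! ### Weight identities behind invariance under the lowering operators -/

section Laws

variable {p} (hp : p ≠ 0)
include hp

theorem cupWeight_ne_zero (x : Label n m) : cupWeight p x ≠ 0 :=
  pow_ne_zero _ (neg_ne_zero.2 (pow_ne_zero _ (inv_ne_zero hp)))

theorem capWeight_mul_cupWeight (x : Label n m) : capWeight p x * cupWeight p (dual x) = 1 :=
  inv_mul_cancel₀ (cupWeight_ne_zero hp _)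

/-- This allows a label to pass both branches of an extremum without any factor. -/
theorem crossWeight_mul_dual (x y : Label n m) :
    crossWeight p x y * crossWeight p x (dual y) = 1 := by
  have hx := x.2.2
  have hy := y.2.2
  unfold crossWeight
  rw [dual_fst]
  split_ifs with h1 h2
  · rw [dual_snd]
    unfold labelWeight
    split_ifs <;> first | omega | simp [hp]
  · simp
  · simp

omit hp in
-- For different colours this makes the square of a crossing equal to `-1`, so that a crossing and
-- its inverse cancel, as the skein relation with a plus sign and vanishing tied smoothings
-- requires.
theorem crossWeight_mul_swap {x y : Label n m} (h : x ≠ y) (h' : y ≠ dual x) :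
    crossWeight p x y * crossWeight p y x = -1 := by
  have hx := x.2.2
  have hy := y.2.2
  rw [Ne, ext_label] at h h'
  rw [dual_fst, dual_snd] at h'
  unfold crossWeight
  by_cases h1 : x.1 = y.1
  · simp only [h1, if_true, true_and] at h h' ⊢
    unfold labelWeight
    split_ifs <;> first | omega | simp
  · rw [if_neg h1, if_neg (Ne.symm h1)]
    rcases lt_or_gt_of_ne h1 with h2 | h2
    · rw [if_pos h2, if_neg (not_lt_of_gt h2)]; simp
    · rw [if_neg (not_lt_of_gt h2), if_pos h2]; simp

theorem lowerC_ne_zero_iff {c : Fin n} {s : ℕ} {x : Label n m} :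
    lowerC p c s x ≠ 0 ↔ x.1 = c ∧ ((x.2 : ℕ) = s ∨ (x.2 : ℕ) + s + 2 = 2 * m) := by
  unfold lowerC lowerCoeff
  split_ifs <;> simp_all

theorem lowerT_mul_dual {c : Fin n} {s : ℕ} (hs : s < m) (x : Label n m) :
    lowerT p c s x * lowerT p c s (dual x) = 1 := by
  have hx := x.2.2
  unfold lowerT
  rw [dual_fst, dual_snd]
  split_ifs
  · unfold lowerTwist
    split_ifs <;> first | omega | simp [hp]
  · simp

/-- When a minimum is lowered, neighbouring terms of its sum over labels produce the same word; this
is the cancellation of their coefficients. -/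
theorem cupWeight_next {c : Fin n} {s : ℕ} (hs : s < m) {x : Label n m}
    (h : x.2.val + 1 < 2 * m) :
    cupWeight p (next x) * lowerT p c s (next x) * lowerC p c s (dual (next x)) =
      -(cupWeight p x * lowerC p c s x) := by
  unfold lowerC lowerT
  rw [dual_fst, next_fst, dual_snd, next_snd h]
  unfold cupWeight
  rw [next_snd h]
  split_ifs
  · unfold lowerCoeff lowerTwist
    split_ifs <;> first
      | omega
      | (have e : x.2.val + 1 + 1 - m = x.2.val + 1 - m + 1 := by omega
         rw [e, pow_succ]; field_simp; try simp)
      | (have e : x.2.val + 1 + 1 - m = 0 := by omega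
         have e' : x.2.val + 1 - m = 0 := by omega
         rw [e, e']; field_simp; try simp)
      | simp
  · simp

theorem crossWeight_next {c : Fin n} {s : ℕ} (hs : s < m) {x : Label n m}
    (hx : lowerC p c s x ≠ 0) (y : Label n m) :
    crossWeight p (next x) y = crossWeight p x y * lowerT p c s y := by
  obtain ⟨rfl, hi⟩ := (lowerC_ne_zero_iff hp).1 hx
  unfold crossWeight lowerT
  rw [next_fst, next_snd (by omega)]
  by_cases h : x.1 = y.1
  · rw [if_pos h, if_pos h, if_pos h.symm]
    exact labelWeight_succ hp hs hi y.2.2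
  · rw [if_neg h, if_neg h, if_neg (Ne.symm h), mul_one]

theorem lowerT_mul_crossWeight {c : Fin n} {s : ℕ} (hs : s < m) {x y : Label n m}
    (hx : lowerC p c s x = 0) (hy : lowerC p c s y ≠ 0) :
    lowerT p c s x * crossWeight p x (next y) =
      crossWeight p x y + (if x = next y then zWeight p * lowerT p c s x else 0) -
        (if y = dual x then zWeight p else 0) := by
  obtain ⟨rfl, hj⟩ := (lowerC_ne_zero_iff hp).1 hy
  have hx' : ¬ (x.1 = y.1 ∧ ((x.2 : ℕ) = s ∨ (x.2 : ℕ) + s + 2 = 2 * m)) :=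
    fun h => (lowerC_ne_zero_iff hp).2 h hx
  have hx2 := x.2.2
  simp only [ext_label (x := x), ext_label (x := y)]
  unfold crossWeight lowerT
  rw [next_fst, next_snd (by omega), dual_fst, dual_snd]
  by_cases h : x.1 = y.1
  · simp only [h, true_and, not_or] at hx'
    have := lowerTwist_mul_labelWeight hp hs hj hx'.1 hx'.2
    simp only [h, if_true, true_and]
    rw [this]
    congr 1
    exact if_congr (by omega) rfl rfl
  · rw [if_neg h, if_neg h, if_neg h, if_neg (fun h' : x.1 = y.1 ∧ _ => h h'.1),
      if_neg (fun h' : y.1 = x.1 ∧ _ => h h'.1.symm)]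
    ring

theorem zWeight_add_lowerT_mul {c : Fin n} {s : ℕ} (hs : s < m) {x : Label n m}
    (hx : lowerC p c s x ≠ 0) :
    zWeight p + lowerT p c s x * crossWeight p x (next x) +
      (if next x = dual x then zWeight p * (capWeight p (next x) * cupWeight p (next x)) else 0) =
      crossWeight p x x := by
  obtain ⟨rfl, hi⟩ := (lowerC_ne_zero_iff hp).1 hx
  simp only [ext_label (x := next x)]
  unfold crossWeight lowerT zWeight capWeight cupWeight
  rw [next_fst, dual_fst, dual_snd, dual_snd, next_snd (by omega)]
  simp only [if_true, true_and]
  unfold labelWeight lowerTwist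
  split_ifs <;> first
    | omega
    | (have e : 2 * m - 1 - (x.2.val + 1) + 1 - m = 0 := by omega
       have e' : x.2.val + 1 + 1 - m = 1 := by omega
       rw [e, e']; field_simp; ring)
    | (field_simp; ring)

/-- If the operator moves two different labels of its colour, one is at `s` and the other at `2m - 2
- s`. This is the coefficient identity for that case of the invariance of the crossing. -/
theorem lowerT_mul_lowerC {c : Fin n} {s : ℕ} (hs : s < m) {x y : Label n m}
    (hx : lowerC p c s x ≠ 0) (hy : lowerC p c s y ≠ 0) (hxy : x ≠ y) :
    lowerT p c s x * lowerC p c s y * crossWeight p x (next y) +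
      zWeight p * (lowerC p c s x * capWeight p (next x) * cupWeight p (next y)) =
      crossWeight p x y * lowerC p c s y := by
  obtain ⟨rfl, hi⟩ := (lowerC_ne_zero_iff hp).1 hx
  obtain ⟨h1, hj⟩ := (lowerC_ne_zero_iff hp).1 hy
  rw [Ne, ext_label, not_and] at hxy
  have hxy := hxy h1.symm
  unfold crossWeight lowerT lowerC zWeight capWeight cupWeight
  rw [next_fst, dual_snd, next_snd (by omega), next_snd (by omega)]
  simp only [h1, if_true]
  have hm : s + 1 < m := by omega
  have h0 : -(p⁻¹ ^ 2) ≠ 0 := neg_ne_zero.2 (pow_ne_zero _ (inv_ne_zero hp))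
  have e1 : lowerCoeff p m s s = 1 := if_pos rfl
  have e2 {i : ℕ} (h : i + s + 2 = 2 * m) : lowerCoeff p m s i = -p⁻¹ := by
    rw [lowerCoeff, if_neg (by omega), if_pos h]
  rcases hi with hx | hx
  · have hy : (y.2 : ℕ) + s + 2 = 2 * m := by omega
    have e : y.2.val + 1 + 1 - m = 2 * m - 1 - (s + 1) + 1 - m + 1 := by omega
    rw [hx, lowerTwist_one p hm, labelWeight_opp p (by omega),
      labelWeight_one p (by omega) (by omega) (by omega), e1, e2 hy, e, pow_succ (-(p⁻¹ ^ 2))]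
    have hq := pow_ne_zero (2 * m - 1 - (s + 1) + 1 - m) h0
    generalize (-(p⁻¹ ^ 2)) ^ (2 * m - 1 - (s + 1) + 1 - m) = q at hq ⊢
    field_simp
    ring
  · have hy : (y.2 : ℕ) = s := by omega
    have e : 2 * m - 1 - (x.2.val + 1) + 1 - m = 0 := by omega
    have e' : s + 1 + 1 - m = 0 := by omega
    rw [hy, lowerTwist_three p hm hx, labelWeight_opp p (by omega),
      labelWeight_neg p (by omega) (by omega) (by omega), e1, e2 hx, e, e']
    field_simp
    ring

end Laws

end Vertex
end TiedLink

namespace TiedLink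

/-! ### Operators on states -/

namespace Vertex

/-- Linear combinations of words of labels. -/
abbrev State (K : Type*) [Field K] (n m : ℕ) : Type _ := List (Label n m) →₀ K

/-- Operators on states. -/
abbrev Op (K : Type*) [Field K] (n m : ℕ) : Type _ := Module.End K (State K n m)

variable {K : Type*} [Field K] {n m : ℕ}

/-- The empty word. -/
noncomputable def vac : State K n m := Finsupp.single [] 1

/-- Adding a label on the left. -/
noncomputable def pre (x : Label n m) : Op K n m := Finsupp.lmapDomain K K (List.cons x)

/-- The operator that acts on all labels but the first one. -/
noncomputable def up (T : Op K n m) : Op K n m :=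
  Finsupp.linearCombination K fun l => match l with
    | [] => 0
    | x :: l => pre x (T (Finsupp.single l 1))

/-- An operator defined by its action on the first two labels. -/
noncomputable def onPairs (φ : Label n m → Label n m → Op K n m) : Op K n m :=
  Finsupp.linearCombination K fun l => match l with
    | x :: y :: l => φ x y (Finsupp.single l 1)
    | _ => 0

theorem pre_single (x : Label n m) (l : List (Label n m)) (k : K) :
    pre x (Finsupp.single l k) = Finsupp.single (x :: l) k := by
  simp [pre]

/-- Operators are compared on the empty word and on words with a first letter. -/
theorem hom_ext {X Y : Op K n m} (h0 : X vac = Y vac) (h : ∀ x v, X (pre x v) = Y (pre x v)) :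
    X = Y := by
  refine Finsupp.lhom_ext' fun l => LinearMap.ext_ring ?_
  cases l with
  | nil => exact h0
  | cons x l => simpa [pre_single] using h x (Finsupp.single l 1)

theorem hom_ext₂ {X Y : Op K n m} (h0 : X vac = Y vac)
    (h1 : ∀ x, X (pre x vac) = Y (pre x vac))
    (h : ∀ x y v, X (pre x (pre y v)) = Y (pre x (pre y v))) : X = Y := by
  refine hom_ext h0 fun x v => ?_
  exact LinearMap.congr_fun (hom_ext (X := X * pre x) (Y := Y * pre x) (h1 x) (h x)) v

@[simp] theorem up_vac (T : Op K n m) : up T vac = 0 := by simp [up, vac]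

@[simp] theorem up_pre (T : Op K n m) (x : Label n m) (v : State K n m) :
    up T (pre x v) = pre x (T v) := by
  suffices h : up T * pre x = pre x * T from LinearMap.congr_fun h v
  refine Finsupp.lhom_ext' fun l => LinearMap.ext_ring ?_
  simp [pre_single, up]

@[simp] theorem onPairs_vac (φ : Label n m → Label n m → Op K n m) : onPairs φ vac = 0 := by
  simp [onPairs, vac]

@[simp] theorem onPairs_pre_vac (φ : Label n m → Label n m → Op K n m) (x : Label n m) :
    onPairs φ (pre x vac) = 0 := by
  simp [onPairs, vac, pre_single]

@[simp] theorem onPairs_pre_pre (φ : Label n m → Label n m → Op K n m) (x y : Label n m)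
    (v : State K n m) : onPairs φ (pre x (pre y v)) = φ x y v := by
  suffices h : onPairs φ * (pre x * pre y) = φ x y from LinearMap.congr_fun h v
  refine Finsupp.lhom_ext' fun l => LinearMap.ext_ring ?_
  simp [pre_single, onPairs]

theorem up_add (S T : Op K n m) : up (S + T) = up S + up T := hom_ext (by simp) (by simp)
theorem up_mul (S T : Op K n m) : up (S * T) = up S * up T := hom_ext (by simp) (by simp)
theorem up_smul (k : K) (T : Op K n m) : up (k • T) = k • up T := hom_ext (by simp) (by simp)

variable (p : K)

/-- The operator that adds two dual labels that satisfy a given condition. -/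
noncomputable def pairSum (P : Label n m → Prop) [DecidablePred P] : Op K n m :=
  ∑ k, if P k then cupWeight p k • (pre k * pre (dual k)) else 0

theorem pairSum_apply (P : Label n m → Prop) [DecidablePred P] (v : State K n m) :
    pairSum p P v = ∑ k, if P k then cupWeight p k • pre k (pre (dual k) v) else 0 := by
  rw [pairSum, LinearMap.sum_apply]
  exact Finset.sum_congr rfl fun k _ => by split_ifs <;> simp

/-- The part of a minimum with labels above a given one. -/
noncomputable abbrev tailSum (y : Label n m) : Op K n m :=
  pairSum p fun k => k.1 = y.1 ∧ y.2 < k.2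

/-- A minimum of a given colour. -/
noncomputable abbrev colourSum (c : Fin n) : Op K n m := pairSum p fun k => k.1 = c

/-- A minimum. -/
noncomputable def cupOp : Op K n m := pairSum p fun _ => True

/-- A maximum. -/
noncomputable def capOp : Op K n m := onPairs fun x y => if y = dual x then capWeight p x • 1 else 0

/-- A tie between the first two strands. -/
noncomputable def tieOp : Op K n m :=
  onPairs fun x y => if x.1 = y.1 then pre x * pre y else 0

/-- A positive crossing. -/
noncomputable def crossOp : Op K n m :=
  onPairs fun x y => crossWeight p x y • (pre y * pre x) +
    (if x.1 = y.1 ∧ y.2 < x.2 then zWeight p • (pre x * pre y) else 0) +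
    (if y = dual x then (zWeight p * capWeight p x) • tailSum p (dual x) else 0)

/-- A maximum below a minimum, with a tie. -/
noncomputable def hookOp : Op K n m := capOp p * up tieOp * up (up (cupOp p))

/-- A negative crossing. -/
noncomputable def crossOp' : Op K n m := zWeight p • (tieOp + hookOp p) - crossOp p

/-- A lowering operator. -/
noncomputable def lower (c : Fin n) (s : ℕ) : Op K n m :=
  Finsupp.linearCombination K fun l => l.rec (motive := fun _ => State K n m) 0
    fun x l v => lowerC p c s x • pre (next x) (Finsupp.single l 1) + lowerT p c s x • pre x v

theorem cupOp_apply (v : State K n m) :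
    cupOp p v = ∑ k, cupWeight p k • pre k (pre (dual k) v) := by
  simp [cupOp, pairSum_apply]

@[simp] theorem capOp_pre (x y : Label n m) (v : State K n m) :
    capOp p (pre x (pre y v)) = if y = dual x then capWeight p x • v else 0 := by
  rw [capOp, onPairs_pre_pre]; split_ifs <;> simp

@[simp] theorem tieOp_pre (x y : Label n m) (v : State K n m) :
    tieOp (pre x (pre y v)) = if x.1 = y.1 then pre x (pre y v) else 0 := by
  rw [tieOp, onPairs_pre_pre]; split_ifs <;> simp

@[simp] theorem capOp_vac : capOp p (vac : State K n m) = 0 := onPairs_vac _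
@[simp] theorem capOp_pre_vac (x : Label n m) : capOp p (pre x vac) = 0 := onPairs_pre_vac _ _
@[simp] theorem tieOp_vac : tieOp (vac : State K n m) = 0 := onPairs_vac _
@[simp] theorem tieOp_pre_vac (x : Label n m) : tieOp (K := K) (pre x vac) = 0 :=
  onPairs_pre_vac _ _
@[simp] theorem crossOp_vac : crossOp p (vac : State K n m) = 0 := onPairs_vac _
@[simp] theorem crossOp_pre_vac (x : Label n m) : crossOp p (pre x vac) = 0 :=
  onPairs_pre_vac _ _

theorem crossOp_pre (x y : Label n m) (v : State K n m) :
    crossOp p (pre x (pre y v)) = crossWeight p x y • pre y (pre x v) +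
      (if x.1 = y.1 ∧ y.2 < x.2 then zWeight p else 0) • pre x (pre y v) +
      (if y = dual x then zWeight p * capWeight p x else 0) • tailSum p (dual x) v := by
  rw [crossOp, onPairs_pre_pre]; split_ifs <;> simp

@[simp] theorem lower_vac (c : Fin n) (s : ℕ) : lower p c s (vac : State K n m) = 0 := by
  simp [lower, vac]

@[simp] theorem lower_pre (c : Fin n) (s : ℕ) (x : Label n m) (v : State K n m) :
    lower p c s (pre x v) =
      lowerC p c s x • pre (next x) v + lowerT p c s x • pre x (lower p c s v) := by
  suffices h : lower p c s * pre x =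
      lowerC p c s x • pre (next x) + lowerT p c s x • (pre x * lower p c s) from
    LinearMap.congr_fun h v
  refine Finsupp.lhom_ext' fun l => LinearMap.ext_ring ?_
  simp [pre_single, lower]

theorem tailSum_of_last {y : Label n m} (h : y.2.val + 1 = 2 * m) : tailSum p y = 0 := by
  refine Finset.sum_eq_zero fun k _ => if_neg fun h' => ?_
  have := k.2.2
  have := Fin.lt_def.1 h'.2
  omega

theorem pairSum_eq_add {P Q : Label n m → Prop} [DecidablePred P] [DecidablePred Q]
    {x : Label n m} (h : ∀ k, P k ↔ k = x ∨ Q k) (hx : ¬ Q x) (v : State K n m) :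
    pairSum p P v = cupWeight p x • pre x (pre (dual x) v) + pairSum p Q v := by
  rw [pairSum_apply, pairSum_apply, ← Finset.sum_ite_eq' Finset.univ x
    (fun k => cupWeight p k • pre k (pre (dual k) v)) |>.trans (if_pos (Finset.mem_univ x)),
    ← Finset.sum_add_distrib]
  refine Finset.sum_congr rfl fun k _ => ?_
  by_cases hk : k = x
  · subst hk; simp [h, hx]
  · simp [h, hk]

theorem tailSum_succ {y : Label n m} (h : y.2.val + 1 < 2 * m) (v : State K n m) :
    tailSum p y v =
      cupWeight p (next y) • pre (next y) (pre (dual (next y)) v) + tailSum p (next y) v := by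
  refine pairSum_eq_add p (fun k => ?_) (by simp) v
  rw [ext_label, Fin.lt_def, Fin.lt_def, next_snd h, next_fst]
  omega

theorem colourSum_eq {x : Label n m} (h : x.2.val = 0) (v : State K n m) :
    colourSum p x.1 v = cupWeight p x • pre x (pre (dual x) v) + tailSum p x v := by
  refine pairSum_eq_add p (fun k => ?_) (by simp) v
  rw [ext_label, Fin.lt_def]
  omega

theorem cupOp_eq_sum : cupOp p = ∑ c : Fin n, colourSum (m := m) p c := by
  simp only [cupOp, pairSum]
  rw [Finset.sum_comm]
  simp

/-! ### Minima and crossings commute with the lowering operators -/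

section Lower

variable {p} (hp : p ≠ 0) {c : Fin n} {s : ℕ} (hs : s < m)
include hp hs

theorem lowerC_of_last {y : Label n m} (h : y.2.val + 1 = 2 * m) : lowerC p c s y = 0 := by
  by_contra h'
  have := ((lowerC_ne_zero_iff hp).1 h').2
  omega

/-- The sum telescopes by `cupWeight_next`; only the term at its lower boundary `y` remains. The
induction goes from the last label down. -/
theorem lower_tailSum (y : Label n m) (v : State K n m) :
    lower p c s (tailSum p y v) = tailSum p y (lower p c s v) -
      (cupWeight p y * lowerC p c s y) • pre (next y) (pre (dual y) v) := by
  have hy := y.2.2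
  obtain ⟨d, hd⟩ : ∃ d, y.2.val + 1 + d = 2 * m := ⟨2 * m - (y.2.val + 1), by omega⟩
  induction d generalizing y with
  | zero => simp [tailSum_of_last p hd, lowerC_of_last hp hs hd]
  | succ d ih =>
    have h : y.2.val + 1 < 2 * m := by omega
    have h1 := cupWeight_next hp (c := c) hs h
    have h2 := lowerT_mul_dual hp (c := c) hs (next y)
    rw [tailSum_succ p h, tailSum_succ p h, map_add, ih _ (next y).2.2 (by rw [next_snd h]; omega)]
    simp only [map_smul, lower_pre, map_add, next_dual_next h]
    linear_combination (norm := module) h1 • pre (next y) (pre (dual y) v) +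
      (cupWeight p (next y) • h2) • pre (next y) (pre (dual (next y)) (lower p c s v))

/-- The sum starts at the lowest label, whose dual is the last label and is annihilated by the
coefficient of lowering. The boundary term left by `lower_tailSum` is cancelled by the first term of
the sum. -/
theorem commute_lower_colourSum (d : Fin n) : Commute (lower p c s : Op K n m) (colourSum p d) := by
  refine LinearMap.ext fun v => ?_
  have h : (dual ((d, ⟨0, by omega⟩) : Label n m)).2.val + 1 = 2 * m := by
    rw [dual_snd]; simp; omega
  have h2 := lowerT_mul_dual hp (c := c) hs ((d, ⟨0, by omega⟩) : Label n m)
  simp only [Module.End.mul_apply]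
  rw [colourSum_eq p (x := (d, ⟨0, by omega⟩)) rfl, colourSum_eq p (x := (d, ⟨0, by omega⟩)) rfl,
    map_add, lower_tailSum hp hs]
  simp only [map_smul, lower_pre, map_add, lowerC_of_last hp hs h]
  generalize ((d, ⟨0, by omega⟩) : Label n m) = x at *
  linear_combination (norm := module) (cupWeight p x • h2) • pre x (pre (dual x) (lower p c s v))

theorem commute_lower_cupOp : Commute (lower p c s : Op K n m) (cupOp p) := by
  rw [cupOp_eq_sum]
  exact Commute.sum_right _ _ _ fun d _ => commute_lower_colourSum hp hs d

end Lower

theorem commute_lower_up {c : Fin n} {s : ℕ} {T : Op K n m} (h : Commute (lower p c s) T) :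
    Commute (lower p c s) (up T) := by
  refine hom_ext (by simp) fun x v => ?_
  have h := LinearMap.congr_fun h v
  simp only [Module.End.mul_apply] at h
  simp [h]

theorem commute_lower_tieOp (c : Fin n) (s : ℕ) : Commute (lower p c s : Op K n m) tieOp := by
  refine hom_ext₂ (by simp) (by simp) fun x y v => ?_
  by_cases h : x.1 = y.1 <;> simp [h]

section Lower

variable {p} (hp : p ≠ 0) {c : Fin n} {s : ℕ} (hs : s < m)
include hp hs

/-- A maximum applied to a lowered pair of labels gets two contributions, one from each branch; they
cancel. -/
theorem lowerC_mul_capWeight {x y : Label n m} (hx : lowerC p c s x ≠ 0) (h : y = dual (next x)) :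
    lowerC p c s x * capWeight p (next x) +
      lowerT p c s x * lowerC p c s y * capWeight p x = 0 := by
  obtain ⟨rfl, hi⟩ := (lowerC_ne_zero_iff hp).1 hx
  have hx1 : x.2.val + 1 < 2 * m := by omega
  have hny : next y = dual x := by rw [h, next_dual_next hx1]
  have hy2 : y.2.val + 1 < 2 * m := by rw [h, dual_snd, next_snd hx1]; omega
  have h1 := cupWeight_next hp (c := x.1) hs hy2
  have h2 := lowerT_mul_dual hp (c := x.1) hs x
  rw [hny, dual_dual] at h1
  have h3 := capWeight_mul_cupWeight hp (next x)
  have h4 := capWeight_mul_cupWeight hp x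
  rw [← h] at h3
  linear_combination lowerT p x.1 s x * capWeight p x * capWeight p (next x) * h1
    - (capWeight p (next x) * lowerC p x.1 s x) * h4
    - lowerT p x.1 s x * capWeight p x * lowerC p x.1 s y * h3
    - (capWeight p (next x) * lowerC p x.1 s x * capWeight p x * cupWeight p (dual x)) * h2

/-- The cases are distinguished by which of the first two labels the operator can move. The
non-diagonal parts of the crossing produce the boundary terms of `lower_tailSum`, which the weight
identities with `zWeight` absorb. -/
theorem commute_lower_crossOp : Commute (lower p c s : Op K n m) (crossOp p) := by
  refine hom_ext₂ (by simp) (by simp) fun x y v => ?_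
  have hx2 := x.2.2
  have hy2 := y.2.2
  have h0 : (if y = dual x then zWeight p * capWeight p x else 0) *
      (lowerT p c s x * lowerT p c s y) =
      if y = dual x then zWeight p * capWeight p x else 0 := by
    split_ifs with h
    · rw [h, lowerT_mul_dual hp hs, mul_one]
    · rw [zero_mul]
  have h0' : (if y = dual x then zWeight p * capWeight p x else 0) *
      (cupWeight p (dual x) * lowerC p c s (dual x)) =
      if y = dual x then zWeight p * lowerC p c s y else 0 := by
    split_ifs with h
    · rw [h]
      linear_combination zWeight p * lowerC p c s (dual x) * capWeight_mul_cupWeight hp x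
    · rw [zero_mul]
  have h1 : lowerC p c s x ≠ 0 →
      crossWeight p (next x) y = crossWeight p x y * lowerT p c s y :=
    fun h => crossWeight_next hp hs h y
  simp only [Module.End.mul_apply, crossOp_pre, lower_pre, map_add, map_smul, smul_add,
    lower_tailSum hp hs]
  by_cases hx : lowerC p c s x = 0
  · by_cases hy : lowerC p c s y = 0
    -- Neither label moves: only the group-like factors occur, and they cancel on a dual pair.
    · have h0' : (if y = dual x then zWeight p * capWeight p x else 0) *
          (cupWeight p (dual x) * lowerC p c s (dual x)) = 0 := by rw [h0', hy]; simp
      simp only [hx, hy]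
      linear_combination (norm := module) -(h0 • (tailSum p (dual x)) ((lower p c s) v)) -
        h0' • pre (next (dual x)) (pre (dual (dual x)) v)
    -- Only the second label moves. It can move into `x`, which switches off the term with unchanged
    -- labels, or start at `dual x`, which produces the boundary term of the tail.
    · have hy' := (lowerC_ne_zero_iff hp).1 hy
      have hl := lowerT_mul_crossWeight hp hs hx hy
      have hb : next y ≠ dual x := by
        intro h
        refine (lowerC_ne_zero_iff hp).2 ⟨?_, ?_⟩ hx
        · rw [← dual_fst, ← h, next_fst, hy'.1]
        · have := congr_arg (fun a : Label n m => a.2.val) h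
          simp only [next_snd (x := y) (by omega), dual_snd] at this
          omega
      have ha : (if x.1 = y.1 ∧ y.2 < x.2 then zWeight p else 0) =
          (if x.1 = (next y).1 ∧ (next y).2 < x.2 then zWeight p else 0) +
            if x = next y then zWeight p else 0 := by
        simp only [ext_label (x := x), Fin.lt_def, next_fst, next_snd (x := y) (by omega)]
        split_ifs <;> first | omega | simp
      have hc : (if y = dual x then zWeight p * lowerC p c s y else 0) •
          pre (next (dual x)) (pre (dual (dual x)) v) =
          (if y = dual x then zWeight p * lowerC p c s y else 0) • pre (next y) (pre x v) := by
        split_ifs with h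
        · rw [h, dual_dual]
        · simp
      have hd : (if x = next y then zWeight p else 0) • pre x (pre (next y) v) =
          (if x = next y then zWeight p else 0) • pre (next y) (pre x v) := by
        split_ifs with h
        · rw [h]
        · simp
      have hl' : lowerT p c s x * crossWeight p x (next y) =
          crossWeight p x y + (if x = next y then zWeight p else 0) * lowerT p c s x -
          (if y = dual x then zWeight p else 0) := by rw [hl]; split_ifs <;> simp
      have he : (if y = dual x then zWeight p * lowerC p c s y else 0) =
          (if y = dual x then zWeight p else 0) * lowerC p c s y := by split_ifs <;> simp
      rw [if_neg hb]
      simp only [hx]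
      linear_combination (norm := module) -(h0 • (tailSum p (dual x)) ((lower p c s) v)) -
        h0' • pre (next (dual x)) (pre (dual (dual x)) v) - hc +
        (lowerT p c s x * lowerC p c s y) • (ha • pre x (pre (next y) v)) +
        (lowerT p c s x * lowerC p c s y) • hd -
        (lowerC p c s y) • hl' • pre (next y) (pre x v) - he • pre (next y) (pre x v)
  · have hx' := (lowerC_ne_zero_iff hp).1 hx
    have h1 := h1 hx
    by_cases hy : lowerC p c s y = 0
    · have h0' : (if y = dual x then zWeight p * capWeight p x else 0) *
          (cupWeight p (dual x) * lowerC p c s (dual x)) = 0 := by rw [h0', hy]; simp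
      have hb : y ≠ dual (next x) := by
        rintro rfl
        refine (lowerC_ne_zero_iff hp (x := dual (next x))).2 ⟨hx'.1, ?_⟩ hy
        rw [dual_snd, next_snd (by omega)]
        omega
      have ha : (if (next x).1 = y.1 ∧ y.2 < (next x).2 then zWeight p else 0) =
          if x.1 = y.1 ∧ y.2 < x.2 then zWeight p else 0 := by
        have : ¬ (x.1 = y.1 ∧ x.2.val = y.2.val) := by
          rw [← ext_label]; rintro rfl; exact hx hy
        simp only [Fin.lt_def, next_fst, next_snd (x := x) (by omega)]
        exact if_congr (by omega) rfl rfl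
      rw [if_neg hb, ha, h1]
      simp only [hy]
      linear_combination (norm := module) -(h0 • (tailSum p (dual x)) ((lower p c s) v)) -
        h0' • pre (next (dual x)) (pre (dual (dual x)) v)
    · have hy' := (lowerC_ne_zero_iff hp).1 hy
      have hb : y ≠ dual x := by
        intro h
        have := congr_arg (fun a : Label n m => a.2.val) h
        simp only [dual_snd] at this
        omega
      -- Both labels move: either they coincide, or `y` is the dual of `next x`.
      by_cases hxy : x = y
      · subst hxy
        have hl := zWeight_add_lowerT_mul hp hs hx
        have ha : (next x).1 = x.1 ∧ x.2 < (next x).2 :=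
          ⟨rfl, by rw [Fin.lt_def, next_snd (by omega)]; omega⟩
        have ha' : ¬ (x.1 = (next x).1 ∧ (next x).2 < x.2) := fun h => lt_asymm h.2 ha.2
        rw [if_neg hb, if_pos ha, if_neg ha', h1, if_neg (fun h => lt_irrefl _ h.2)]
        by_cases hd : next x = dual x
        · have hd' : x = dual (next x) := by rw [hd, dual_dual]
          have h3 := lowerC_mul_capWeight hp hs hx hd'
          rw [if_pos hd', if_pos hd, ← hd', ← hd, tailSum_succ (y := x) p (by omega), ← hd']
          rw [if_pos hd] at hl
          linear_combination (norm := module) (-zWeight p) • h3 • tailSum p (next x) v -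
            lowerC p c s x • hl • pre (next x) (pre x v)
        · have hd' : x ≠ dual (next x) := fun h => hd (by rw [h, dual_dual, ← h])
          rw [if_neg hd] at hl
          rw [if_neg hd, if_neg hd']
          linear_combination (norm := module) - lowerC p c s x • hl • pre (next x) (pre x v)
      · have hl := lowerT_mul_lowerC hp hs hx hy hxy
        rw [ext_label] at hxy
        have hd : y = dual (next x) := by
          rw [ext_label, dual_snd, next_snd (by omega), dual_fst, next_fst, hx'.1, hy'.1]
          refine ⟨rfl, ?_⟩
          omega
        have hd' : next y = dual x := by rw [hd, next_dual_next (by omega)]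
        have ha : (if (next x).1 = y.1 ∧ y.2 < (next x).2 then zWeight p else 0) =
            if x.1 = y.1 ∧ y.2 < x.2 then zWeight p else 0 := by
          simp only [Fin.lt_def, next_fst, next_snd (x := x) (by omega)]
          exact if_congr (by omega) rfl rfl
        have ha' : (if x.1 = (next y).1 ∧ (next y).2 < x.2 then zWeight p else 0) =
            if x.1 = y.1 ∧ y.2 < x.2 then zWeight p else 0 := by
          simp only [Fin.lt_def, next_fst, next_snd (x := y) (by omega)]
          exact if_congr (by omega) rfl rfl
        have h3 := lowerC_mul_capWeight hp hs hx hd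
        have ht := tailSum_succ (y := y) p (by omega) v
        have hdn : dual (next y) = x := by rw [hd', dual_dual]
        rw [if_neg hb, ha, ha', if_pos hd, if_pos hd', h1, ← hd, ← hd', ht, hdn]
        linear_combination (norm := module) (-zWeight p) • h3 • tailSum p (next y) v -
            hl • pre (next y) (pre x v)

end Lower

end Vertex
end TiedLink

namespace TiedLink
namespace Vertex

/-! ### Relations between the operators -/

variable {K : Type*} [Field K] {n m : ℕ} (p : K)

/-- The operators that commute with the lowering operators. -/
noncomputable def invariants : Subalgebra K (Op K n m) :=
  Subalgebra.centralizer K {F | ∃ c s, s < m ∧ F = lower p c s}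

/-- The value of a negative curl. -/
def twist (m : ℕ) : K := p⁻¹ * (-(p⁻¹ ^ 2)) ^ m

/-- The operator that moves a first label past the next two. -/
noncomputable def slide (b : Label n m) : Op K n m :=
  onPairs fun y t => (crossWeight p b y * crossWeight p b t) • (pre y * pre t * pre b)

@[simp] theorem slide_vac (b : Label n m) : slide p b vac = 0 := onPairs_vac _

@[simp] theorem slide_pre_vac (b y : Label n m) : slide p b (pre y vac) = 0 := onPairs_pre_vac _ _

@[simp] theorem slide_pre (b y t : Label n m) (v : State K n m) :
    slide p b (pre y (pre t v)) =
      (crossWeight p b y * crossWeight p b t) • pre y (pre t (pre b v)) := by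
  simp [slide]

theorem mem_invariants {X : Op K n m} :
    X ∈ invariants p ↔ ∀ c s, s < m → Commute (lower p c s) X := by
  rw [invariants, Subalgebra.mem_centralizer_iff]
  exact ⟨fun h c s hs => h _ ⟨c, s, hs, rfl⟩, fun h F ⟨c, s, hs, hF⟩ => hF ▸ h c s hs⟩

theorem up_mem_invariants {X : Op K n m} (h : X ∈ invariants p) : up X ∈ invariants p :=
  (mem_invariants p).2 fun c s hs => commute_lower_up p ((mem_invariants p).1 h c s hs)

theorem pairSum_up_up (P : Label n m → Prop) [DecidablePred P] (T : Op K n m) (v : State K n m) :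
    pairSum p P (T v) = up (up T) (pairSum p P v) := by
  simp only [pairSum_apply, map_sum]
  refine Finset.sum_congr rfl fun k _ => ?_
  split_ifs <;> simp

/-- This and the following lemmas are the exchange of heights with a slice acting two or more places
to the right. -/
theorem capOp_up_up (T : Op K n m) : capOp p * up (up T) = T * capOp p := by
  refine hom_ext₂ (by simp) (by simp) fun x y v => ?_
  simp only [Module.End.mul_apply, up_pre, capOp_pre]
  split_ifs <;> simp

theorem cupOp_up_up (T : Op K n m) : cupOp p * T = up (up T) * cupOp p :=
  LinearMap.ext fun v => pairSum_up_up p _ T v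

theorem tieOp_up_up (T : Op K n m) : tieOp * up (up T) = up (up T) * tieOp := by
  refine hom_ext₂ (by simp) (by simp) fun x y v => ?_
  simp only [Module.End.mul_apply, up_pre, tieOp_pre]
  split_ifs <;> simp

theorem crossOp_up_up (T : Op K n m) : crossOp p * up (up T) = up (up T) * crossOp p := by
  refine hom_ext₂ (by simp) (by simp) fun x y v => ?_
  simp only [Module.End.mul_apply, up_pre, crossOp_pre, map_add, map_smul, pairSum_up_up]

theorem hookOp_up_up (T : Op K n m) : hookOp p * up (up T) = up (up T) * hookOp p := by
  rw [hookOp, mul_assoc, ← up_mul, ← up_mul, cupOp_up_up, mul_assoc, ← up_mul, up_mul (up (up T)),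
    ← mul_assoc tieOp, tieOp_up_up, mul_assoc, up_mul, ← mul_assoc, capOp_up_up, up_mul]
  simp only [mul_assoc]

theorem sub_mul_op (a b c : Op K n m) : (a - b) * c = a * c - b * c := rfl

theorem mul_sub_op (a b c : Op K n m) : a * (b - c) = a * b - a * c :=
  LinearMap.ext fun _ => map_sub a _ _

theorem crossOp'_up_up (T : Op K n m) : crossOp' p * up (up T) = up (up T) * crossOp' p := by
  simp only [crossOp', sub_mul_op, mul_sub_op, smul_mul_assoc, mul_smul_comm, add_mul, mul_add,
    tieOp_up_up, hookOp_up_up, crossOp_up_up]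

theorem tieOp_pairSum (P : Label n m → Prop) [DecidablePred P] (v : State K n m) :
    tieOp (pairSum p P v) = pairSum p P v := by
  simp only [pairSum_apply, map_sum]
  refine Finset.sum_congr rfl fun k _ => ?_
  split_ifs <;> simp

@[simp] theorem hookOp_vac : hookOp p (vac : State K n m) = 0 := by simp [hookOp]

@[simp] theorem hookOp_pre_vac (x : Label n m) : hookOp p (pre x (vac : State K n m)) = 0 := by
  simp [hookOp]

theorem hookOp_pre (x y : Label n m) (v : State K n m) :
    hookOp p (pre x (pre y v)) =
      if y = dual x then capWeight p x • colourSum p x.1 v else 0 := by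
  simp only [hookOp, Module.End.mul_apply, up_pre, cupOp_apply, map_sum, map_smul, tieOp_pre]
  split_ifs with h
  · rw [pairSum_apply, Finset.smul_sum]
    refine Finset.sum_congr rfl fun k _ => ?_
    subst h
    rw [dual_fst]
    by_cases hk : k.1 = x.1
    · rw [if_pos hk.symm, if_pos hk, capOp_pre, if_pos rfl, smul_comm]
    · rw [if_neg (Ne.symm hk), if_neg hk]; simp
  · refine Finset.sum_eq_zero fun k _ => ?_
    split_ifs <;> simp only [capOp_pre, if_neg h, map_zero, smul_zero]

section

variable {p} (hp : p ≠ 0)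
include hp

theorem crossOp_mem_invariants : (crossOp p : Op K n m) ∈ invariants p :=
  (mem_invariants p).2 fun _ _ hs => commute_lower_crossOp hp hs

theorem cupOp_mem_invariants : (cupOp p : Op K n m) ∈ invariants p :=
  (mem_invariants p).2 fun _ _ hs => commute_lower_cupOp hp hs

omit hp in
theorem tieOp_mem_invariants : (tieOp : Op K n m) ∈ invariants p :=
  (mem_invariants p).2 fun _ _ _ => commute_lower_tieOp p _ _

theorem capOp_mem_invariants : (capOp p : Op K n m) ∈ invariants p := by
  refine (mem_invariants p).2 fun c s hs => hom_ext₂ (by simp) (by simp) fun x y v => ?_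
  have h0 : (if y = dual x then lowerT p c s x * lowerT p c s y else 1) = 1 := by
    split_ifs with h
    · rw [h, lowerT_mul_dual hp hs]
    · rfl
  have h1 : (if y = dual (next x) then lowerC p c s x * capWeight p (next x) else 0) +
      (if next y = dual x then lowerT p c s x * lowerC p c s y * capWeight p x else 0) = 0 := by
    by_cases hx : lowerC p c s x = 0
    · by_cases hy : lowerC p c s y = 0
      · simp [hx, hy]
      · have hy' := (lowerC_ne_zero_iff hp).1 hy
        rw [hx, if_neg (c := next y = dual x) (fun h => (lowerC_ne_zero_iff hp).2 ⟨?_, ?_⟩ hx)]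
        · simp
        · rw [← dual_fst, ← h, next_fst, hy'.1]
        · have := congr_arg (fun a : Label n m => a.2.val) h
          simp only [next_snd (x := y) (by omega), dual_snd] at this
          have := x.2.2
          omega
    · have hx' := (lowerC_ne_zero_iff hp).1 hx
      by_cases hy : lowerC p c s y = 0
      · rw [if_neg, hy]
        · simp
        · rintro rfl
          refine (lowerC_ne_zero_iff hp (x := dual (next x))).2 ⟨hx'.1, ?_⟩ hy
          rw [dual_snd, next_snd (by omega)]
          omega
      · have hy' := (lowerC_ne_zero_iff hp).1 hy
        by_cases h : y = dual (next x)
        · rw [if_pos h, if_pos (by rw [h, next_dual_next (by omega)])]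
          exact lowerC_mul_capWeight hp hs hx h
        · rw [if_neg h, if_neg, add_zero]
          intro h'
          refine h ?_
          rw [← dual_dual x] at h
          rw [← dual_dual y, ← next_dual_next (by omega : y.2.val + 1 < 2 * m), h', dual_dual]
  simp only [Module.End.mul_apply, lower_pre, map_add, map_smul, smul_add, capOp_pre, smul_ite,
    smul_zero]
  split_ifs at h0 h1 ⊢ <;> simp only [map_smul, map_zero] <;>
    linear_combination (norm := module) -(h1 • v) - (capWeight p x • h0) • lower p c s v

/-- Lowering a word that begins with `y` gives a nonzero multiple of the word that begins with `next
y`, plus a word that begins with `y`. Every first label is thus reached from the bottom of its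
colour, and an operator that commutes with lowering is determined by its values on words with a
bottom label in front. -/
theorem eq_of_bottom {X Y : Op K n m} (hX : X ∈ invariants p) (hY : Y ∈ invariants p)
    (h0 : X vac = Y vac) (h : ∀ b : Label n m, b.2.val = 0 → ∀ v, X (pre b v) = Y (pre b v)) :
    X = Y := by
  refine hom_ext h0 fun x v => ?_
  obtain ⟨c, j, hj⟩ := x
  induction j generalizing v with
  | zero => exact h _ rfl v
  | succ j ih =>
    replace ih : ∀ v, _ := fun v => ih v (by omega)
    set y : Label n m := (c, ⟨j, by omega⟩) with hy
    have hn : next y = (c, ⟨j + 1, hj⟩) := by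
      rw [ext_label, next_snd (by simp [hy]; omega)]
      exact ⟨rfl, rfl⟩
    obtain ⟨s, hs, hφ⟩ : ∃ s, s < m ∧ lowerC p c s y ≠ 0 := by
      by_cases hjm : j < m
      · exact ⟨j, hjm, (lowerC_ne_zero_iff hp).2 ⟨rfl, Or.inl rfl⟩⟩
      · exact ⟨2 * m - 2 - j, by omega,
          (lowerC_ne_zero_iff hp).2 ⟨rfl, Or.inr (by simp [hy]; omega)⟩⟩
    have h1 := LinearMap.congr_fun ((mem_invariants p).1 hX c s hs).eq (pre y v)
    have h2 := LinearMap.congr_fun ((mem_invariants p).1 hY c s hs).eq (pre y v)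
    simp only [Module.End.mul_apply, lower_pre, map_add, map_smul, hn] at h1 h2
    rw [← ih v, ← ih, h1] at h2
    exact smul_right_injective _ hφ (add_right_cancel h2)

theorem hookOp_mem_invariants : (hookOp p : Op K n m) ∈ invariants p :=
  mul_mem (mul_mem (capOp_mem_invariants hp) (up_mem_invariants p tieOp_mem_invariants))
    (up_mem_invariants p (up_mem_invariants p (cupOp_mem_invariants hp)))

end

/-! ### Words that begin with a bottom label -/

section Bottom

variable {p} (hp : p ≠ 0) {b : Label n m} (hb : b.2.val = 0)

omit [Field K] in
theorem mem_pos (b : Label n m) : 0 < m := by have := b.2.2; omega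

include hb in
-- The truncated subtraction in the exponent gives the weight `1` to every label in the lower half.
theorem cupWeight_bottom : cupWeight p b = 1 := by
  have := mem_pos b
  rw [cupWeight, hb, show 0 + 1 - m = 0 by omega, pow_zero]

include hb in
theorem capWeight_dual_bottom : capWeight p (dual b) = 1 := by
  rw [capWeight, dual_dual, cupWeight_bottom hb, inv_one]

include hp hb in
theorem twist_mul_capWeight : twist p m * capWeight p b = p⁻¹ := by
  have := mem_pos b
  have h0 : -(p⁻¹ ^ 2) ≠ 0 := neg_ne_zero.2 (pow_ne_zero _ (inv_ne_zero hp))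
  rw [twist, capWeight, cupWeight, dual_snd, hb, show 2 * m - 1 - 0 + 1 - m = m by omega, mul_assoc,
    mul_inv_cancel₀ (pow_ne_zero _ h0), mul_one]

include hb in
-- No label lies below `b`, and no label lies above its dual, so both non-diagonal parts of the
-- crossing vanish.
theorem crossOp_bottom (y : Label n m) (v : State K n m) :
    crossOp p (pre b (pre y v)) = crossWeight p b y • pre y (pre b v) := by
  have := mem_pos b
  rw [crossOp_pre, if_neg (fun h => by have := Fin.lt_def.1 h.2; omega),
    tailSum_of_last p (by rw [dual_snd]; omega)]
  simp

include hb in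
theorem up_crossOp_crossOp_bottom (u : State K n m) :
    up (crossOp p) (crossOp p (pre b u)) = slide p b u := by
  suffices h : up (crossOp p) * crossOp p * pre b = slide p b from LinearMap.congr_fun h u
  refine hom_ext₂ (by simp) (by simp [crossOp_bottom hb]) fun y t v => ?_
  simp [crossOp_bottom hb, smul_smul]

include hp in
theorem slide_pairSum (P : Label n m → Prop) [DecidablePred P] (v : State K n m) :
    slide p b (pairSum p P v) = pairSum p P (pre b v) := by
  simp only [pairSum_apply, map_sum]
  refine Finset.sum_congr rfl fun k _ => ?_
  split_ifs
  · rw [map_smul, slide_pre, crossWeight_mul_dual hp, one_smul]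
  · rw [map_zero]

include hp in
theorem capOp_slide (u : State K n m) : capOp p (slide p b u) = pre b (capOp p u) := by
  suffices h : capOp p * slide p b = pre b * capOp p from LinearMap.congr_fun h u
  refine hom_ext₂ (by simp) (by simp) fun y t v => ?_
  by_cases h : t = dual y
  · simp [h, crossWeight_mul_dual hp]
  · simp [h]

include hp in
-- Passing the bottom label over two letters multiplies by weights that depend only on these
-- letters. A crossing permutes the letters or replaces a dual pair by dual pairs, for which the
-- product of the weights is `1`.
theorem crossOp_slide (u : State K n m) : crossOp p (slide p b u) = slide p b (crossOp p u) := by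
  suffices h : crossOp p * slide p b = slide p b * crossOp p from LinearMap.congr_fun h u
  refine hom_ext₂ (by simp) (by simp) fun y t v => ?_
  simp only [Module.End.mul_apply, slide_pre, crossOp_pre, map_add, map_smul, slide_pairSum hp]
  by_cases h : t = dual y
  · have h1 := crossWeight_mul_dual hp b y
    rw [h]
    linear_combination (norm := module) ((if dual y = dual y then zWeight p * capWeight p y else 0)
       • h1) • tailSum p (dual y) (pre b v)
  · rw [if_neg h]
    module

end Bottom

/-! ### Identities checked on bottom labels -/

section Relations

theorem mul_up_one {X : Op K n m} (h : X vac = 0) : X * up 1 = X :=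
  hom_ext (by simp [h]) (by simp)

theorem mul_up_up_one {X : Op K n m} (h : X vac = 0) (h' : ∀ x, X (pre x vac) = 0) :
    X * up (up 1) = X :=
  hom_ext₂ (by simp [h]) (by simp [h']) (by simp)

@[simp] theorem crossOp'_vac : crossOp' p (vac : State K n m) = 0 := by simp [crossOp']

@[simp] theorem crossOp'_pre_vac (x : Label n m) : crossOp' p (pre x (vac : State K n m)) = 0 := by
  simp [crossOp']

theorem crossOp_add_crossOp' :
    crossOp p + crossOp' p = (zWeight p • (tieOp + hookOp p) : Op K n m) := by
  rw [crossOp']; abel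

theorem tieOp_mul_crossOp : (tieOp * crossOp p : Op K n m) = crossOp p * tieOp := by
  refine hom_ext₂ (by simp) (by simp) fun x y v => ?_
  simp only [Module.End.mul_apply, tieOp_pre, crossOp_pre, map_add, map_smul, tieOp_pairSum]
  by_cases h : x.1 = y.1
  · simp only [if_pos h, if_pos h.symm, crossOp_pre]
  · rw [if_neg h, if_neg (Ne.symm h), if_neg (fun h' => h h'.1),
      if_neg (fun h' => h (by rw [h', dual_fst]))]
    simp

variable {p} (hp : p ≠ 0)
include hp

/-- On a bottom label, one side lets it pass the next two letters before these cross, the other side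
afterwards; this is `crossOp_slide`. -/
theorem braid : (crossOp p * up (crossOp p) * crossOp p : Op K n m) =
    up (crossOp p) * crossOp p * up (crossOp p) := by
  have h := crossOp_mem_invariants (n := n) (m := m) hp
  refine eq_of_bottom hp (mul_mem (mul_mem h (up_mem_invariants p h)) h)
    (mul_mem (mul_mem (up_mem_invariants p h) h) (up_mem_invariants p h)) (by simp)
    fun b hb v => ?_
  simp only [Module.End.mul_apply, up_pre, up_crossOp_crossOp_bottom hb]
  exact crossOp_slide hp v

theorem capOp_up_crossOp_crossOp :
    (capOp p * up (crossOp p) * crossOp p : Op K n m) = up (capOp p) := by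
  have h := crossOp_mem_invariants (n := n) (m := m) hp
  have h' := capOp_mem_invariants (n := n) (m := m) hp
  refine eq_of_bottom hp (mul_mem (mul_mem h' (up_mem_invariants p h)) h)
    (up_mem_invariants p h') (by simp) fun b hb v => ?_
  simp only [Module.End.mul_apply, up_pre, up_crossOp_crossOp_bottom hb]
  exact capOp_slide hp v

theorem up_crossOp_crossOp_up_cupOp :
    (up (crossOp p) * crossOp p * up (cupOp p) : Op K n m) = cupOp p * up 1 := by
  have h := crossOp_mem_invariants (n := n) (m := m) hp
  have h' := cupOp_mem_invariants (n := n) (m := m) hp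
  refine eq_of_bottom hp (mul_mem (mul_mem (up_mem_invariants p h) h) (up_mem_invariants p h'))
    (mul_mem h' (up_mem_invariants p (one_mem _))) (by simp) fun b hb v => ?_
  simp only [Module.End.mul_apply, up_pre, up_crossOp_crossOp_bottom hb, Module.End.one_apply]
  exact slide_pairSum hp _ v

theorem capOp_mul_crossOp : (capOp p * crossOp p : Op K n m) = twist p m • capOp p := by
  have h' := capOp_mem_invariants (n := n) (m := m) hp
  refine eq_of_bottom hp (mul_mem h' (crossOp_mem_invariants hp)) (Subalgebra.smul_mem _ h' _)
    (by simp) fun b hb v => ?_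
  suffices h : capOp p * crossOp p * pre b = twist p m • (capOp p * pre b) from
    LinearMap.congr_fun h v
  refine hom_ext (by simp) fun y v => ?_
  have := mem_pos b
  have h1 := twist_mul_capWeight hp hb
  simp only [Module.End.mul_apply, crossOp_bottom hb, map_smul, capOp_pre, LinearMap.smul_apply]
  by_cases h : y = dual b
  · have h2 : crossWeight p b (dual b) = p⁻¹ := by
      rw [crossWeight, if_pos (dual_fst _).symm, dual_snd, labelWeight_opp p (by omega)]
    rw [h, if_pos (dual_dual b).symm, if_pos rfl, capWeight_dual_bottom hb, h2, smul_smul, smul_smul,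
      h1, mul_one]
  · rw [if_neg (fun h' => h (by rw [h', dual_dual])), if_neg h, smul_zero, smul_zero]

theorem hookOp_mul_crossOp : (hookOp p * crossOp p : Op K n m) = twist p m • hookOp p := by
  have h' := hookOp_mem_invariants (n := n) (m := m) hp
  refine eq_of_bottom hp (mul_mem h' (crossOp_mem_invariants hp)) (Subalgebra.smul_mem _ h' _)
    (by simp) fun b hb v => ?_
  suffices h : hookOp p * crossOp p * pre b = twist p m • (hookOp p * pre b) from
    LinearMap.congr_fun h v
  refine hom_ext (by simp) fun y v => ?_
  have := mem_pos b
  have h1 := twist_mul_capWeight hp hb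
  simp only [Module.End.mul_apply, crossOp_bottom hb, map_smul, hookOp_pre, LinearMap.smul_apply]
  by_cases h : y = dual b
  · have h2 : crossWeight p b (dual b) = p⁻¹ := by
      rw [crossWeight, if_pos (dual_fst _).symm, dual_snd, labelWeight_opp p (by omega)]
    rw [h, if_pos (dual_dual b).symm, if_pos rfl, capWeight_dual_bottom hb, h2, smul_smul, smul_smul,
      h1, mul_one, dual_fst]
  · rw [if_neg (fun h' => h (by rw [h', dual_dual])), if_neg h, smul_zero, smul_zero]

/-- The skein relation multiplied by the crossing, with the inverse crossing eliminated. `up (up 1)`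
replaces the identity: it annihilates words with fewer than two letters, as the crossing does. -/
theorem crossOp_mul_crossOp : (crossOp p * crossOp p + up (up 1) : Op K n m) =
    zWeight p • (tieOp * crossOp p) + (zWeight p * twist p m) • hookOp p := by
  have h := crossOp_mem_invariants (n := n) (m := m) hp
  refine eq_of_bottom hp (add_mem (mul_mem h h)
      (up_mem_invariants p (up_mem_invariants p (one_mem _))))
    (add_mem (Subalgebra.smul_mem _ (mul_mem tieOp_mem_invariants h) _)
      (Subalgebra.smul_mem _ (hookOp_mem_invariants hp) _))
    (by simp) fun b hb v => ?_
  suffices h : (crossOp p * crossOp p + up (up 1)) * pre b =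
      (zWeight p • (tieOp * crossOp p) + (zWeight p * twist p m) • hookOp p) * pre b from
    LinearMap.congr_fun h v
  refine hom_ext (by simp) fun y v => ?_
  have := mem_pos b
  have h1 := twist_mul_capWeight hp hb
  simp only [Module.End.mul_apply, LinearMap.add_apply, crossOp_bottom hb, map_smul, up_pre,
    Module.End.one_apply, LinearMap.smul_apply, tieOp_pre, hookOp_pre]
  rw [crossOp_pre, colourSum_eq p hb, cupWeight_bottom hb]
  by_cases hyb : y = b
  · subst hyb
    have h2 : crossWeight p y y = p := by rw [crossWeight, if_pos rfl, labelWeight_self]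
    have h3 : y ≠ dual y := by
      rw [Ne, ext_label, dual_snd]; omega
    rw [if_neg (fun h => lt_irrefl _ h.2), if_neg h3, if_pos rfl, h2, if_neg h3]
    -- Equal bottom labels are an eigenvector of the crossing with eigenvalue `p`, which forces `z =
    -- p + p⁻¹`.
    have h4 : p * p + 1 = zWeight p * p := by rw [zWeight]; field_simp
    linear_combination (norm := module) h4 • pre y (pre y v)
  by_cases hyd : y = dual b
  · subst hyd
    have h2 : crossWeight p b (dual b) = p⁻¹ := by
      rw [crossWeight, if_pos (dual_fst _).symm, dual_snd, labelWeight_opp p (by omega)]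
    have h3 : crossWeight p (dual b) b = p⁻¹ := by
      rw [crossWeight, if_pos (dual_fst _), dual_snd, labelWeight_opp p (by omega)]
    have h4 : b.2 < (dual b).2 := by rw [Fin.lt_def, dual_snd]; omega
    have h5 : p⁻¹ * p⁻¹ + 1 = zWeight p * p⁻¹ := by
      rw [zWeight]; field_simp; ring
    rw [if_pos ⟨rfl, h4⟩, if_pos (dual_dual b).symm, if_pos rfl, if_pos (dual_fst b), dual_dual, h2,
      h3, capWeight_dual_bottom hb]
    linear_combination (norm := module) h5 • pre b (pre (dual b) v) -
      (zWeight p • h1) • (pre b (pre (dual b) v) + tailSum p b v)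
  · have h2 := crossWeight_mul_swap (p := p) (Ne.symm hyb) hyd
    rw [if_neg (c := b = dual y) (fun h => hyd (by rw [h, dual_dual])), if_neg hyd]
    by_cases h : y.1 = b.1
    · have h4 : b.2 < y.2 := by
        have : ¬ (y.1 = b.1 ∧ y.2.val = b.2.val) := by rwa [← ext_label]
        rw [Fin.lt_def]
        omega
      rw [if_pos ⟨h, h4⟩, if_pos h]
      linear_combination (norm := module) h2 • pre b (pre y v)
    · rw [if_neg (c := y.1 = b.1 ∧ b.2 < y.2) (fun h' => h h'.1), if_neg h]
      linear_combination (norm := module) h2 • pre b (pre y v)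

end Relations

end Vertex
end TiedLink

namespace TiedLink
namespace Vertex

/-! ### The second crossing -/

/-- The braid relation is inverted by multiplying it with the inverses on both sides. `P` and `Q`
play the role of the identity because the operators are invertible only on sufficiently long words.
-/
theorem braid_inverse {M : Type*} [Monoid M] {A a C c P Q : M} (hAa : A * a = P) (haA : a * A = P)
    (hCc : C * c = Q) (hcC : c * C = Q) (hPC : P * C = C) (hPc : P * c = c) (hQc : Q * c = c)
    (hcQ : c * Q = c) (hQA : Q * A = A * Q) (hQa : Q * a = a * Q)
    (h : A * C * A = C * A * C) : a * c * a = c * a * c := by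
  have h1 : a * c * a * (A * C * A) * (c * a * c) = c * a * c := by
    calc _ = a * c * (a * A * C) * A * c * a * c := by simp only [mul_assoc]
      _ = a * (c * C) * A * c * a * c := by rw [haA, hPC]; simp only [mul_assoc]
      _ = a * A * (Q * c) * a * c := by rw [hcC, mul_assoc a Q, hQA]; simp only [mul_assoc]
      _ = _ := by rw [hQc, haA, hPc]
  have h2 : a * c * a * (C * A * C) * (c * a * c) = a * c * a := by
    calc _ = a * c * a * C * A * (C * c) * a * c := by simp only [mul_assoc]
      _ = a * c * a * C * (A * a) * (Q * c) := by
        rw [hCc, mul_assoc _ Q a, hQa]; simp only [mul_assoc]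
      _ = a * c * (a * (C * c)) := by
        rw [hQc, hAa, mul_assoc _ P, hPc]; simp only [mul_assoc]
      _ = a * c * a := by rw [hCc, ← hQa, ← mul_assoc, mul_assoc a c Q, hcQ]
  rw [← h1, h, h2]

variable {K : Type*} [Field K] {n m : ℕ} {p : K}

theorem hom_ext₃ {X Y : Op K n m} (h0 : X vac = Y vac) (h1 : ∀ x, X (pre x vac) = Y (pre x vac))
    (h2 : ∀ x y, X (pre x (pre y vac)) = Y (pre x (pre y vac)))
    (h : ∀ x y t v, X (pre x (pre y (pre t v))) = Y (pre x (pre y (pre t v)))) : X = Y := by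
  refine hom_ext₂ h0 h1 fun x y v => ?_
  exact LinearMap.congr_fun (hom_ext (X := X * (pre x * pre y)) (Y := Y * (pre x * pre y)) (h2 x y)
    (h x y)) v

section

variable (hp : p ≠ 0)
include hp

/-- Only one of the labels of a minimum fits a given label on its left. -/
theorem sum_cupWeight_smul (x : Label n m) (f : Label n m → State K n m) :
    ∑ k, cupWeight p k • (if k = dual x then capWeight p x • f k else 0) = f (dual x) := by
  rw [Finset.sum_eq_single (dual x)]
  · rw [if_pos rfl, smul_smul, mul_comm, capWeight_mul_cupWeight hp, one_smul]
  · intro k _ hk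
    rw [if_neg hk, smul_zero]
  · simp

/-- Only one of the labels of a minimum fits a given label on its right. -/
theorem sum_cupWeight_smul' (x : Label n m) (f : Label n m → State K n m) :
    ∑ k, cupWeight p k • (if x = dual (dual k) then capWeight p (dual k) • f k else 0) = f x := by
  rw [Finset.sum_eq_single x]
  · have := capWeight_mul_cupWeight hp (dual x)
    rw [dual_dual] at this
    rw [dual_dual, if_pos rfl, smul_smul, mul_comm, this, one_smul]
  · intro k _ hk
    rw [dual_dual, if_neg (Ne.symm hk), smul_zero]
  · simp

theorem up_capOp_mul_cupOp : (up (capOp p) * cupOp p : Op K n m) = up 1 := by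
  refine hom_ext ?_ fun x v => ?_
  · simp [cupOp_apply]
  · rw [Module.End.mul_apply, cupOp_apply, map_sum]
    refine (Finset.sum_congr rfl fun k _ => ?_).trans ((sum_cupWeight_smul' hp x fun k => pre k v).trans
      (up_pre 1 x v).symm)
    rw [map_smul, up_pre, capOp_pre]
    split_ifs with h
    · rw [map_smul]
    · rw [map_zero]

theorem capOp_mul_up_cupOp : (capOp p * up (cupOp p) : Op K n m) = up 1 := by
  refine hom_ext (by simp) fun x v => ?_
  simp only [Module.End.mul_apply, up_pre, cupOp_apply, map_sum, map_smul, capOp_pre,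
    Module.End.one_apply]
  simpa using sum_cupWeight_smul hp x fun k => pre (dual k) v

theorem up_capOp_colourSum (c : Fin n) (t : Label n m) (v : State K n m) :
    up (capOp p) (colourSum p c (pre t v)) = if t.1 = c then pre t v else 0 := by
  rw [pairSum_apply, map_sum]
  refine (Finset.sum_congr rfl fun k _ => ?_).trans
    (sum_cupWeight_smul' hp t fun k => if k.1 = c then pre k v else 0)
  by_cases h1 : k.1 = c
  · rw [if_pos h1, if_pos h1, map_smul, up_pre, capOp_pre]
    split_ifs
    · rw [map_smul]
    · rw [map_zero]
  · simp [h1]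

theorem capOp_colourSum (c : Fin n) (x : Label n m) (v : State K n m) :
    capOp p (pre x (colourSum p c v)) = if x.1 = c then pre x v else 0 := by
  rw [pairSum_apply, map_sum, map_sum]
  refine (Finset.sum_congr rfl fun k _ => ?_).trans
    ((sum_cupWeight_smul hp x fun k => if k.1 = c then pre (dual k) v else 0).trans
      (by rw [dual_dual, dual_fst]))
  split_ifs with h1 h2 h2 <;> simp [h2]

/-- Rotating a tied smoothing around an extremum turns it into the other one. With the skein
relation, the rotation of one crossing therefore implies that of the opposite crossing. -/
theorem capOp_mul_up_hookOp : (capOp p * up (hookOp p) : Op K n m) = up (capOp p) * tieOp := by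
  refine hom_ext₃ (by simp) (fun x => by simp) (fun x y => ?_) fun x y t v => ?_
  · by_cases h : x.1 = y.1 <;> simp [h]
  · simp only [Module.End.mul_apply, up_pre, hookOp_pre, tieOp_pre]
    by_cases h1 : t = dual y
    · by_cases h2 : x.1 = y.1 <;> simp [h1, h2, capOp_colourSum hp]
    · by_cases h2 : x.1 = y.1 <;> simp [h1, h2]

theorem capOp_mul_up_tieOp : (capOp p * up tieOp : Op K n m) = up (capOp p) * hookOp p := by
  refine hom_ext₃ (by simp) (fun x => by simp) (fun x y => ?_) fun x y t v => ?_
  · simp only [Module.End.mul_apply, up_pre, hookOp_pre, tieOp_pre_vac, map_zero]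
    split_ifs
    · rw [map_smul, pairSum_apply, map_sum, Finset.sum_eq_zero, smul_zero]
      intro k _
      split_ifs <;> simp
    · rw [map_zero]
  · simp only [Module.End.mul_apply, up_pre, hookOp_pre, tieOp_pre]
    by_cases h1 : y = dual x
    · subst h1
      by_cases h2 : x.1 = t.1
      · simp [h2, up_capOp_colourSum hp]
      · simp [h2, up_capOp_colourSum hp, Ne.symm h2]
    · by_cases h2 : y.1 = t.1 <;> simp [h1, h2]

theorem hookOp_mul_up_cupOp : (hookOp p * up (cupOp p) : Op K n m) = up tieOp * cupOp p := by
  refine hom_ext ?_ fun x v => ?_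
  · simp [cupOp_apply]
  · simp only [Module.End.mul_apply, up_pre, cupOp_apply, map_sum, map_smul, hookOp_pre, tieOp_pre]
    refine (sum_cupWeight_smul hp x fun k => colourSum p x.1 (pre (dual k) v)).trans ?_
    rw [dual_dual, pairSum_apply]
    refine Finset.sum_congr rfl fun k _ => ?_
    by_cases h : k.1 = x.1
    · rw [if_pos h, if_pos (show (dual k).1 = x.1 from h)]
    · rw [if_neg h, if_neg (show ¬ (dual k).1 = x.1 from h), map_zero, smul_zero]

theorem tieOp_mul_up_cupOp : (tieOp * up (cupOp p) : Op K n m) = up (hookOp p) * cupOp p := by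
  refine hom_ext ?_ fun x v => ?_
  · simp [cupOp_apply]
  · simp only [Module.End.mul_apply, up_pre, cupOp_apply, map_sum, map_smul, hookOp_pre, tieOp_pre,
      dual_fst]
    refine Eq.trans ?_ ((sum_cupWeight_smul' hp x fun k => pre k (colourSum p k.1 v)).symm.trans ?_)
    · rw [pairSum_apply, map_sum]
      refine Finset.sum_congr rfl fun k _ => ?_
      by_cases h : k.1 = x.1
      · rw [if_pos h, if_pos h.symm, map_smul]
      · rw [if_neg h, if_neg (Ne.symm h), map_zero, smul_zero]
    · refine Finset.sum_congr rfl fun k _ => ?_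
      split_ifs <;> simp

omit hp in
theorem capOp_mul_cupOp :
    (capOp p * cupOp p : Op K n m) = (∑ k : Label n m, cupWeight p k * capWeight p k) • 1 := by
  refine LinearMap.ext fun v => ?_
  simp [cupOp_apply, Finset.sum_smul, smul_smul]

end

instance : IsRightCancelAdd (Op K n m) :=
  ⟨fun _ _ _ h => LinearMap.ext fun v => add_right_cancel (LinearMap.congr_fun h v)⟩

theorem up_one_pairSum (P : Label n m → Prop) [DecidablePred P] (v : State K n m) :
    up 1 (pairSum p P v) = pairSum p P v := by
  simp only [pairSum_apply, map_sum]
  refine Finset.sum_congr rfl fun k _ => ?_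
  split_ifs <;> simp

theorem up_one_mul_crossOp : (up 1 * crossOp p : Op K n m) = crossOp p := by
  refine hom_ext₂ (by simp) (fun x => by simp) fun x y v => ?_
  simp only [Module.End.mul_apply, crossOp_pre, map_add, map_smul, up_pre, Module.End.one_apply,
    up_one_pairSum]

theorem up_one_mul_crossOp' : (up 1 * crossOp' p : Op K n m) = crossOp' p := by
  refine hom_ext₂ (by simp) (fun x => by simp) fun x y v => ?_
  have h := LinearMap.congr_fun (up_one_mul_crossOp (p := p)) (pre x (pre y v))
  simp only [Module.End.mul_apply] at h
  simp only [Module.End.mul_apply, crossOp', LinearMap.sub_apply, LinearMap.smul_apply,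
    LinearMap.add_apply, map_sub, map_add, map_smul, h, hookOp_pre, tieOp_pre]
  split_ifs <;> simp [up_one_pairSum]

section

variable (hp : p ≠ 0) (hz : zWeight p ≠ 0)
include hp

theorem twist_ne_zero : twist p m ≠ 0 :=
  mul_ne_zero (inv_ne_zero hp)
    (pow_ne_zero _ (neg_ne_zero.2 (pow_ne_zero _ (inv_ne_zero hp))))

omit hp in
theorem crossOp'_mul_up_up_one : (crossOp' p * up (up 1) : Op K n m) = crossOp' p :=
  mul_up_up_one (by simp) (by simp)

include hz

/-- The crossing commutes with its square, with `up (up 1)` and with the tie, hence by the quadratic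
relation with the hook, whose coefficient there is nonzero. The twist on the other side is already
known. -/
theorem crossOp_mul_hookOp : (crossOp p * hookOp p : Op K n m) = twist p m • hookOp p := by
  rw [← hookOp_mul_crossOp hp]
  have h := crossOp_mul_crossOp (n := n) (m := m) hp
  have h1 : (crossOp p * (crossOp p * crossOp p + up (up 1)) : Op K n m) =
      (crossOp p * crossOp p + up (up 1)) * crossOp p := by
    rw [mul_add, add_mul, crossOp_up_up, mul_assoc]
  rw [h] at h1
  simp only [mul_add, add_mul, mul_smul_comm, smul_mul_assoc, ← mul_assoc,
    ← tieOp_mul_crossOp] at h1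
  have h2 : (zWeight p * twist p m) • (crossOp p * hookOp p) =
      ((zWeight p * twist p m) • (hookOp p * crossOp p) : Op K n m) := by
    linear_combination (norm := module) h1
  exact smul_right_injective _ (mul_ne_zero hz (twist_ne_zero hp)) h2

theorem crossOp_mul_crossOp' : (crossOp p * crossOp' p : Op K n m) = up (up 1) := by
  rw [crossOp', mul_sub_op, mul_smul_comm, mul_add, crossOp_mul_hookOp hp hz, ← tieOp_mul_crossOp]
  linear_combination (norm := module) -(crossOp_mul_crossOp (n := n) (m := m) hp)

omit hz in
theorem crossOp'_mul_crossOp : (crossOp' p * crossOp p : Op K n m) = up (up 1) := by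
  rw [crossOp', sub_mul_op, smul_mul_assoc, add_mul, hookOp_mul_crossOp hp]
  linear_combination (norm := module) -(crossOp_mul_crossOp (n := n) (m := m) hp)

theorem capOp_mul_crossOp' : (capOp p * crossOp' p : Op K n m) = (twist p m)⁻¹ • capOp p := by
  rw [eq_inv_smul_iff₀ (twist_ne_zero hp), ← smul_mul_assoc, ← capOp_mul_crossOp hp, mul_assoc,
    crossOp_mul_crossOp' hp hz, mul_up_up_one (by simp) (by simp)]

theorem capOp_mul_up_crossOp :
    (capOp p * up (crossOp p) : Op K n m) = up (capOp p) * crossOp' p := by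
  rw [← capOp_up_crossOp_crossOp hp, mul_assoc _ _ (crossOp' p), crossOp_mul_crossOp' hp hz,
    mul_assoc, ← up_mul, mul_up_one (by simp)]

/-- The skein relation handles the sum of both crossings, since rotation only exchanges its
smoothings; the crossing already known is subtracted. -/
theorem capOp_mul_up_crossOp' :
    (capOp p * up (crossOp' p) : Op K n m) = up (capOp p) * crossOp p := by
  have h := capOp_mul_up_crossOp (n := n) (m := m) hp hz
  have h' := crossOp_add_crossOp' (K := K) (n := n) (m := m) p
  have h1 : capOp p * up (crossOp p + crossOp' p) =
      (up (capOp p) * (crossOp p + crossOp' p) : Op K n m) := by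
    rw [h', up_smul, up_add, mul_smul_comm, mul_smul_comm, mul_add, mul_add,
      capOp_mul_up_hookOp hp, capOp_mul_up_tieOp hp, add_comm]
  rw [up_add, mul_add, mul_add, h] at h1
  linear_combination (norm := module) h1

omit hz in
theorem crossOp_mul_up_cupOp :
    (crossOp p * up (cupOp p) : Op K n m) = up (crossOp' p) * cupOp p := by
  have h := congr_arg (up (crossOp' p) * ·) (up_crossOp_crossOp_up_cupOp (n := n) (m := m) hp)
  simp only [← mul_assoc, ← up_mul, crossOp'_mul_crossOp hp] at h
  rw [mul_assoc _ (cupOp p), cupOp_up_up, ← mul_assoc, ← up_mul, crossOp'_mul_up_up_one] at h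
  rw [← h, ← crossOp_up_up, mul_assoc, ← up_mul, ← cupOp_up_up, mul_one]

omit hz in
theorem crossOp'_mul_up_cupOp :
    (crossOp' p * up (cupOp p) : Op K n m) = up (crossOp p) * cupOp p := by
  have h := crossOp_mul_up_cupOp (n := n) (m := m) hp
  have h' := crossOp_add_crossOp' (K := K) (n := n) (m := m) p
  have h1 : (crossOp p + crossOp' p) * up (cupOp p) =
      (up (crossOp p + crossOp' p) * cupOp p : Op K n m) := by
    rw [h', up_smul, up_add, smul_mul_assoc, smul_mul_assoc, add_mul, add_mul,
      hookOp_mul_up_cupOp hp, tieOp_mul_up_cupOp hp, add_comm]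
  rw [up_add, add_mul, add_mul, h] at h1
  linear_combination (norm := module) h1

theorem braid' : (crossOp' p * up (crossOp' p) * crossOp' p : Op K n m) =
    up (crossOp' p) * crossOp' p * up (crossOp' p) := by
  have h1 := crossOp_mul_crossOp' (n := n) (m := m) hp hz
  have h2 := crossOp'_mul_crossOp (n := n) (m := m) hp
  have h3 {X : Op K n m} (h : up 1 * X = X) : up (up 1) * up X = up X := by
    rw [← up_mul, h]
  exact braid_inverse h1 h2 (by rw [← up_mul, h1]) (by rw [← up_mul, h2]) (h3 up_one_mul_crossOp)
    (h3 up_one_mul_crossOp')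
    (by rw [← up_mul, ← crossOp'_up_up, crossOp'_mul_up_up_one])
    (by rw [← up_mul, crossOp'_mul_up_up_one]) (crossOp_up_up p _).symm
    (crossOp'_up_up p _).symm (braid hp)

end

end Vertex
end TiedLink

namespace TiedLink

open Slice

/-! ### State sums -/

namespace Vertex

variable {K : Type*} [Field K] {n m : ℕ} (p : K)

/-- A tie between the strands at two positions. -/
noncomputable def tieAt (i j : ℕ) : Op K n m :=
  Finsupp.linearCombination K fun l =>
    if i < l.length ∧ (l.map Prod.fst)[i]? = (l.map Prod.fst)[j]? then Finsupp.single l 1 else 0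

/-- The operator of a slice. -/
noncomputable def sliceOp : Slice Unit → Op K n m
  | cup i _ => up^[i] (cupOp p)
  | cap i => up^[i] (capOp p)
  | cross i ε => up^[i] (if ε = 1 then crossOp p else crossOp' p)
  | tie i j => tieAt i j

/-- The operator of a word. -/
noncomputable def wordOp : List (Slice Unit) → Op K n m
  | [] => 1
  | c :: w => wordOp w * sliceOp p c

theorem wordOp_append (u v : List (Slice Unit)) :
    (wordOp p (u ++ v) : Op K n m) = wordOp p v * wordOp p u := by
  induction u with
  | nil => simp [wordOp]
  | cons c u ih => simp only [List.cons_append, wordOp, ih, mul_assoc]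

theorem upIter_mul (k : ℕ) (X Y : Op K n m) : up^[k] (X * Y) = up^[k] X * up^[k] Y := by
  induction k with
  | zero => rfl
  | succ k ih => simp only [Function.iterate_succ_apply', ih, up_mul]

theorem upIter_smul (k : ℕ) (c : K) (X : Op K n m) : up^[k] (c • X) = c • up^[k] X := by
  induction k with
  | zero => rfl
  | succ k ih => simp only [Function.iterate_succ_apply', ih, up_smul]

theorem upIter_add (k : ℕ) (X Y : Op K n m) : up^[k] (X + Y) = up^[k] X + up^[k] Y := by
  induction k with
  | zero => rfl
  | succ k ih => simp only [Function.iterate_succ_apply', ih, up_add]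

theorem upIter_add_apply (i k : ℕ) (X : Op K n m) : up^[i + k] X = up^[k] (up^[i] X) := by
  rw [add_comm, Function.iterate_add_apply]

theorem single_cons (x : Label n m) (l : List (Label n m)) :
    (Finsupp.single (x :: l) 1 : State K n m) = pre x (Finsupp.single l 1) := (pre_single x l 1).symm

theorem tieAt_single (i j : ℕ) (l : List (Label n m)) :
    (tieAt i j : Op K n m) (Finsupp.single l 1) =
      if i < l.length ∧ (l.map Prod.fst)[i]? = (l.map Prod.fst)[j]? then Finsupp.single l 1 else 0 := by
  simp [tieAt]

theorem tieAt_succ (i j : ℕ) : (tieAt (i + 1) (j + 1) : Op K n m) = up (tieAt i j) := by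
  refine Finsupp.lhom_ext' fun l => LinearMap.ext_ring ?_
  simp only [LinearMap.comp_apply, Finsupp.lsingle_apply]
  cases l with
  | nil => simpa [tieAt_single, vac] using (up_vac (tieAt (K := K) (n := n) (m := m) i j)).symm
  | cons x l =>
    rw [tieAt_single, single_cons, up_pre, tieAt_single]
    simp only [List.map_cons, List.getElem?_cons_succ, List.length_cons, add_lt_add_iff_right]
    split_ifs <;> simp

theorem tieAt_zero_one : (tieAt 0 1 : Op K n m) = tieOp := by
  refine Finsupp.lhom_ext' fun l => LinearMap.ext_ring ?_
  simp only [LinearMap.comp_apply, Finsupp.lsingle_apply]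
  rcases l with _ | ⟨x, _ | ⟨y, l⟩⟩
  · simpa [tieAt_single, vac] using (tieOp_vac (K := K) (n := n) (m := m)).symm
  · have := tieOp_pre_vac (K := K) x
    rw [vac, ← single_cons] at this
    simp [tieAt_single, this]
  · rw [tieAt_single, single_cons, single_cons, tieOp_pre]
    simp

theorem tieAt_add (i j k : ℕ) : (tieAt (i + k) (j + k) : Op K n m) = up^[k] (tieAt i j) := by
  induction k with
  | zero => rfl
  | succ k ih => rw [← add_assoc, ← add_assoc, tieAt_succ, ih, Function.iterate_succ_apply']

theorem tieAt_self_succ (i : ℕ) : (tieAt i (i + 1) : Op K n m) = up^[i] tieOp := by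
  rw [← tieAt_zero_one, ← tieAt_add, zero_add, add_comm]

theorem sliceOp_shift (c : Slice Unit) (k : ℕ) :
    (sliceOp p (c.shift k) : Op K n m) = up^[k] (sliceOp p c) := by
  cases c with
  | cup i b => exact upIter_add_apply _ _ _
  | cap i => exact upIter_add_apply _ _ _
  | cross i ε => exact upIter_add_apply _ _ _
  | tie i j => exact tieAt_add i j k

/-! #### Matrix coefficients -/

/-- A nonzero matrix coefficient of a product has a nonzero path through an intermediate word;
iteration produces histories. -/
theorem exists_of_apply_ne_zero {X : Op K n m} {v : State K n m} {l' : List (Label n m)}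
    (h : X v l' ≠ 0) : ∃ l, v l ≠ 0 ∧ X (Finsupp.single l 1) l' ≠ 0 := by
  have h1 : X v = v.sum fun l k => k • X (Finsupp.single l 1) := by
    conv_lhs => rw [← v.sum_single, map_finsuppSum]
    refine Finsupp.sum_congr fun l _ => ?_
    rw [← map_smul, Finsupp.smul_single, smul_eq_mul, mul_one]
  rw [h1, Finsupp.sum_apply, Finsupp.sum] at h
  obtain ⟨l, _, hl⟩ := Finset.exists_ne_zero_of_sum_ne_zero h
  rw [Finsupp.smul_apply, smul_eq_mul] at hl
  exact ⟨l, left_ne_zero_of_mul hl, right_ne_zero_of_mul hl⟩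

theorem apply_congr {X Y : Op K n m} {v : State K n m}
    (h : ∀ l, v l ≠ 0 → X (Finsupp.single l 1) = Y (Finsupp.single l 1)) : X v = Y v := by
  by_contra h'
  rw [← sub_eq_zero, ← LinearMap.sub_apply] at h'
  obtain ⟨l', hl'⟩ := Finsupp.ne_iff.1 h'
  obtain ⟨l, hl, hl''⟩ := exists_of_apply_ne_zero hl'
  refine hl'' ?_
  rw [LinearMap.sub_apply, h l hl, sub_self]
  rfl

theorem upIter_append (h : List (Label n m)) (X : Op K n m) (t : List (Label n m)) :
    up^[h.length] X (Finsupp.single (h ++ t) 1) =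
      (X (Finsupp.single t 1)).mapDomain (h ++ ·) := by
  induction h with
  | nil => exact Finsupp.mapDomain_id.symm
  | cons x h ih =>
    rw [List.length_cons, Function.iterate_succ_apply', List.cons_append, single_cons, up_pre, ih,
      pre, Finsupp.lmapDomain_apply, ← Finsupp.mapDomain_comp]
    rfl

theorem upIter_of_length_lt {k : ℕ} {l : List (Label n m)} (h : l.length < k) (X : Op K n m) :
    up^[k] X (Finsupp.single l 1) = 0 := by
  induction k generalizing l with
  | zero => omega
  | succ k ih =>
    rw [Function.iterate_succ_apply']
    cases l with
    | nil => exact up_vac _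
    | cons x l => rw [single_cons, up_pre, ih (by simpa using h), map_zero]

theorem exists_of_upIter_ne_zero {k : ℕ} {X : Op K n m} {l l' : List (Label n m)}
    (h : up^[k] X (Finsupp.single l 1) l' ≠ 0) :
    ∃ s t t', s.length = k ∧ l = s ++ t ∧ l' = s ++ t' ∧ X (Finsupp.single t 1) t' ≠ 0 := by
  have hk : k ≤ l.length := by
    by_contra hk
    rw [upIter_of_length_lt (by omega)] at h
    exact h rfl
  obtain ⟨s, t, rfl, hs⟩ : ∃ s t, l = s ++ t ∧ s.length = k :=
    ⟨l.take k, l.drop k, (List.take_append_drop k l).symm, by simpa using hk⟩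
  subst hs
  rw [upIter_append] at h
  by_cases hl : l' ∈ Set.range (s ++ ·)
  · obtain ⟨t', rfl⟩ := hl
    rw [Finsupp.mapDomain_apply (List.append_right_injective s)] at h
    exact ⟨s, t, t', rfl, rfl, rfl, h⟩
  · exact absurd (Finsupp.mapDomain_of_notMem_range _ _ hl) h

theorem upIter_one_apply {k : ℕ} {v : State K n m} (h : ∀ l, v l ≠ 0 → k ≤ l.length) :
    up^[k] 1 v = v := by
  suffices h : up^[k] 1 v = (1 : Op K n m) v from h
  refine apply_congr fun l hl => ?_
  obtain ⟨s, t, rfl, rfl⟩ : ∃ s t, l = s ++ t ∧ s.length = k :=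
    ⟨l.take k, l.drop k, (List.take_append_drop k l).symm, by simpa using h l hl⟩
  rw [upIter_append, Module.End.one_apply, Module.End.one_apply, Finsupp.mapDomain_single]

theorem cupOp_apply_ne_zero {t t' : List (Label n m)}
    (h : cupOp p (Finsupp.single t 1) t' ≠ 0) : ∃ k, t' = k :: dual k :: t := by
  rw [cupOp_apply, Finsupp.finsetSum_apply] at h
  obtain ⟨k, _, hk⟩ := Finset.exists_ne_zero_of_sum_ne_zero h
  rw [← single_cons, ← single_cons, Finsupp.smul_apply, Finsupp.single_apply] at hk
  refine ⟨k, ?_⟩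
  by_contra h'
  rw [if_neg (Ne.symm h'), smul_zero] at hk
  exact hk rfl

theorem exists_eq_of_single_apply_ne_zero {l l' : List (Label n m)} {k : K}
    (h : (k • (Finsupp.single l 1 : State K n m)) l' ≠ 0) : l' = l := by
  by_contra h'
  rw [Finsupp.smul_apply, Finsupp.single_apply, if_neg (Ne.symm h'), smul_zero] at h
  exact h rfl

theorem capOp_apply_ne_zero {t t' : List (Label n m)}
    (h : capOp p (Finsupp.single t 1) t' ≠ 0) : ∃ k, t = k :: dual k :: t' := by
  rcases t with _ | ⟨x, _ | ⟨y, t⟩⟩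
  · exact absurd (congrArg (· t') (capOp_vac p)) h
  · exact absurd (congrArg (· t') (capOp_pre_vac p x)) (by rwa [vac, ← single_cons])
  · rw [single_cons, single_cons, capOp_pre] at h
    split_ifs at h with hy
    · exact ⟨x, by rw [hy, exists_eq_of_single_apply_ne_zero h]⟩
    · exact absurd rfl h

/-- The linear combinations of the words that arise from a given word by adding two labels of given
colours. -/
def pairSpace (K : Type*) [Field K] (c d : Fin n) (t : List (Label n m)) :
    Submodule K (State K n m) :=
  Finsupp.supported K K {l | ∃ x y : Label n m, l = x :: y :: t ∧ x.1 = c ∧ y.1 = d}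

theorem pre_pre_mem_pairSpace (x y : Label n m) (t : List (Label n m)) :
    pre x (pre y (Finsupp.single t 1)) ∈ pairSpace K x.1 y.1 t := by
  rw [← single_cons, ← single_cons]
  exact Finsupp.single_mem_supported _ _ ⟨x, y, rfl, rfl, rfl⟩

theorem pairSum_mem_pairSpace {P : Label n m → Prop} [DecidablePred P] {c : Fin n}
    (h : ∀ k, P k → k.1 = c) (t : List (Label n m)) :
    pairSum p P (Finsupp.single t 1) ∈ pairSpace K c c t := by
  rw [pairSum_apply]
  refine Submodule.sum_mem _ fun k _ => ?_
  split_ifs with hk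
  · obtain rfl := h k hk
    exact Submodule.smul_mem _ _ (pre_pre_mem_pairSpace k (dual k) t)
  · exact Submodule.zero_mem _

theorem crossOp_mem_pairSpace (x y : Label n m) (t : List (Label n m)) :
    crossOp p (pre x (pre y (Finsupp.single t 1))) ∈ pairSpace K y.1 x.1 t := by
  rw [crossOp_pre]
  refine add_mem (add_mem (Submodule.smul_mem _ _ (pre_pre_mem_pairSpace y x t)) ?_) ?_
  · split_ifs with h
    · have := pre_pre_mem_pairSpace (K := K) x y t
      rw [h.1] at this
      rw [h.1]
      exact Submodule.smul_mem _ _ this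
    · rw [zero_smul]; exact zero_mem _
  · split_ifs with h
    · subst h
      exact Submodule.smul_mem _ _ (pairSum_mem_pairSpace p (fun k hk => hk.1) t)
    · rw [zero_smul]; exact zero_mem _

theorem crossOp'_mem_pairSpace (x y : Label n m) (t : List (Label n m)) :
    crossOp' p (pre x (pre y (Finsupp.single t 1))) ∈ pairSpace K y.1 x.1 t := by
  refine sub_mem (Submodule.smul_mem _ _ (add_mem ?_ ?_)) (crossOp_mem_pairSpace p x y t)
  · rw [tieOp_pre]
    split_ifs with h
    · have := pre_pre_mem_pairSpace (K := K) x y t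
      rw [h] at this
      rwa [h]
    · exact zero_mem _
  · rw [hookOp_pre]
    split_ifs with h
    · subst h
      exact Submodule.smul_mem _ _ (pairSum_mem_pairSpace p (fun k hk => hk) t)
    · exact zero_mem _

/-- Strands keep their colours at a crossing: the parts that do not exchange the labels are present
only for equal colours. -/
theorem crossing_apply_ne_zero {ε : ℤˣ} {t t' : List (Label n m)}
    (h : (if ε = 1 then crossOp p else crossOp' p) (Finsupp.single t 1) t' ≠ 0) :
    ∃ x y x' y' : Label n m, ∃ r, t = x :: y :: r ∧ t' = x' :: y' :: r ∧ x'.1 = y.1 ∧ y'.1 = x.1 := by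
  rcases t with _ | ⟨x, _ | ⟨y, r⟩⟩
  · split_ifs at h
    · exact absurd (congrArg (· t') (crossOp_vac p)) h
    · exact absurd (congrArg (· t') (crossOp'_vac p)) h
  · rw [single_cons] at h
    split_ifs at h
    · exact absurd (congrArg (· t') (crossOp_pre_vac p x)) h
    · exact absurd (congrArg (· t') (crossOp'_pre_vac p x)) h
  · have h1 : (if ε = 1 then crossOp p else crossOp' p) (Finsupp.single (x :: y :: r) 1) ∈
        pairSpace K y.1 x.1 r := by
      rw [single_cons, single_cons]
      split_ifs
      · exact crossOp_mem_pairSpace p x y r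
      · exact crossOp'_mem_pairSpace p x y r
    obtain ⟨x', y', rfl, h2, h3⟩ := (Finsupp.mem_supported K _).1 h1 (Finsupp.mem_support_iff.2 h)
    exact ⟨x, y, x', y', r, rfl, rfl, h2, h3⟩

theorem tieAt_apply_ne_zero {i j : ℕ} {l l' : List (Label n m)}
    (h : (tieAt i j : Op K n m) (Finsupp.single l 1) l' ≠ 0) :
    l' = l ∧ i < l.length ∧ (l.map Prod.fst)[i]? = (l.map Prod.fst)[j]? := by
  rw [tieAt_single] at h
  split_ifs at h with h'
  · exact ⟨exists_eq_of_single_apply_ne_zero (k := (1 : K)) (by rwa [one_smul]), h'⟩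
  · exact absurd rfl h

theorem level_of_apply_ne_zero {c : Slice Unit} {l l' : List (Label n m)}
    (h : sliceOp p c (Finsupp.single l 1) l' ≠ 0) : c.level l.length = some l'.length := by
  cases c with
  | cup i b =>
    obtain ⟨s, t, t', rfl, rfl, rfl, h'⟩ := exists_of_upIter_ne_zero h
    obtain ⟨k, rfl⟩ := cupOp_apply_ne_zero p h'
    simp [level]; omega
  | cap i =>
    obtain ⟨s, t, t', rfl, rfl, rfl, h'⟩ := exists_of_upIter_ne_zero h
    obtain ⟨k, rfl⟩ := capOp_apply_ne_zero p h'
    simp [level]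
    omega
  | cross i ε =>
    obtain ⟨s, t, t', rfl, rfl, rfl, h'⟩ := exists_of_upIter_ne_zero h
    obtain ⟨x, y, x', y', r, rfl, rfl, -, -⟩ := crossing_apply_ne_zero p h'
    simp [level]
  | tie i j =>
    obtain ⟨rfl, hi, h⟩ := tieAt_apply_ne_zero h
    -- Beyond the end of the word the colour at `j` would be `none`, unlike the colour at `i`.
    have hj : j < l'.length := by
      by_contra hj
      rw [List.getElem?_eq_none (i := j) (by simpa using hj), List.getElem?_eq_none_iff,
        List.length_map] at h
      omega
    simp [level, hi, hj]

/-- A sequence of words of labels, one for every level, such that no slice has coefficient `0`. -/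
def IsHistory (w : List (Slice Unit)) (s : ℕ → List (Label n m)) : Prop :=
  ∀ k c, w[k]? = some c → sliceOp p c (Finsupp.single (s k) 1) (s (k + 1)) ≠ 0

theorem exists_history {w : List (Slice Unit)} {l l' : List (Label n m)}
    (h : wordOp p w (Finsupp.single l 1) l' ≠ 0) :
    ∃ s, s 0 = l ∧ s w.length = l' ∧ IsHistory p w s := by
  induction w generalizing l with
  | nil =>
    refine ⟨fun _ => l, rfl, ?_, by simp [IsHistory]⟩
    exact (exists_eq_of_single_apply_ne_zero (k := (1 : K)) (by rwa [one_smul])).symm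
  | cons c w ih =>
    rw [wordOp, Module.End.mul_apply] at h
    obtain ⟨t, ht, h⟩ := exists_of_apply_ne_zero h
    obtain ⟨s, rfl, rfl, hs⟩ := ih h
    refine ⟨fun k => k.casesOn l s, rfl, rfl, ?_⟩
    rintro (_ | k) d hd
    · simp only [List.getElem?_cons_zero, Option.some.injEq] at hd
      subst hd
      exact ht
    · exact hs k d (by simpa using hd)

theorem IsHistory.levels {w : List (Slice Unit)} {s : ℕ → List (Label n m)}
    (h : IsHistory p w s) : levels w (s 0).length = some (s w.length).length := by
  induction w generalizing s with
  | nil => rfl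
  | cons c w ih =>
    rw [TiedLink.levels, level_of_apply_ne_zero p (h 0 c rfl), Option.bind_some]
    exact ih (s := fun k => s (k + 1)) fun k d hd => h (k + 1) d (by simpa using hd)

theorem levels_of_apply_ne_zero {w : List (Slice Unit)} {l l' : List (Label n m)}
    (h : wordOp p w (Finsupp.single l 1) l' ≠ 0) : levels w l.length = some l'.length := by
  obtain ⟨s, rfl, rfl, hs⟩ := exists_history p h
  exact hs.levels

theorem IsHistory.append {w₁ w₂ : List (Slice Unit)} {s₁ s₂ : ℕ → List (Label n m)}
    (h₁ : IsHistory p w₁ s₁) (h₂ : IsHistory p w₂ s₂) (h : s₁ w₁.length = s₂ 0) :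
    IsHistory p (w₁ ++ w₂) fun k => if k ≤ w₁.length then s₁ k else s₂ (k - w₁.length) := by
  intro k c hk
  dsimp only
  rcases lt_or_ge k w₁.length with hlt | hge
  · rw [List.getElem?_append_left hlt] at hk
    rw [if_pos hlt.le, if_pos (show k + 1 ≤ w₁.length from hlt)]
    exact h₁ k c hk
  · rw [List.getElem?_append_right hge] at hk
    obtain ⟨j, rfl⟩ := Nat.exists_eq_add_of_le hge
    rw [Nat.add_sub_cancel_left] at hk
    rw [if_neg (c := w₁.length + j + 1 ≤ w₁.length) (by omega),
      show w₁.length + j + 1 - w₁.length = j + 1 by omega]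
    have h3 : (if w₁.length + j ≤ w₁.length then s₁ (w₁.length + j)
        else s₂ (w₁.length + j - w₁.length)) = s₂ j := by
      split_ifs with h3
      · obtain rfl : j = 0 := by omega
        exact h
      · rw [Nat.add_sub_cancel_left]
    rw [h3]
    exact h₂ j c hk

theorem getElem?_map_append_add {α β : Type*} (f : α → β) (r t : List α) (j : ℕ) :
    ((r ++ t).map f)[r.length + j]? = (t.map f)[j]? := by
  rw [List.map_append, List.getElem?_append_right (by simp)]
  simp

/-- In a contributing state the colour is constant along strands and across ties, so the colours see
the partition defined by the ties. -/
theorem IsHistory.colour_eq {w : List (Slice Unit)} {s : ℕ → List (Label n m)}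
    (h : IsHistory p w s) {P Q : ℕ × ℕ} (hPQ : Linked w P Q) :
    ((s P.1).map Prod.fst)[P.2]? = ((s Q.1).map Prod.fst)[Q.2]? := by
  cases hPQ with
  | cup_left k i q b hk hq =>
    obtain ⟨r, t, t', rfl, e, e', h'⟩ := exists_of_upIter_ne_zero (h _ _ hk)
    obtain ⟨x, rfl⟩ := cupOp_apply_ne_zero p h'
    simp [e, e', List.getElem?_append, hq]
  | cup_right k i q b hk hq =>
    obtain ⟨r, t, t', rfl, e, e', h'⟩ := exists_of_upIter_ne_zero (h _ _ hk)
    obtain ⟨x, rfl⟩ := cupOp_apply_ne_zero p h'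
    obtain ⟨j, rfl⟩ := Nat.exists_eq_add_of_le hq
    simp only [e, e', add_assoc, getElem?_map_append_add]
    simp
  | cup_arc k i b hk =>
    obtain ⟨r, t, t', rfl, e, e', h'⟩ := exists_of_upIter_ne_zero (h _ _ hk)
    obtain ⟨x, rfl⟩ := cupOp_apply_ne_zero p h'
    simp [e']
  | cap_left k i q hk hq =>
    obtain ⟨r, t, t', rfl, e, e', h'⟩ := exists_of_upIter_ne_zero (h _ _ hk)
    obtain ⟨x, rfl⟩ := capOp_apply_ne_zero p h'
    simp [e, e', List.getElem?_append, hq]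
  | cap_right k i q hk hq =>
    obtain ⟨r, t, t', rfl, e, e', h'⟩ := exists_of_upIter_ne_zero (h _ _ hk)
    obtain ⟨x, rfl⟩ := capOp_apply_ne_zero p h'
    obtain ⟨j, rfl⟩ := Nat.exists_eq_add_of_le hq
    simp only [e, e', add_assoc, getElem?_map_append_add]
    simp
  | cap_arc k i hk =>
    obtain ⟨r, t, t', rfl, e, e', h'⟩ := exists_of_upIter_ne_zero (h _ _ hk)
    obtain ⟨x, rfl⟩ := capOp_apply_ne_zero p h'
    simp [e]
  | cross_other k i q ε hk hq hq' =>
    obtain ⟨r, t, t', rfl, e, e', h'⟩ := exists_of_upIter_ne_zero (h _ _ hk)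
    obtain ⟨x, y, x', y', v, rfl, rfl, -, -⟩ := crossing_apply_ne_zero p h'
    rcases lt_or_ge q r.length with hlt | hge
    · simp [e, e', List.getElem?_append, hlt]
    · obtain ⟨j, rfl⟩ : ∃ j, q = r.length + (j + 2) := ⟨q - r.length - 2, by omega⟩
      simp only [e, e', getElem?_map_append_add]
      simp
  | cross_right k i ε hk =>
    obtain ⟨r, t, t', rfl, e, e', h'⟩ := exists_of_upIter_ne_zero (h _ _ hk)
    obtain ⟨x, y, x', y', v, rfl, rfl, h1, h2⟩ := crossing_apply_ne_zero p h'
    simp [e, e', h2]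
  | cross_left k i ε hk =>
    obtain ⟨r, t, t', rfl, e, e', h'⟩ := exists_of_upIter_ne_zero (h _ _ hk)
    obtain ⟨x, y, x', y', v, rfl, rfl, h1, h2⟩ := crossing_apply_ne_zero p h'
    simp [e, e', h1]
  | tie_other k i j q hk =>
    rw [(tieAt_apply_ne_zero (h _ _ hk)).1]
  | tie_spring k i j hk => exact (tieAt_apply_ne_zero (h _ _ hk)).2.2

theorem IsHistory.colour_eq_of_tiedTogether {w : List (Slice Unit)} {s : ℕ → List (Label n m)}
    (h : IsHistory p w s) {P Q : ℕ × ℕ} (hPQ : TiedTogether w P Q) :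
    ((s P.1).map Prod.fst)[P.2]? = ((s Q.1).map Prod.fst)[Q.2]? := by
  induction hPQ with
  | rel P Q hPQ => exact h.colour_eq p hPQ
  | refl P => rfl
  | symm P Q _ ih => exact ih.symm
  | trans P Q T _ _ ih ih' => exact ih.trans ih'

/-! #### The rules -/

variable (n m)

/-- The state sum of a word. -/
noncomputable def stateSum (w : List (Slice Unit)) : K := (wordOp p w (vac : State K n m)) []

/-- The values of the curls. -/
def curlValue (m : ℕ) (ε : ℤˣ) : K := if ε = 1 then (twist p m)⁻¹ else twist p m

/-- The value of a circle. -/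
def loopValue : K := ∑ k : Label n m, cupWeight p k * capWeight p k

variable {n m}

theorem stateSum_append (w₁ u w₂ : List (Slice Unit)) :
    stateSum n m p (w₁ ++ u ++ w₂) = wordOp p w₂ (wordOp p u (wordOp p w₁ (vac : State K n m))) [] := by
  rw [stateSum, wordOp_append, wordOp_append]
  rfl

theorem stateSum_append' (w₁ w₂ : List (Slice Unit)) :
    stateSum n m p (w₁ ++ w₂) = wordOp p w₂ (wordOp p w₁ (vac : State K n m)) [] := by
  rw [stateSum, wordOp_append]
  rfl

/-- `up^[i] 1` is zero on words with fewer than `i` letters, but only words with exactly `k` letters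
occur in the state. -/
theorem upIter_one_wordOp_vac {w : List (Slice Unit)} {k i : ℕ} (h : levels w 0 = some k)
    (hi : i ≤ k) : up^[i] 1 (wordOp p w (vac : State K n m)) = wordOp p w vac := by
  refine upIter_one_apply fun l hl => ?_
  have := levels_of_apply_ne_zero p hl
  rw [List.length_nil, h, Option.some.injEq] at this
  omega

section

variable {p} (hp : p ≠ 0) (hz : zWeight p ≠ 0)

theorem upIter_succ (i : ℕ) (X : Op K n m) : up^[i + 1] X = up^[i] (up X) := rfl

include hp hz in
theorem crossing_mul_crossing_neg (ε : ℤˣ) :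
    ((if -ε = 1 then crossOp p else crossOp' p) * (if ε = 1 then crossOp p else crossOp' p) :
      Op K n m) = up (up 1) := by
  rcases Int.units_eq_one_or ε with rfl | rfl
  · simpa [show (-1 : ℤˣ) ≠ 1 by decide] using crossOp'_mul_crossOp hp
  · simpa [show (-1 : ℤˣ) ≠ 1 by decide] using crossOp_mul_crossOp' hp hz

include hp hz in
theorem crossing_braid (ε : ℤˣ) {X : Op K n m} (hX : X = if ε = 1 then crossOp p else crossOp' p) :
    X * up X * X = up X * X * up X := by
  subst hX
  split_ifs
  · exact braid hp
  · exact braid' hp hz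

include hp hz in
theorem capOp_mul_up_crossing (ε : ℤˣ) :
    (capOp p * up (if ε = 1 then crossOp p else crossOp' p) : Op K n m) =
      up (capOp p) * (if -ε = 1 then crossOp p else crossOp' p) := by
  rcases Int.units_eq_one_or ε with rfl | rfl
  · simpa [show (-1 : ℤˣ) ≠ 1 by decide] using capOp_mul_up_crossOp hp hz
  · simpa [show (-1 : ℤˣ) ≠ 1 by decide] using capOp_mul_up_crossOp' hp hz

include hp in
theorem crossing_mul_up_cupOp (ε : ℤˣ) :
    ((if -ε = 1 then crossOp p else crossOp' p) * up (cupOp p) : Op K n m) =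
      up (if ε = 1 then crossOp p else crossOp' p) * cupOp p := by
  rcases Int.units_eq_one_or ε with rfl | rfl
  · simpa [show (-1 : ℤˣ) ≠ 1 by decide] using crossOp'_mul_up_cupOp hp
  · simpa [show (-1 : ℤˣ) ≠ 1 by decide] using crossOp_mul_up_cupOp hp

include hp hz in
theorem capOp_mul_crossing (ε : ℤˣ) :
    (capOp p * (if -ε = 1 then crossOp p else crossOp' p) : Op K n m) =
      curlValue p m ε • capOp p := by
  rcases Int.units_eq_one_or ε with rfl | rfl
  · simpa [curlValue, show (-1 : ℤˣ) ≠ 1 by decide] using capOp_mul_crossOp' hp hz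
  · simpa [curlValue, show (-1 : ℤˣ) ≠ 1 by decide] using capOp_mul_crossOp hp

include hp hz in
theorem wordOp_planeMove {u v : List (Slice Unit)} (h : PlaneMove u v) {w : List (Slice Unit)}
    {k l : ℕ} (hw : levels w 0 = some k) (hu : levels u k = some l) :
    wordOp p u (wordOp p w (vac : State K n m)) = wordOp p v (wordOp p w vac) := by
  have key : ∀ {u v : List (Slice Unit)}, (wordOp p u : Op K n m) = wordOp p v →
      wordOp p u (wordOp p w (vac : State K n m)) = wordOp p v (wordOp p w vac) :=
    fun h => by rw [h]
  have key' : ∀ {u : List (Slice Unit)} {i : ℕ}, i ≤ k → (wordOp p u : Op K n m) = up^[i] 1 →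
      wordOp p u (wordOp p w (vac : State K n m)) = wordOp p [] (wordOp p w vac) :=
    fun h h' => by rw [h', upIter_one_wordOp_vac p hw h]; rfl
  cases h with
  | far_cup c i b =>
    refine key ?_
    simp only [wordOp, one_mul, sliceOp_shift]
    rw [sliceOp, ← upIter_mul, cupOp_up_up, upIter_mul]
    rfl
  | far_cap c i =>
    refine key ?_
    simp only [wordOp, one_mul, sliceOp_shift]
    rw [sliceOp, ← upIter_mul, ← capOp_up_up, upIter_mul]
    rfl
  | far_cross c i ε =>
    refine key ?_
    simp only [wordOp, one_mul, sliceOp_shift]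
    rw [sliceOp]
    simp only [upIter_succ, ← upIter_mul]
    split_ifs
    · rw [crossOp_up_up]
    · rw [crossOp'_up_up]
  | zigzag_left i b =>
    simp only [levels, level, Option.bind_eq_some_iff, Option.ite_none_right_eq_some,
      Option.some.injEq] at hu
    obtain ⟨_, ⟨_, rfl⟩, _, ⟨_, _⟩, _⟩ := hu
    refine key' (i := i + 1) (by omega) ?_
    simp only [wordOp, one_mul, sliceOp]
    rw [upIter_succ, ← upIter_mul, up_capOp_mul_cupOp hp, upIter_succ]
  | zigzag_right i b =>
    simp only [levels, level, Option.bind_eq_some_iff, Option.ite_none_right_eq_some,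
      Option.some.injEq] at hu
    obtain ⟨_, ⟨_, rfl⟩, _, ⟨_, _⟩, _⟩ := hu
    refine key' (i := i + 1) (by omega) ?_
    simp only [wordOp, one_mul, sliceOp]
    rw [upIter_succ, ← upIter_mul, capOp_mul_up_cupOp hp, upIter_succ]
  | cup_cross i b ε =>
    refine key ?_
    simp only [wordOp, one_mul, sliceOp]
    rw [upIter_succ, upIter_succ, ← upIter_mul, ← upIter_mul, crossing_mul_up_cupOp hp]
  | cross_cap i ε =>
    refine key ?_
    simp only [wordOp, one_mul, sliceOp]
    rw [upIter_succ, upIter_succ, ← upIter_mul, ← upIter_mul, capOp_mul_up_crossing hp hz]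

include hp hz in
theorem wordOp_curl {ε : ℤˣ} {u : List (Slice Unit)} (h : Curl ε u) {w : List (Slice Unit)} {k : ℕ}
    (hw : levels w 0 = some k) (hu : levels u k = some k) :
    wordOp p u (wordOp p w (vac : State K n m)) = curlValue p m ε • wordOp p w vac := by
  have key : ∀ {u : List (Slice Unit)} {i : ℕ}, i ≤ k →
      (wordOp p u : Op K n m) = curlValue p m ε • up^[i] 1 →
      wordOp p u (wordOp p w (vac : State K n m)) = curlValue p m ε • (wordOp p w vac) :=
    fun h h' => by rw [h', LinearMap.smul_apply, upIter_one_wordOp_vac p hw h]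
  cases h with
  | right i b =>
    simp only [levels, level, Option.bind_eq_some_iff, Option.ite_none_right_eq_some,
      Option.some.injEq] at hu
    obtain ⟨_, ⟨_, rfl⟩, _⟩ := hu
    refine key (i := i + 1) (by omega) ?_
    simp only [wordOp, one_mul, sliceOp]
    have h := crossing_mul_up_cupOp (n := n) (m := m) hp (-ε)
    rw [neg_neg] at h
    rw [upIter_succ, upIter_succ, mul_assoc, ← upIter_mul, ← upIter_mul, h, ← mul_assoc, ← up_mul,
      capOp_mul_crossing hp hz, up_smul, smul_mul_assoc, up_capOp_mul_cupOp hp, upIter_smul,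
      upIter_succ]
  | left i b =>
    simp only [levels, level, Option.bind_eq_some_iff, Option.ite_none_right_eq_some,
      Option.some.injEq] at hu
    obtain ⟨_, ⟨_, rfl⟩, _, ⟨_, rfl⟩, _⟩ := hu
    refine key (i := i + 1) (by omega) ?_
    simp only [wordOp, one_mul, sliceOp]
    rw [upIter_succ, mul_assoc, ← upIter_mul, ← upIter_mul, ← crossing_mul_up_cupOp hp,
      ← mul_assoc, capOp_mul_crossing hp hz, smul_mul_assoc, capOp_mul_up_cupOp hp, upIter_smul,
      upIter_succ]

include hp hz in
theorem isTiedSkein_stateSum :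
    IsTiedSkein (curlValue p m) (zWeight p) (loopValue n m p) (stateSum n m p) where
  zero w h := by
    by_contra h'
    exact h (levels_of_apply_ne_zero p h')
  plane u v h w₁ w₂ k l h1 h2 _ := by
    rw [stateSum_append, stateSum_append, wordOp_planeMove hp hz h h1 h2]
  reidemeister2 i ε w₁ w₂ k h1 hi := by
    rw [stateSum_append, stateSum_append']
    simp only [wordOp, one_mul, sliceOp]
    rw [← upIter_mul, crossing_mul_crossing_neg hp hz, ← upIter_succ, ← upIter_succ,
      upIter_one_wordOp_vac p h1 hi]
  reidemeister3 i ε w₁ w₂ k h1 hi := by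
    rw [stateSum_append, stateSum_append]
    simp only [wordOp, one_mul, sliceOp, upIter_succ, ← upIter_mul]
    rw [crossing_braid hp hz ε rfl]
  curl ε u h w₁ w₂ k h1 h2 := by
    rw [stateSum_append, stateSum_append', wordOp_curl hp hz h h1 h2, map_smul]
    rfl
  union i w₁ w₂ k h1 hi := by
    rw [stateSum_append, stateSum_append']
    simp only [wordOp, one_mul, sliceOp, ← upIter_mul]
    rw [capOp_mul_cupOp, upIter_smul, LinearMap.smul_apply, upIter_one_wordOp_vac p h1 hi, map_smul]
    rfl
  tie i j w₁ w₂ k h1 hi hj h := by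
    rw [stateSum_append, stateSum_append']
    simp only [wordOp, one_mul, sliceOp]
    -- If the tie mattered, some word with different colours at `i` and `j` would contribute. Its
    -- histories below and above the level join to a history of `w₁ ++ w₂`, in which tied points
    -- have equal colours.
    by_contra h0
    have h3 : (wordOp p w₂ * (tieAt i j - 1) : Op K n m) (wordOp p w₁ (vac : State K n m)) [] ≠ 0 := by
      rw [Module.End.mul_apply, LinearMap.sub_apply, map_sub, Finsupp.sub_apply]
      exact sub_ne_zero.2 h0
    obtain ⟨l, hl, hl'⟩ := exists_of_apply_ne_zero h3
    rw [Module.End.mul_apply, LinearMap.sub_apply, Module.End.one_apply, tieAt_single] at hl'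
    have h4 := levels_of_apply_ne_zero p hl
    rw [List.length_nil, h1, Option.some.injEq] at h4
    obtain ⟨s₁, hs₁, rfl, h₁⟩ := exists_history p hl
    split_ifs at hl' with h5
    · rw [sub_self, map_zero] at hl'
      exact hl' rfl
    · refine h5 ⟨h4 ▸ hi, ?_⟩
      rw [zero_sub, map_neg, Finsupp.neg_apply, neg_ne_zero] at hl'
      obtain ⟨s₂, hs₂, -, h₂⟩ := exists_history p hl'
      have h6 := (h₁.append p h₂ hs₂.symm).colour_eq_of_tiedTogether p h
      simpa using h6
  skein i w₁ w₂ k h1 hi := by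
    simp only [stateSum_append, ← Finsupp.add_apply, ← map_add, ← Finsupp.smul_apply, ← map_smul,
      ← LinearMap.add_apply]
    have h := congrArg (up^[i]) (crossOp_add_crossOp' (K := K) (n := n) (m := m) p)
    rw [upIter_add, upIter_smul, upIter_add, hookOp, upIter_mul, upIter_mul, ← upIter_succ,
      ← upIter_succ, ← upIter_succ, ← tieAt_self_succ, ← tieAt_self_succ] at h
    simp only [wordOp, one_mul, sliceOp, if_true, if_neg (show (-1 : ℤˣ) ≠ 1 by decide)]
    rw [h, mul_assoc]
    simp only [map_smul, LinearMap.smul_apply]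

end

end Vertex
end TiedLink

namespace TiedLink

open Slice

/-! ### Specializations separate the elements of the coefficient ring -/

section Separation

variable {R K B J : Type*} [CommRing R] [Field K]

theorem polynomial_eq_zero_of_eval₂ (σ : B → R →+* K) (hσ : ∀ r, (∀ b, σ b r = 0) → r = 0)
    (x : B → J → K) (hx : ∀ b, (Set.range (x b)).Infinite) (f : Polynomial R)
    (h : ∀ b j, Polynomial.eval₂ (σ b) (x b j) f = 0) : f = 0 := by
  refine Polynomial.ext fun i => hσ _ fun b => ?_
  have h1 : f.map (σ b) = 0 := by
    refine Polynomial.eq_zero_of_infinite_isRoot _ ((hx b).mono ?_)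
    rintro _ ⟨j, rfl⟩
    rw [Set.mem_ofPred, Polynomial.IsRoot.def, Polynomial.eval_map, h]
  rw [← Polynomial.coeff_map, h1, Polynomial.coeff_zero]

theorem laurentPolynomial_eq_zero_of_eval₂ (σ : B → R →+* K) (hσ : ∀ r, (∀ b, σ b r = 0) → r = 0)
    (x : B → J → Kˣ) (hx : ∀ b, (Set.range fun j => (x b j : K)).Infinite) (f : LaurentPolynomial R)
    (h : ∀ b j, LaurentPolynomial.eval₂ (σ b) (x b j) f = 0) : f = 0 := by
  -- A power of the invertible variable clears the negative exponents.
  obtain ⟨k, g, hg⟩ := f.exists_T_pow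
  have h1 : g = 0 := polynomial_eq_zero_of_eval₂ σ hσ (fun b j => (x b j : K)) hx g fun b j => by
    rw [← LaurentPolynomial.eval₂_toLaurent, hg, map_mul, h, zero_mul]
  rw [h1, map_zero] at hg
  have h2 := congrArg (· * LaurentPolynomial.T (-k)) hg
  simpa [LaurentPolynomial.mul_T_assoc] using h2.symm

end Separation

/-! ### The values of the parameters -/

/-- The positive real number whose power with exponent `4 t + 5` is `b + 2`. -/
noncomputable def root (b t : ℕ) : ℝ := ((b + 2 : ℕ) : ℝ) ^ ((4 * t + 5 : ℕ) : ℝ)⁻¹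

theorem root_pow (b t : ℕ) : root b t ^ (4 * t + 5) = ((b + 2 : ℕ) : ℝ) :=
  Real.rpow_inv_natCast_pow (Nat.cast_nonneg _) (by omega)

theorem one_lt_root (b t : ℕ) : 1 < root b t :=
  Real.one_lt_rpow (by norm_cast; omega) (by positivity)

theorem root_injective (b : ℕ) : Function.Injective (root b) := by
  intro t t' h
  have h1 := root_pow b t
  rw [← root_pow b t', ← h] at h1
  have := pow_right_injective₀ (by linarith [one_lt_root b t]) (one_lt_root b t).ne' h1
  omega

namespace Vertex

theorem zWeight_injOn {p q : ℝ} (hp : 1 < p) (hq : 1 < q) (h : zWeight p = zWeight q) : p = q := by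
  unfold zWeight at h
  have hp0 : p ≠ 0 := by linarith
  have hq0 : q ≠ 0 := by linarith
  field_simp at h
  have h1 : (p - q) * (p * q - 1) = 0 := by linear_combination h
  rcases mul_eq_zero.1 h1 with h1 | h1
  · linarith
  · nlinarith

/-- For `m = 2 (t + 1)` the sign in the twist disappears, and its inverse is the power of the root
with exponent `2 m + 1 = 4 t + 5`. Thus `a` depends only on `b`, while `t` remains free to vary `z`.
-/
theorem inv_twist_root (b t : ℕ) :
    (twist (root b t) (2 * (t + 1)))⁻¹ = ((b + 2 : ℕ) : ℝ) := by
  rw [← root_pow b t, twist, pow_mul, neg_sq]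
  have : root b t ≠ 0 := by linarith [one_lt_root b t]
  rw [← pow_mul, ← pow_mul, ← pow_succ', inv_pow, inv_inv]
  congr 1
  ring

/-- With `r = -(p⁻¹ ^ 2)`, the labels below and above the middle form two geometric sums; the factor
`r ^ m * (r - 1)` clears the denominators. -/
theorem loopValue_mul {p : ℝ} (hp : p ≠ 0) (n m : ℕ) :
    loopValue n m p * ((-(p⁻¹ ^ 2)) ^ m * (-(p⁻¹ ^ 2) - 1)) =
      n * ((-(p⁻¹ ^ 2)) ^ (2 * m + 1) - (-(p⁻¹ ^ 2)) ^ (m + 1) + (-(p⁻¹ ^ 2)) ^ m - 1) := by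
  have h0 : -(p⁻¹ ^ 2) ≠ 0 := neg_ne_zero.2 (pow_ne_zero _ (inv_ne_zero hp))
  have h1 : ∀ k : Label n m, cupWeight p k * capWeight p k =
      (-(p⁻¹ ^ 2)) ^ (k.2.val + 1 - m) * ((-(p⁻¹ ^ 2)) ^ (2 * m - k.2.val - m))⁻¹ := by
    intro k
    have := k.2.2
    rw [capWeight, cupWeight, cupWeight, dual_snd,
      show 2 * m - 1 - k.2.val + 1 - m = 2 * m - k.2.val - m by omega]
  generalize -(p⁻¹ ^ 2) = r at *
  rw [loopValue, Finset.sum_congr rfl fun k _ => h1 k]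
  simp only [Fintype.sum_prod_type, Finset.sum_const, Finset.card_univ, Fintype.card_fin,
    nsmul_eq_mul, mul_assoc]
  congr 1
  rw [Fin.sum_univ_eq_sum_range (fun i => r ^ (i + 1 - m) * (r ^ (2 * m - i - m))⁻¹) (2 * m),
    two_mul m, Finset.sum_range_add, add_mul]
  have h2 : ∀ i ∈ Finset.range m, r ^ (i + 1 - m) * (r ^ (m + m - i - m))⁻¹ * r ^ m = r ^ i := by
    intro i hi
    rw [Finset.mem_range] at hi
    rw [show i + 1 - m = 0 by omega, pow_zero, one_mul, inv_mul_eq_iff_eq_mul₀ (pow_ne_zero _ h0),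
      ← pow_add]
    congr 1; omega
  have h3 : ∀ i ∈ Finset.range m, r ^ (m + i + 1 - m) * (r ^ (m + m - (m + i) - m))⁻¹ * r ^ m =
      r ^ (m + 1) * r ^ i := by
    intro i _
    rw [show m + m - (m + i) - m = 0 by omega, pow_zero, inv_one, mul_one, ← pow_add, ← pow_add]
    congr 1; omega
  replace h2 := Finset.sum_congr rfl h2
  replace h3 := Finset.sum_congr rfl h3
  rw [← Finset.sum_mul] at h2 h3
  have h4 := geom_sum_mul r m
  rw [← mul_assoc, ← mul_assoc, h2, h3, ← Finset.mul_sum]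
  linear_combination (1 + r ^ (m + 1)) * h4

theorem loopValue_root_ne_zero (b t : ℕ) {n : ℕ} (hn : n ≠ 0) :
    loopValue n (2 * (t + 1)) (root b t) ≠ 0 := by
  intro h
  have hp := one_lt_root b t
  have h1 := loopValue_mul (p := root b t) (by linarith) n (2 * (t + 1))
  have hq0 : 0 < (root b t)⁻¹ ^ 2 := by positivity
  have hq1 : (root b t)⁻¹ ^ 2 < 1 := pow_lt_one₀ (by positivity) (inv_lt_one_of_one_lt₀ hp) two_ne_zero
  rw [h, zero_mul, eq_comm, mul_eq_zero] at h1
  replace h1 := h1.resolve_left (Nat.cast_ne_zero.2 hn)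
  generalize (root b t)⁻¹ ^ 2 = q at *
  have e1 : (-q) ^ (2 * (t + 1)) = q ^ (2 * (t + 1)) := by rw [pow_mul, neg_sq, ← pow_mul]
  -- Since `m` is even, the right side factors, up to sign, into two differences that are nonzero
  -- for `0 < q < 1`.
  have h2 : (q ^ (2 * (t + 1) + 1) - 1) * (q ^ (2 * (t + 1)) - 1) = 0 := by
    rw [pow_succ (-q), pow_succ (-q) (2 * (t + 1)), mul_comm 2 (2 * (t + 1)), pow_mul, e1] at h1
    linear_combination -h1
  have h3 : q ^ (2 * (t + 1) + 1) < 1 := pow_lt_one₀ hq0.le hq1 (by omega)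
  have h4 : q ^ (2 * (t + 1)) < 1 := pow_lt_one₀ hq0.le hq1 (by omega)
  nlinarith

theorem loopValue_eq_mul {K : Type*} [Field K] (p : K) (n m : ℕ) :
    loopValue n m p = n * loopValue 1 m p := by
  simp only [loopValue, cupWeight, capWeight, dual_snd, Fintype.sum_prod_type]
  simp

end Vertex

/-- The value of `z` as a unit. -/
noncomputable def zUnit (b t : ℕ) : ℝˣ :=
  Units.mk0 (Vertex.zWeight (root b t)) (by
    have := one_lt_root b t
    unfold Vertex.zWeight
    positivity)

/-- The value of `a` as a unit. -/
noncomputable def aUnit (b : ℕ) : ℝˣ := Units.mk0 ((b + 2 : ℕ) : ℝ) (by positivity)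

/-- The specialization of the polynomials in `a`. -/
noncomputable def evalA (b : ℕ) : LaurentPolynomial ℤ →+* ℝ :=
  LaurentPolynomial.eval₂ (Int.castRingHom ℝ) (aUnit b)

/-- The specialization of the polynomials in `a` and `z`. -/
noncomputable def evalZ (b : ℕ × ℕ) : LaurentPolynomial (LaurentPolynomial ℤ) →+* ℝ :=
  LaurentPolynomial.eval₂ (evalA b.1) (zUnit b.1 b.2)

/-- The specialization of the coefficient ring. -/
noncomputable def evalX (b : (ℕ × ℕ) × ℕ) : Coeff →+* ℝ :=
  Polynomial.eval₂RingHom (evalZ b.1)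
    (Vertex.loopValue (b.2 + 1) (2 * (b.1.2 + 1)) (root b.1.1 b.1.2))

/-- The variables are eliminated one at a time, each by infinitely many values with the others
fixed: `x⁻¹` by the number of colours, `z` by `t`, and `a` by `b`. -/
theorem eq_zero_of_evalX {f : Coeff} (h : ∀ b, evalX b f = 0) : f = 0 := by
  refine polynomial_eq_zero_of_eval₂ evalZ (fun g hg => ?_) _ (fun b => ?_) f fun b j => h (b, j)
  · refine laurentPolynomial_eq_zero_of_eval₂ evalA (fun g hg => ?_) zUnit (fun b => ?_) g
      fun b t => hg (b, t)
    · refine laurentPolynomial_eq_zero_of_eval₂ (fun _ : Unit => Int.castRingHom ℝ)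
        (fun r hr => by simpa using hr ()) (fun _ => aUnit) (fun _ => ?_) g fun _ b => hg b
      refine Set.infinite_range_of_injective fun b b' hb => ?_
      simpa [aUnit] using hb
    · refine Set.infinite_range_of_injective fun t t' ht => root_injective b ?_
      exact Vertex.zWeight_injOn (one_lt_root _ _) (one_lt_root _ _) ht
  · refine Set.infinite_range_of_injective fun j j' hj => ?_
    dsimp only at hj
    rw [Vertex.loopValue_eq_mul, Vertex.loopValue_eq_mul _ (j' + 1)] at hj
    simpa using mul_right_cancel₀ (Vertex.loopValue_root_ne_zero b.1 b.2 one_ne_zero) hj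

theorem evalX_z (b : (ℕ × ℕ) × ℕ) : evalX b z = Vertex.zWeight (root b.1.1 b.1.2) := by
  simp only [evalX, z, Polynomial.coe_eval₂RingHom, Polynomial.eval₂_C, evalZ,
    LaurentPolynomial.eval₂_T, zpow_one]
  rfl

theorem evalX_xInv (b : (ℕ × ℕ) × ℕ) :
    evalX b xInv = Vertex.loopValue (b.2 + 1) (2 * (b.1.2 + 1)) (root b.1.1 b.1.2) := by
  simp [evalX, xInv]

theorem evalX_aPow (b : (ℕ × ℕ) × ℕ) (ε : ℤˣ) :
    evalX b (aPow ε) = Vertex.curlValue (root b.1.1 b.1.2) (2 * (b.1.2 + 1)) ε := by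
  have h := Vertex.inv_twist_root b.1.1 b.1.2
  simp only [evalX, aPow, Polynomial.coe_eval₂RingHom, Polynomial.eval₂_C, evalZ, evalA,
    LaurentPolynomial.eval₂_C, LaurentPolynomial.eval₂_T, Vertex.curlValue]
  rcases Int.units_eq_one_or ε with rfl | rfl
  · simp only [Units.val_one, zpow_one, if_true, h]
    rfl
  · rw [if_neg (by decide)]
    simp only [Units.val_neg, Units.val_one, zpow_neg, zpow_one, Units.val_inv_eq_inv_val]
    rw [← inv_inv (Vertex.twist _ _), h]
    rfl

end TiedLink

namespace TiedLink

open Slice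

/-! ### Existence and uniqueness -/

section Transfer

variable {R : Type*} [CommRing R] {a : ℤˣ → R} {z y : R}

/-- Families of functionals obey one reduction formula with common coefficients; both existence and
uniqueness use this. -/
theorem IsTiedSkein.pi {ι : Type*} {S : ι → Type*} [∀ i, AddCommGroup (S i)] [∀ i, Module R (S i)]
    {Z : ∀ i, List (Slice Unit) → S i} (h : ∀ i, IsTiedSkein a z y (Z i)) :
    IsTiedSkein a z y fun w i => Z i w where
  zero w hw := funext fun i => (h i).zero w hw
  plane u v huv w₁ w₂ n k h₁ hu hv := funext fun i => (h i).plane u v huv w₁ w₂ n k h₁ hu hv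
  reidemeister2 j ε w₁ w₂ n h₁ hj := funext fun i => (h i).reidemeister2 j ε w₁ w₂ n h₁ hj
  reidemeister3 j ε w₁ w₂ n h₁ hj := funext fun i => (h i).reidemeister3 j ε w₁ w₂ n h₁ hj
  curl ε u hu w₁ w₂ n h₁ h₂ := funext fun i => (h i).curl ε u hu w₁ w₂ n h₁ h₂
  union j w₁ w₂ n h₁ hj := funext fun i => (h i).union j w₁ w₂ n h₁ hj
  tie j k w₁ w₂ n h₁ hj hk ht := funext fun i => (h i).tie j k w₁ w₂ n h₁ hj hk ht
  skein j w₁ w₂ n h₁ hj := funext fun i => (h i).skein j w₁ w₂ n h₁ hj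

theorem IsTiedSkein.of_ringHom {K : Type*} [CommRing K] {a' : ℤˣ → K} {z' y' : K} (f : R →+* K)
    {S : Type*} [AddCommGroup S] [Module R S] [Module K S] (hf : ∀ (r : R) (s : S), r • s = f r • s)
    {Z : List (Slice Unit) → S} (h : IsTiedSkein a' z' y' Z) (ha : ∀ ε, f (a ε) = a' ε)
    (hz : f z = z') (hy : f y = y') : IsTiedSkein a z y Z where
  zero := h.zero
  plane := h.plane
  reidemeister2 := h.reidemeister2
  reidemeister3 := h.reidemeister3
  curl ε u hu w₁ w₂ n h₁ h₂ := by rw [hf, ha, h.curl ε u hu w₁ w₂ n h₁ h₂]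
  union j w₁ w₂ n h₁ hj := by rw [hf, hy, h.union j w₁ w₂ n h₁ hj]
  tie := h.tie
  skein j w₁ w₂ n h₁ hj := by rw [hf, hz, h.skein j w₁ w₂ n h₁ hj]

end Transfer

theorem aPow_zero : aPow 0 = 1 := by simp [aPow]

theorem aPow_add (m n : ℤ) : aPow (m + n) = aPow m * aPow n := by
  rw [aPow, LaurentPolynomial.T_add, map_mul, map_mul]
  rfl

theorem C_T_neg_one_mul_z : Polynomial.C (LaurentPolynomial.T (-1)) * z = 1 := by
  rw [z, ← map_mul, ← LaurentPolynomial.T_add]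
  simp

/-- The real numbers, as a module over the coefficient ring. -/
def ValueAt (_ : (ℕ × ℕ) × ℕ) : Type := ℝ

noncomputable instance (b : (ℕ × ℕ) × ℕ) : AddCommGroup (ValueAt b) :=
  inferInstanceAs (AddCommGroup ℝ)

noncomputable instance (b : (ℕ × ℕ) × ℕ) : Module ℝ (ValueAt b) := inferInstanceAs (Module ℝ ℝ)

/-- The index belongs to the type so that each copy of the real numbers carries its own evaluation
of `Coeff`. -/
noncomputable instance (b : (ℕ × ℕ) × ℕ) : Module Coeff (ValueAt b) :=
  Module.compHom (ValueAt b) (evalX b)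

/-- The state sums for all values of the parameters. -/
noncomputable def values (w : List (Slice Unit)) (b : (ℕ × ℕ) × ℕ) : ValueAt b :=
  (Vertex.stateSum (b.2 + 1) (2 * (b.1.2 + 1)) (root b.1.1 b.1.2) w : ℝ)

theorem isTiedSkein_values : IsTiedSkein (fun ε : ℤˣ => aPow ε) z xInv values := by
  refine IsTiedSkein.pi fun b => IsTiedSkein.of_ringHom (evalX b) (fun _ _ => rfl)
    (Vertex.isTiedSkein_stateSum (K := ℝ) ?_ (zUnit b.1.1 b.1.2).ne_zero) (evalX_aPow b) (evalX_z b)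
    (evalX_xInv b)
  linarith [one_lt_root b.1.1 b.1.2]

theorem values_circle (b : (ℕ × ℕ) × ℕ) : values [cup 0 (), cap 0] b =
    (Vertex.loopValue (b.2 + 1) (2 * (b.1.2 + 1)) (root b.1.1 b.1.2) : ℝ) := by
  have h := congrFun (isTiedSkein_values.union 0 [] [] 0 rfl le_rfl) b
  refine h.trans ?_
  change evalX b xInv * (Vertex.stateSum (b.2 + 1) (2 * (b.1.2 + 1)) (root b.1.1 b.1.2) [] : ℝ) = _
  rw [evalX_xInv]
  simp [Vertex.stateSum, Vertex.wordOp, Vertex.vac]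

/-- The circle has a nonzero value at every choice of parameters, so the evaluations of the
coefficient are recovered, and they separate `Coeff`. This makes the normalized polynomial well
defined. -/
theorem smul_values_circle_injective {c d : Coeff}
    (h : c • values [cup 0 (), cap 0] = d • values [cup 0 (), cap 0]) : c = d := by
  refine sub_eq_zero.1 (eq_zero_of_evalX fun b => ?_)
  have h1 (c : Coeff) : (c • values [cup 0 (), cap 0]) b =
      (evalX b c * Vertex.loopValue (b.2 + 1) (2 * (b.1.2 + 1)) (root b.1.1 b.1.2) : ℝ) :=
    congrArg (fun s : ValueAt b => c • s) (values_circle b)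
  have h2 := (h1 c).symm.trans ((congrFun h b).trans (h1 d))
  rw [map_sub, mul_right_cancel₀ (Vertex.loopValue_root_ne_zero _ _ (Nat.succ_ne_zero _)) h2,
    sub_self]

theorem Replace.exists_levels {u v : List (Slice Unit)} {D D' : UnorientedDiagram}
    (h : Replace u v D D') : ∃ w₁ w₂ n k, D.word = w₁ ++ u ++ w₂ ∧ D'.word = w₁ ++ v ++ w₂ ∧
      levels w₁ 0 = some n ∧ levels u n = some k ∧ levels v n = some k := by
  obtain ⟨w₁, w₂, s, t, h1, h2, h3, h4, h5, -⟩ := h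
  exact ⟨w₁, w₂, s.length, t.length, h1, h2, (run_eq_some_iff _ _ _).1 h3,
    (run_eq_some_iff _ _ _).1 h4, (run_eq_some_iff _ _ _).1 h5⟩

theorem replace_of_levels {u v w₁ w₂ : List (Slice Unit)} {D D' : UnorientedDiagram} {n k : ℕ}
    (h : D.word = w₁ ++ u ++ w₂) (h' : D'.word = w₁ ++ v ++ w₂) (h₁ : levels w₁ 0 = some n)
    (hu : levels u n = some k) (hv : levels v n = some k) : Replace u v D D' := by
  have h2 := (run_nil_iff _).1 D.closed
  rw [h, levels_append, levels_append, h₁, Option.bind_some, hu, Option.bind_some] at h2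
  exact ⟨w₁, w₂, List.replicate n (), List.replicate k (), h, h',
    (run_eq_some_iff _ _ _).2 (by simpa using h₁), (run_eq_some_iff _ _ _).2 (by simpa using hu),
    (run_eq_some_iff _ _ _).2 (by simpa using hv), (run_eq_some_iff _ _ _).2 (by simpa using h2)⟩

theorem Diagram.exists_levels {D : UnorientedDiagram} {w₁ w₂ : List (Slice Unit)} {c : Slice Unit}
    (h : D.word = w₁ ++ [c] ++ w₂) :
    ∃ n k, levels w₁ 0 = some n ∧ c.level n = some k ∧ levels w₂ k = some 0 := by
  have h1 := (run_nil_iff _).1 D.closed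
  rw [h, List.append_assoc, levels_append, Option.bind_eq_some_iff] at h1
  obtain ⟨n, hn, h1⟩ := h1
  simp only [List.singleton_append, levels, Option.bind_eq_some_iff] at h1
  obtain ⟨k, hk, h1⟩ := h1
  exact ⟨n, k, hn, hk, h1⟩

/-- The polynomial is the coefficient of the circle in the reduction of the family of all state
sums. Each rule holds for the family and passes to the coefficients by their uniqueness. -/
theorem exists_isTiedKauffman : ∃ L, IsTiedKauffman L := by
  have hZ := isTiedSkein_values
  choose L hL using fun D : UnorientedDiagram => hZ.exists_eq_smul_circle C_T_neg_one_mul_z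
    ((run_nil_iff _).1 D.closed) D.nonempty
  have key {D D' : UnorientedDiagram} (h : values D.word = values D'.word) : L D = L D' :=
    smul_values_circle_injective (by rw [← hL, ← hL, h])
  have key' {D D' : UnorientedDiagram} {c : Coeff} (h : values D.word = c • values D'.word) :
      L D = c * L D' :=
    smul_values_circle_injective (by rw [← hL, h, hL, mul_smul])
  refine ⟨L, ?_, ?_, ?_, ?_, ?_, ?_, ?_, ?_⟩
  · rintro D D' (⟨u, v, huv, h⟩ | ⟨u, b, hu, h, h'⟩)
    · obtain ⟨w₁, w₂, n, k, h, h', h₁, hu, hv⟩ := h.exists_levels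
      exact key (by rw [h, h', hZ.plane u v huv w₁ w₂ n k h₁ hu hv])
    · refine key ?_
      rw [h, h']
      exact (hZ.infinity (by rw [← aPow_add]; simp [aPow_zero])
        ((run_eq_some_iff u [b] [b]).1 hu)).symm
  · rintro D D' ⟨w₁, w₂, i, j, h, h', ht⟩
    obtain ⟨n, k, h₁, hk, -⟩ := Diagram.exists_levels h
    simp only [level, Option.ite_none_right_eq_some] at hk
    rw [h'] at ht
    exact key (by rw [h, h', hZ.tie i j w₁ w₂ n h₁ hk.1.1 hk.1.2 ht])
  · intro D h
    refine smul_values_circle_injective ?_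
    rw [← hL, h, one_smul]
  · rintro D D' ⟨i, h⟩
    obtain ⟨w₁, w₂, n, k, h, h', h₁, hu, hv⟩ := h.exists_levels
    simp only [levels, level, Option.bind_eq_some_iff, Option.ite_none_right_eq_some] at hu
    obtain ⟨_, ⟨hi, _⟩, _⟩ := hu
    exact key' (by rw [h, h', hZ.union i w₁ w₂ n h₁ hi, List.append_nil])
  · rintro D D' ⟨i, ε, h⟩
    obtain ⟨w₁, w₂, n, k, h, h', h₁, hu, hv⟩ := h.exists_levels
    simp only [levels, level, Option.bind_eq_some_iff, Option.ite_none_right_eq_some] at hu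
    obtain ⟨_, ⟨hi, _⟩, _⟩ := hu
    exact key (by rw [h, h', hZ.reidemeister2 i ε w₁ w₂ n h₁ hi, List.append_nil])
  · rintro D D' ⟨i, ε, h⟩
    obtain ⟨w₁, w₂, n, k, h, h', h₁, hu, hv⟩ := h.exists_levels
    simp only [levels, level, Option.bind_eq_some_iff, Option.ite_none_right_eq_some,
      Option.some.injEq] at hv
    obtain ⟨_, ⟨hi, rfl⟩, _⟩ := hv
    exact key (by rw [h, h', hZ.reidemeister3 i ε w₁ w₂ n h₁ (by omega)])
  · rintro ε D D' ⟨u, hu, h⟩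
    obtain ⟨w₁, w₂, n, k, h, h', h₁, hk, hv⟩ := h.exists_levels
    obtain rfl : n = k := Option.some.inj hv
    exact key' (by rw [h, h', hZ.curl ε u hu w₁ w₂ n h₁ hk, List.append_nil])
  · intro w₁ w₂ i Dp Dm De Df hp hm he hf
    obtain ⟨n, k, h₁, hk, -⟩ := Diagram.exists_levels hp
    simp only [level, Option.ite_none_right_eq_some] at hk
    refine smul_values_circle_injective ?_
    rw [add_smul, mul_smul, add_smul, ← hL, ← hL, ← hL, ← hL, hp, hm, he, hf,
      hZ.skein i w₁ w₂ n h₁ hk.1]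

/-! ### Uniqueness of the polynomial -/

section Uniqueness

variable (L : UnorientedDiagram → Coeff)

open scoped Classical in
/-- The extension of a function on diagrams to words; the empty diagram has the value `x`. -/
noncomputable def extend (w : List (Slice Unit)) :
    LaurentPolynomial (LaurentPolynomial (LaurentPolynomial ℤ)) :=
  if h : levels w 0 = some 0 then
    if h' : w ≠ [] then Polynomial.toLaurent (L ⟨w, (run_nil_iff w).2 h, h'⟩)
    else LaurentPolynomial.T (-1)
  else 0

theorem extend_word (D : UnorientedDiagram) : extend L D.word = Polynomial.toLaurent (L D) := by
  rw [extend, dif_pos ((run_nil_iff _).1 D.closed), dif_pos D.nonempty]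

theorem extend_nil : extend L [] = LaurentPolynomial.T (-1) := by
  simp [extend, levels]

variable {L}

theorem extend_eq_smul {v w : List (Slice Unit)} {c : Coeff} (h : levels v 0 = levels w 0)
    (hv : v ≠ []) (hw : w ≠ [])
    (hL : ∀ D D' : UnorientedDiagram, D.word = v → D'.word = w → L D = c * L D') :
    extend L v = c • extend L w := by
  by_cases h0 : levels w 0 = some 0
  · have h1 := hL ⟨v, (run_nil_iff v).2 (h.trans h0), hv⟩ ⟨w, (run_nil_iff w).2 h0, hw⟩ rfl rfl
    rw [extend, extend, dif_pos (h.trans h0), dif_pos h0, dif_pos hv, dif_pos hw, h1, map_mul,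
      Algebra.smul_def, LaurentPolynomial.algebraMap_eq_toLaurent]
  · rw [extend, extend, dif_neg (by rwa [h]), dif_neg h0, smul_zero]

theorem extend_eq {v w : List (Slice Unit)} (h : levels v 0 = levels w 0)
    (hv : v ≠ []) (hw : w ≠ [])
    (hL : ∀ D D' : UnorientedDiagram, D.word = v → D'.word = w → L D = L D') :
    extend L v = extend L w := by
  rw [extend_eq_smul (c := 1) h hv hw fun D D' h h' => by rw [hL D D' h h', one_mul], one_smul]

theorem levels_replace {u v w₁ w₂ : List (Slice Unit)} {n k : ℕ} (h₁ : levels w₁ 0 = some n)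
    (hu : levels u n = some k) (hv : levels v n = some k) :
    levels (w₁ ++ u ++ w₂) 0 = levels (w₁ ++ v ++ w₂) 0 := by
  rw [levels_append, levels_append, levels_append, levels_append, h₁, Option.bind_some,
    Option.bind_some, hu, hv]

theorem ne_nil_of_levels {w : List (Slice Unit)} {n : ℕ} (h : levels w 0 = some n) (hn : n ≠ 0) :
    w ≠ [] := by
  rintro rfl
  exact hn (Option.some.inj h).symm

/-- Diagrams are nonempty, so each rule requires that no side becomes the empty word. This fails
only for the removal of a lone circle, where the value `x` of the empty word makes the rule agree
with the value `1` of the circle. -/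
theorem isTiedSkein_extend (hL : IsTiedKauffman L) :
    IsTiedSkein (fun ε : ℤˣ => aPow ε) z xInv (extend L) where
  zero w hw := dif_neg hw
  plane u v huv w₁ w₂ n k h₁ hu hv := by
    -- A zigzag contains a strand that comes from below, so some slice remains after it is
    -- straightened.
    have hne : w₁ ++ u ++ w₂ ≠ [] := by cases huv <;> simp
    have hne' : w₁ ++ v ++ w₂ ≠ [] := by
      cases huv with
      | zigzag_left i b =>
        simp only [levels, level, Option.bind_eq_some_iff, Option.ite_none_right_eq_some,
          Option.some.injEq] at hu
        obtain ⟨_, ⟨_, rfl⟩, _, ⟨_, _⟩, _⟩ := hu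
        simp [ne_nil_of_levels h₁ (by omega)]
      | zigzag_right i b =>
        simp only [levels, level, Option.bind_eq_some_iff, Option.ite_none_right_eq_some] at hu
        obtain ⟨_, ⟨_, _⟩, _⟩ := hu
        simp [ne_nil_of_levels h₁ (by omega)]
      | _ => simp
    exact extend_eq (levels_replace h₁ hu hv) hne hne' fun D D' h h' =>
      hL.sphere D D' (Or.inl ⟨u, v, huv, replace_of_levels h h' h₁ hu hv⟩)
  reidemeister2 i ε w₁ w₂ n h₁ hi := by
    have hu : levels [cross i ε, cross i (-ε)] n = some n := by simp [levels, level, hi]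
    have hne := ne_nil_of_levels h₁ (by omega)
    have := levels_replace (v := []) (w₂ := w₂) h₁ hu rfl
    rw [List.append_nil] at this
    exact extend_eq this (by simp [hne]) (by simp [hne]) fun D D' h h' =>
      hL.reidemeister2 D D' ⟨i, ε, replace_of_levels h (by simpa using h') h₁ hu rfl⟩
  reidemeister3 i ε w₁ w₂ n h₁ hi := by
    have hu : levels [cross i ε, cross (i + 1) ε, cross i ε] n = some n := by
      simp [levels, level, hi, show i + 2 ≤ n by omega]
    have hv : levels [cross (i + 1) ε, cross i ε, cross (i + 1) ε] n = some n := by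
      simp [levels, level, hi, show i + 2 ≤ n by omega]
    have hne := ne_nil_of_levels h₁ (by omega)
    exact extend_eq (levels_replace h₁ hu hv) (by simp [hne]) (by simp [hne]) fun D D' h h' =>
      hL.reidemeister3 D D' ⟨i, ε, replace_of_levels h h' h₁ hu hv⟩
  curl ε u h w₁ w₂ n h₁ hu := by
    have hn : n ≠ 0 := by
      cases h with
      | right i b =>
        simp only [levels, level, Option.bind_eq_some_iff, Option.ite_none_right_eq_some] at hu
        obtain ⟨_, ⟨_, _⟩, _⟩ := hu
        omega
      | left i b =>
        simp only [levels, level, Option.bind_eq_some_iff, Option.ite_none_right_eq_some,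
          Option.some.injEq] at hu
        obtain ⟨_, ⟨_, rfl⟩, _, ⟨_, _⟩, _⟩ := hu
        omega
    have hne := ne_nil_of_levels h₁ hn
    have := levels_replace (v := []) (w₂ := w₂) h₁ hu rfl
    rw [List.append_nil] at this
    exact extend_eq_smul this (by simp [hne]) (by simp [hne]) fun D D' h2 h' =>
      hL.curl ε D D' ⟨u, h, replace_of_levels h2 (by simpa using h') h₁ hu rfl⟩
  union i w₁ w₂ n h₁ hi := by
    have hu : levels [cup i (), cap i] n = some n := by simp [levels, level, hi]
    have := levels_replace (v := []) (w₂ := w₂) h₁ hu rfl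
    rw [List.append_nil] at this
    by_cases hne : w₁ ++ w₂ = []
    · obtain ⟨rfl, rfl⟩ := List.append_eq_nil_iff.1 hne
      obtain rfl : n = 0 := (Option.some.inj h₁).symm
      obtain rfl : i = 0 := by omega
      have h1 := extend_word L ⟨[cup 0 (), cap 0], rfl, by simp⟩
      rw [hL.circle _ rfl] at h1
      refine h1.trans ?_
      rw [List.append_nil, extend_nil]
      change _ = Polynomial.toLaurent xInv * _
      rw [xInv, Polynomial.toLaurent_X, ← LaurentPolynomial.T_add]
      simp
    · exact extend_eq_smul this (by simp) hne fun D D' h h' =>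
        hL.union D D' ⟨i, replace_of_levels h (by simpa using h') h₁ hu rfl⟩
  tie i j w₁ w₂ n h₁ hi hj ht := by
    have hu : levels [Slice.tie i j] n = some n := by simp [levels, level, hi, hj]
    have hne := ne_nil_of_levels h₁ (by omega)
    have := levels_replace (v := []) (w₂ := w₂) h₁ hu rfl
    rw [List.append_nil] at this
    exact extend_eq this (by simp [hne]) (by simp [hne]) fun D D' h h' =>
      hL.tie D D' ⟨w₁, w₂, i, j, h, h', h' ▸ ht⟩
  skein i w₁ w₂ n h₁ hi := by
    have hp (ε : ℤˣ) : levels [cross i ε] n = some n := by simp [levels, level, hi]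
    have he : levels [Slice.tie i (i + 1)] n = some n := by
      simp [levels, level, show i < n by omega, show i + 1 < n by omega]
    have hf : levels [cup (i + 2) (), Slice.tie (i + 1) (i + 2), cap i] n = some n := by
      simp only [levels, level, Option.bind_some, hi, if_true]
      rw [if_pos ⟨by omega, by omega⟩, Option.bind_some, if_pos (by omega)]
      simp
    by_cases h0 : levels (w₁ ++ [cross i 1] ++ w₂) 0 = some 0
    · have h1 := (levels_replace (w₂ := w₂) h₁ (hp 1) (hp (-1))).symm.trans h0
      have h2 := (levels_replace (w₂ := w₂) h₁ (hp 1) he).symm.trans h0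
      have h3 := (levels_replace (w₂ := w₂) h₁ (hp 1) hf).symm.trans h0
      have := hL.skein w₁ w₂ i ⟨_, (run_nil_iff _).2 h0, by simp⟩ ⟨_, (run_nil_iff _).2 h1, by simp⟩
        ⟨_, (run_nil_iff _).2 h2, by simp⟩ ⟨_, (run_nil_iff _).2 h3, by simp⟩ rfl rfl rfl rfl
      have := congrArg Polynomial.toLaurent this
      rw [map_add, map_mul, map_add, ← extend_word, ← extend_word, ← extend_word,
        ← extend_word] at this
      exact this
    · have h1 := h0
      have h2 := h0
      have h3 := h0
      rw [levels_replace h₁ (hp 1) (hp (-1))] at h1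
      rw [levels_replace h₁ (hp 1) he] at h2
      rw [levels_replace h₁ (hp 1) hf] at h3
      rw [extend, extend, extend, extend, dif_neg h0, dif_neg h1, dif_neg h2, dif_neg h3]
      simp

/-- Both solutions are reduced at once, as a functional with values in pairs, so the same
coefficient `c` is the value of each. -/
theorem IsTiedKauffman.eq {L' : UnorientedDiagram → Coeff} (hL : IsTiedKauffman L)
    (hL' : IsTiedKauffman L') : L = L' := by
  have hZ : IsTiedSkein (fun ε : ℤˣ => aPow ε) z xInv
      fun w (i : Bool) => extend (if i then L else L') w :=
    IsTiedSkein.pi fun i => by cases i <;> exact isTiedSkein_extend ‹_›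
  funext D
  obtain ⟨c, hc⟩ := hZ.exists_eq_smul_circle C_T_neg_one_mul_z ((run_nil_iff _).1 D.closed)
    D.nonempty
  have key {M : UnorientedDiagram → Coeff} (hM : IsTiedKauffman M)
      (h : extend M D.word = c • extend M [cup 0 (), cap 0]) : M D = c := by
    have h1 := extend_word M ⟨[cup 0 (), cap 0], rfl, by simp⟩
    rw [hM.circle _ rfl, map_one] at h1
    rw [extend_word, h1, Algebra.smul_def, LaurentPolynomial.algebraMap_eq_toLaurent, mul_one] at h
    exact Polynomial.toLaurent_injective h
  rw [key hL (congrFun hc true), key hL' (congrFun hc false)]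

end Uniqueness

end TiedLink

namespace TiedLink

open Slice

/-! ### Oriented diagrams -/

section Act

variable {α : Type} [Neg α] [DecidableEq α]

@[simp] theorem act_cup_append (h r : List α) (b : α) :
    (cup h.length b).act (h ++ r) = some (h ++ b :: -b :: r) := by
  simp [Slice.act]

@[simp] theorem act_cup_append_cons (h r : List α) (x b : α) :
    (cup (h.length + 1) b).act (h ++ x :: r) = some (h ++ x :: b :: -b :: r) := by
  simpa using act_cup_append (h ++ [x]) r b

@[simp] theorem act_cap_append (h r : List α) (x y : α) :
    (cap h.length).act (h ++ x :: y :: r) = if y = -x then some (h ++ r) else none := by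
  simp [Slice.act]

@[simp] theorem act_cap_append_cons (h r : List α) (w x y : α) :
    (cap (h.length + 1)).act (h ++ w :: x :: y :: r) =
      if y = -x then some (h ++ w :: r) else none := by
  simpa using act_cap_append (h ++ [w]) r x y

@[simp] theorem act_cross_append (h r : List α) (x y : α) (ε : ℤˣ) :
    (cross h.length ε).act (h ++ x :: y :: r) = some (h ++ y :: x :: r) := by
  simp [Slice.act]

@[simp] theorem act_cross_append_cons (h r : List α) (w x y : α) (ε : ℤˣ) :
    (cross (h.length + 1) ε).act (h ++ w :: x :: y :: r) = some (h ++ w :: y :: x :: r) := by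
  simpa using act_cross_append (h ++ [w]) r x y ε

theorem act_shift_append (c : Slice α) (h r : List α) :
    (c.shift h.length).act (h ++ r) = (c.act r).map (h ++ ·) := by
  cases c with
  | cup i b =>
    simp only [shift, Slice.act, List.length_append, add_comm i, add_le_add_iff_left]
    split_ifs
    · rw [List.take_length_add_append, List.drop_length_add_append, List.append_assoc]
      rfl
    · rfl
  | cap i =>
    simp only [shift, Slice.act, add_comm i, List.drop_length_add_append]
    split
    · split_ifs <;> simp [List.take_append]
    · rfl
  | cross i ε =>
    simp only [shift, Slice.act, add_comm i, List.drop_length_add_append]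
    split
    · simp [List.take_append]
    · rfl
  | tie i j =>
    simp only [shift, Slice.act, List.length_append, add_comm _ h.length, add_lt_add_iff_left]
    split_ifs <;> simp

omit [Neg α] [DecidableEq α] in
theorem exists_of_drop_eq_cons {s r : List α} {x : α} {i : ℕ} (h : s.drop i = x :: r) :
    ∃ l, s = l ++ x :: r ∧ l.length = i := by
  refine ⟨s.take i, by rw [← h, List.take_append_drop], ?_⟩
  have := congrArg List.length h
  simp at this ⊢
  omega

theorem exists_of_act_cup {i : ℕ} {b : α} {s t : List α} (h : (cup i b).act s = some t) :
    ∃ l r, s = l ++ r ∧ l.length = i := by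
  simp only [Slice.act, Option.ite_none_right_eq_some] at h
  exact ⟨s.take i, s.drop i, (List.take_append_drop i s).symm, by simpa using h.1⟩

theorem exists_of_act_cap {i : ℕ} {s t : List α} (h : (cap i).act s = some t) :
    ∃ l x y r, s = l ++ x :: y :: r ∧ l.length = i := by
  simp only [Slice.act] at h
  split at h
  · rename_i x y r hs
    obtain ⟨l, hl⟩ := exists_of_drop_eq_cons hs
    exact ⟨l, x, y, r, hl⟩
  · cases h

theorem exists_of_act_cross {i : ℕ} {ε : ℤˣ} {s t : List α} (h : (cross i ε).act s = some t) :
    ∃ l x y r, s = l ++ x :: y :: r ∧ l.length = i := by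
  simp only [Slice.act] at h
  split at h
  · rename_i x y r hs
    obtain ⟨l, hl⟩ := exists_of_drop_eq_cons hs
    exact ⟨l, x, y, r, hl⟩
  · cases h

theorem exists_of_act_cross_succ {i : ℕ} {ε : ℤˣ} {s t : List α}
    (h : (cross (i + 1) ε).act s = some t) :
    ∃ l w x y r, s = l ++ w :: x :: y :: r ∧ l.length = i := by
  obtain ⟨l, x, y, r, rfl, hl⟩ := exists_of_act_cross h
  rcases List.eq_nil_or_concat' l with rfl | ⟨l', w, rfl⟩
  · simp at hl
  · exact ⟨l', w, x, y, r, by simp, by simpa using hl⟩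

theorem exists_of_act_cup_succ {i : ℕ} {b : α} {s t : List α}
    (h : (cup (i + 1) b).act s = some t) : ∃ l x r, s = l ++ x :: r ∧ l.length = i := by
  obtain ⟨l, r, rfl, hl⟩ := exists_of_act_cup h
  rcases List.eq_nil_or_concat' l with rfl | ⟨l', w, rfl⟩
  · simp at hl
  · exact ⟨l', w, r, by simp, by simpa using hl⟩

end Act

@[simp] theorem sign_cross_append (h r : List ℤˣ) (x y ε : ℤˣ) :
    (cross h.length ε).sign (h ++ x :: y :: r) = ((ε * x * y : ℤˣ) : ℤ) := by
  simp [Slice.sign]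

@[simp] theorem sign_cross_append_cons (h r : List ℤˣ) (w x y ε : ℤˣ) :
    (cross (h.length + 1) ε).sign (h ++ w :: x :: y :: r) = ((ε * x * y : ℤˣ) : ℤ) := by
  simpa using sign_cross_append (h ++ [w]) r x y ε

@[simp] theorem sign_cup (i : ℕ) (b : ℤˣ) (s : List ℤˣ) : (cup i b).sign s = 0 := rfl
@[simp] theorem sign_cap (i : ℕ) (s : List ℤˣ) : (cap i).sign s = 0 := rfl
@[simp] theorem sign_tie (i j : ℕ) (s : List ℤˣ) : (Slice.tie i j).sign s = 0 := rfl

theorem sign_shift_append (c : Slice ℤˣ) (h r : List ℤˣ) :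
    (c.shift h.length).sign (h ++ r) = c.sign r := by
  cases c with
  | cross i ε => simp only [shift, Slice.sign, add_comm i, List.drop_length_add_append]
  | _ => rfl

theorem sign_shift_append_cons (c : Slice ℤˣ) (h r : List ℤˣ) (x y : ℤˣ) :
    (c.shift (h.length + 2)).sign (h ++ x :: y :: r) = c.sign r := by
  simpa using sign_shift_append c (h ++ [x, y]) r

theorem run_append {α : Type} [Neg α] [DecidableEq α] (u v : List (Slice α)) (s : List α) :
    run (u ++ v) s = (run u s).bind (run v) := by
  induction u generalizing s with
  | nil => rfl
  | cons c u ih =>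
    simp only [List.cons_append, run]
    cases c.act s with
    | none => rfl
    | some t => simp [ih]

@[simp] theorem writheFrom_nil (s : List ℤˣ) : writheFrom [] s = 0 := rfl

@[simp] theorem writheFrom_singleton (c : Slice ℤˣ) (s : List ℤˣ) :
    writheFrom [c] s = c.sign s := by
  rw [writheFrom]
  cases c.act s <;> simp

theorem writheFrom_cons {c : Slice ℤˣ} {w : List (Slice ℤˣ)} {s t : List ℤˣ}
    (h : c.act s = some t) : writheFrom (c :: w) s = c.sign s + writheFrom w t := by
  simp [writheFrom, h]

theorem writheFrom_append {u : List (Slice ℤˣ)} {s t : List ℤˣ} (h : run u s = some t)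
    (v : List (Slice ℤˣ)) : writheFrom (u ++ v) s = writheFrom u s + writheFrom v t := by
  induction u generalizing s with
  | nil =>
    obtain rfl : s = t := Option.some.inj h
    simp
  | cons c u ih =>
    simp only [run, Option.bind_eq_some_iff] at h
    obtain ⟨r, hr, h⟩ := h
    rw [List.cons_append, writheFrom_cons hr, writheFrom_cons hr, ih h, add_assoc]

/-- The writhe is additive along the word, and each part depends only on the directions below it;
these agree on both sides outside the disc. -/
theorem Replace.writhe_eq {u v : List (Slice ℤˣ)} {D D' : OrientedDiagram} (h : Replace u v D D')
    {k : ℤ} (hk : ∀ s t, run u s = some t → run v s = some t →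
      writheFrom u s = writheFrom v s + k) : writhe D = writhe D' + k := by
  obtain ⟨w₁, w₂, s, t, h, h', h₁, hu, hv, -⟩ := h
  rw [writhe, writhe, h, h', List.append_assoc, List.append_assoc, writheFrom_append h₁,
    writheFrom_append h₁, writheFrom_append hu, writheFrom_append hv, hk s t hu hv]
  ring

/-- When a crossing passes an extremum, both `ε` and the direction of one of its strands are
reversed, so its sign is unchanged. -/
theorem PlaneMove.writheFrom_eq {u v : List (Slice ℤˣ)} (h : PlaneMove u v) {s t : List ℤˣ}
    (hu : run u s = some t) (hv : run v s = some t) : writheFrom u s = writheFrom v s := by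
  cases h with
  | far_cup c i b =>
    simp only [run, Option.bind_eq_some_iff] at hu hv
    obtain ⟨s₁, hs₁, _⟩ := hu
    obtain ⟨s₂, hs₂, -⟩ := hv
    obtain ⟨l, r, rfl, rfl⟩ := exists_of_act_cup hs₂
    rw [writheFrom_cons hs₁, sign_shift_append, writheFrom_cons (act_cup_append l r b)]
    simp [sign_shift_append_cons]
  | far_cap c i =>
    simp only [run, Option.bind_eq_some_iff] at hu hv
    obtain ⟨s₁, hs₁, s₃, hs₃, _⟩ := hu
    obtain ⟨s₂, hs₂, -⟩ := hv
    obtain ⟨l, x, y, r, rfl, rfl⟩ := exists_of_act_cap hs₂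
    rw [writheFrom_cons hs₁, sign_shift_append_cons, writheFrom_cons hs₂]
    rw [act_cap_append, Option.ite_none_right_eq_some, Option.some.injEq] at hs₂
    obtain ⟨-, rfl⟩ := hs₂
    simp [sign_shift_append]
  | far_cross c i ε =>
    simp only [run, Option.bind_eq_some_iff] at hu hv
    obtain ⟨s₁, hs₁, -⟩ := hu
    obtain ⟨s₂, hs₂, -⟩ := hv
    obtain ⟨l, x, y, r, rfl, rfl⟩ := exists_of_act_cross hs₂
    rw [writheFrom_cons hs₁, sign_shift_append_cons, writheFrom_cons (act_cross_append l r x y ε)]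
    have h := act_shift_append c (l ++ [x, y]) r
    rw [List.append_assoc, List.length_append, List.cons_append, List.cons_append, List.nil_append,
      show [x, y].length = 2 from rfl, hs₁, eq_comm, Option.map_eq_some_iff] at h
    obtain ⟨r', -, rfl⟩ := h
    simp [sign_shift_append_cons, add_comm]
  | zigzag_left i b =>
    simp only [run, Option.bind_eq_some_iff] at hu
    obtain ⟨s₁, hs₁, s₂, hs₂, _⟩ := hu
    rw [writheFrom_cons hs₁, writheFrom_cons hs₂]
    simp
  | zigzag_right i b =>
    simp only [run, Option.bind_eq_some_iff] at hu
    obtain ⟨s₁, hs₁, s₂, hs₂, _⟩ := hu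
    rw [writheFrom_cons hs₁, writheFrom_cons hs₂]
    simp
  | cup_cross i b ε =>
    simp only [run, Option.bind_eq_some_iff] at hv
    obtain ⟨s₁, hs₁, _⟩ := hv
    obtain ⟨l, x, r, rfl, rfl⟩ := exists_of_act_cup_succ hs₁
    simp [writheFrom]
    ring
  | cross_cap i ε =>
    simp only [run, Option.bind_eq_some_iff] at hu
    obtain ⟨s₁, hs₁, s₂, hs₂, _⟩ := hu
    obtain ⟨l, w, x, y, r, rfl, rfl⟩ := exists_of_act_cross_succ hs₁
    simp only [act_cross_append_cons, Option.some.injEq] at hs₁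
    subst hs₁
    rw [act_cap_append, Option.ite_none_right_eq_some] at hs₂
    obtain ⟨rfl, -⟩ := hs₂
    simp [writheFrom]
    ring

/-- The closing maximum forces the direction of the minimum to agree with that of the strand; the
product of the two directions at the crossing is then a square. -/
theorem Curl.writheFrom_eq {ε : ℤˣ} {u : List (Slice ℤˣ)} (h : Curl ε u) {s t : List ℤˣ}
    (hu : run u s = some t) : writheFrom u s = ε := by
  cases h with
  | right i b =>
    simp only [run, Option.bind_eq_some_iff] at hu
    obtain ⟨s₁, hs₁, s₂, hs₂, s₃, hs₃, _⟩ := hu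
    obtain ⟨l, x, r, rfl, rfl⟩ := exists_of_act_cup_succ hs₁
    simp only [act_cup_append_cons, Option.some.injEq] at hs₁
    subst hs₁
    simp only [act_cross_append, Option.some.injEq] at hs₂
    subst hs₂
    rw [act_cap_append_cons, Option.ite_none_right_eq_some, neg_inj] at hs₃
    obtain ⟨rfl, -⟩ := hs₃
    simp [writheFrom, mul_assoc]
  | left i b =>
    simp only [run, Option.bind_eq_some_iff] at hu
    obtain ⟨s₁, hs₁, s₂, hs₂, s₃, hs₃, _⟩ := hu
    obtain ⟨l, r, rfl, rfl⟩ := exists_of_act_cup hs₁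
    simp only [act_cup_append, Option.some.injEq] at hs₁
    subst hs₁
    rcases r with _ | ⟨x, r⟩
    · simp [Slice.act] at hs₂
    · simp only [act_cross_append_cons, Option.some.injEq] at hs₂
      subst hs₂
      rw [act_cap_append, Option.ite_none_right_eq_some] at hs₃
      obtain ⟨rfl, -⟩ := hs₃
      simp [writheFrom, mul_assoc]

theorem writheFrom_reidemeister2 {i : ℕ} {ε : ℤˣ} {s t : List ℤˣ}
    (h : run [cross i ε, cross i (-ε)] s = some t) :
    writheFrom [cross i ε, cross i (-ε)] s = 0 := by
  simp only [run, Option.bind_eq_some_iff] at h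
  obtain ⟨s₁, hs₁, _⟩ := h
  obtain ⟨l, x, y, r, rfl, rfl⟩ := exists_of_act_cross hs₁
  simp [writheFrom]
  ring

theorem writheFrom_reidemeister3 {i : ℕ} {ε : ℤˣ} {s t : List ℤˣ}
    (h : run [cross (i + 1) ε, cross i ε, cross (i + 1) ε] s = some t) :
    writheFrom [cross i ε, cross (i + 1) ε, cross i ε] s =
      writheFrom [cross (i + 1) ε, cross i ε, cross (i + 1) ε] s := by
  simp only [run, Option.bind_eq_some_iff] at h
  obtain ⟨s₁, hs₁, _⟩ := h
  obtain ⟨l, w, x, y, r, rfl, rfl⟩ := exists_of_act_cross_succ hs₁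
  simp [writheFrom]
  ring

theorem act_append_right {α : Type} [Neg α] [DecidableEq α] {c : Slice α} {s t : List α}
    (h : c.act s = some t) (r : List α) : c.act (s ++ r) = some (t ++ r) := by
  cases c with
  | cup i b =>
    obtain ⟨l, r', rfl, rfl⟩ := exists_of_act_cup h
    rw [act_cup_append, Option.some.injEq] at h
    subst h
    simp
  | cap i =>
    obtain ⟨l, x, y, r', rfl, rfl⟩ := exists_of_act_cap h
    rw [act_cap_append, Option.ite_none_right_eq_some, Option.some.injEq] at h
    obtain ⟨rfl, rfl⟩ := h
    simp
  | cross i ε =>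
    obtain ⟨l, x, y, r', rfl, rfl⟩ := exists_of_act_cross h
    rw [act_cross_append, Option.some.injEq] at h
    subst h
    simp
  | tie i j =>
    simp only [Slice.act, Option.ite_none_right_eq_some, Option.some.injEq] at h ⊢
    obtain ⟨⟨hi, hj⟩, rfl⟩ := h
    exact ⟨by simp; omega, rfl⟩

theorem sign_append {c : Slice ℤˣ} {s t : List ℤˣ} (h : c.act s = some t) (r : List ℤˣ) :
    c.sign (s ++ r) = c.sign s := by
  cases c with
  | cross i ε =>
    obtain ⟨l, x, y, r', rfl, rfl⟩ := exists_of_act_cross h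
    simp
  | _ => rfl

theorem run_append_right {u : List (Slice ℤˣ)} {s t : List ℤˣ} (h : run u s = some t)
    (r : List ℤˣ) :
    run u (s ++ r) = some (t ++ r) ∧ writheFrom u (s ++ r) = writheFrom u s := by
  induction u generalizing s with
  | nil =>
    obtain rfl : s = t := Option.some.inj h
    exact ⟨rfl, rfl⟩
  | cons c u ih =>
    simp only [run, Option.bind_eq_some_iff] at h
    obtain ⟨s', hs, h⟩ := h
    rw [writheFrom_cons hs, writheFrom_cons (act_append_right hs r), sign_append hs, run, act_append_right hs r,
      (ih h).2]
    exact ⟨(ih h).1, rfl⟩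

theorem run_append_left {u : List (Slice ℤˣ)} {s t : List ℤˣ} (h : run u s = some t)
    (r : List ℤˣ) :
    run (u.map (Slice.shift r.length)) (r ++ s) = some (r ++ t) ∧
      writheFrom (u.map (Slice.shift r.length)) (r ++ s) = writheFrom u s := by
  induction u generalizing s with
  | nil =>
    obtain rfl : s = t := Option.some.inj h
    exact ⟨rfl, rfl⟩
  | cons c u ih =>
    simp only [run, Option.bind_eq_some_iff] at h
    obtain ⟨s', hs, h⟩ := h
    have hs' : (c.shift r.length).act (r ++ s) = some (r ++ s') := by
      rw [act_shift_append, hs]; rfl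
    rw [List.map_cons, writheFrom_cons hs, writheFrom_cons hs', sign_shift_append, run, hs',
      (ih h).2]
    exact ⟨(ih h).1, rfl⟩

/-- An additional strand beside `u`, on either side, does not affect the crossings of `u`. -/
theorem InfinityMove.writhe_eq {D D' : OrientedDiagram} (h : InfinityMove D D') :
    writhe D = writhe D' := by
  obtain ⟨u, b, hu, h, h'⟩ := h
  have h1 := run_append_right hu [-b]
  have h2 := run_append_left hu [-b]
  have e1 : (cup 0 b).act [] = some ([b] ++ [-b]) := rfl
  have e2 : (cup 0 (-b)).act [] = some ([-b] ++ [b]) := by simp [Slice.act]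
  rw [writhe, writhe, h, h', List.append_assoc, List.append_assoc, List.singleton_append,
    List.singleton_append, writheFrom_cons e1, writheFrom_cons e2, writheFrom_append h1.1,
    h1.2, writheFrom_append (u := u.map (shift 1)) h2.1]
  rw [show writheFrom (u.map (shift 1)) _ = _ from h2.2]
  simp

theorem TieMove.writhe_eq {D D' : OrientedDiagram} (h : TieMove D D') : writhe D = writhe D' := by
  obtain ⟨w₁, w₂, i, j, h, h', -⟩ := h
  have hD := D.closed
  rw [h, List.append_assoc, run_append, Option.bind_eq_some_iff] at hD
  obtain ⟨s, hs, hD⟩ := hD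
  simp only [List.singleton_append, run, Option.bind_eq_some_iff] at hD
  obtain ⟨t, ht, -⟩ := hD
  rw [writhe, writhe, h, h', List.append_assoc, writheFrom_append hs, writheFrom_append hs,
    List.singleton_append, writheFrom_cons ht, sign_tie, zero_add]
  simp only [Slice.act, Option.ite_none_right_eq_some, Option.some.injEq] at ht
  rw [ht.2]

/-! #### Forgetting the orientation -/

section Forget

variable {α : Type}

theorem forget_shift (c : Slice α) (k : ℕ) : (c.shift k).forget = c.forget.shift k := by
  cases c <;> rfl

theorem Linked.forget {w : List (Slice α)} {P Q : ℕ × ℕ} (h : Linked w P Q) :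
    Linked (w.map Slice.forget) P Q := by
  have key {k : ℕ} {c : Slice α} (h : w[k]? = some c) :
      (w.map Slice.forget)[k]? = some c.forget := by simp [h]
  cases h with
  | cup_left k i p b h hp => exact .cup_left k i p () (key h) hp
  | cup_right k i p b h hp => exact .cup_right k i p () (key h) hp
  | cup_arc k i b h => exact .cup_arc k i () (key h)
  | cap_left k i p h hp => exact .cap_left k i p (key h) hp
  | cap_right k i p h hp => exact .cap_right k i p (key h) hp
  | cap_arc k i h => exact .cap_arc k i (key h)
  | cross_other k i p ε h hp hp' => exact .cross_other k i p ε (key h) hp hp'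
  | cross_right k i ε h => exact .cross_right k i ε (key h)
  | cross_left k i ε h => exact .cross_left k i ε (key h)
  | tie_other k i j p h => exact .tie_other k i j p (key h)
  | tie_spring k i j h => exact .tie_spring k i j (key h)

theorem TiedTogether.forget {w : List (Slice α)} {P Q : ℕ × ℕ} (h : TiedTogether w P Q) :
    TiedTogether (w.map Slice.forget) P Q :=
  Relation.EqvGen.mono (fun _ _ => Linked.forget) _ _ h

variable [Neg α] [DecidableEq α] {u v : List (Slice α)} {D D' : Diagram α}

theorem Replace.forget (h : Replace u v D D') :
    Replace (u.map Slice.forget) (v.map Slice.forget) D.forget D'.forget := by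
  obtain ⟨w₁, w₂, s, t, h, h', h₁, hu, hv, h₂⟩ := h
  exact ⟨w₁.map Slice.forget, w₂.map Slice.forget, _, _, by simp [Diagram.forget, h],
    by simp [Diagram.forget, h'], run_forget _ _ _ h₁, run_forget _ _ _ hu, run_forget _ _ _ hv,
    run_forget _ _ _ h₂⟩

omit [Neg α] [DecidableEq α] in
theorem PlaneMove.forget (h : PlaneMove u v) :
    PlaneMove (u.map Slice.forget) (v.map Slice.forget) := by
  cases h with
  | far_cup c i b =>
    simp only [List.map_cons, List.map_nil, forget_shift]
    exact .far_cup c.forget i ()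
  | far_cap c i =>
    simp only [List.map_cons, List.map_nil, forget_shift]
    exact .far_cap c.forget i
  | far_cross c i ε =>
    simp only [List.map_cons, List.map_nil, forget_shift]
    exact .far_cross c.forget i ε
  | zigzag_left i b => exact .zigzag_left i ()
  | zigzag_right i b => exact .zigzag_right i ()
  | cup_cross i b ε => exact .cup_cross i () ε
  | cross_cap i ε => exact .cross_cap i ε

theorem InfinityMove.forget (h : InfinityMove D D') : InfinityMove D.forget D'.forget := by
  obtain ⟨u, b, hu, h, h'⟩ := h
  refine ⟨u.map Slice.forget, (), run_forget _ _ _ hu, by simp [Diagram.forget, h, Slice.forget], ?_⟩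
  simp only [Diagram.forget, h', List.map_append, List.map_map, Function.comp_def, forget_shift]
  rfl

theorem SphereMove.forget (h : SphereMove D D') : SphereMove D.forget D'.forget :=
  h.imp (fun ⟨_, _, hu, h⟩ => ⟨_, _, hu.forget, h.forget⟩) InfinityMove.forget

theorem CurlMove.forget {ε : ℤˣ} (h : CurlMove ε D D') : CurlMove ε D.forget D'.forget := by
  obtain ⟨u, hu, h⟩ := h
  refine ⟨_, ?_, h.forget⟩
  cases hu with
  | right i b => exact .right i ()
  | left i b => exact .left i ()

theorem TieMove.forget (h : TieMove D D') : TieMove D.forget D'.forget := by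
  obtain ⟨w₁, w₂, i, j, h, h', ht⟩ := h
  refine ⟨w₁.map Slice.forget, w₂.map Slice.forget, i, j, by simp [Diagram.forget, h, Slice.forget],
    by simp [Diagram.forget, h'], ?_⟩
  simpa [Diagram.forget] using ht.forget

end Forget

theorem IsTiedKauffman.normalized_eq {L : UnorientedDiagram → Coeff} (hL : IsTiedKauffman L)
    {D D' : OrientedDiagram} (h : AmbientMove D D') :
    aPow (-writhe D) * L D.forget = aPow (-writhe D') * L D'.forget := by
  have key (hw : writhe D = writhe D') (h : L D.forget = L D'.forget) :
      aPow (-writhe D) * L D.forget = aPow (-writhe D') * L D'.forget := by rw [hw, h]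
  rcases h with h | ⟨ε, h⟩ | ⟨i, ε, h⟩ | ⟨i, ε, h⟩ | h
  · refine key ?_ (hL.sphere _ _ h.forget)
    rcases h with ⟨u, v, hu, h⟩ | h
    · rw [h.writhe_eq (k := 0) fun s t h h' => by rw [hu.writheFrom_eq h h', add_zero], add_zero]
    · exact h.writhe_eq
  -- The curl raises the writhe by `ε` and multiplies `L` by `a ^ ε`.
  · obtain ⟨u, hu, hr⟩ := h
    rw [hr.writhe_eq (k := ε) fun s t h _ => by rw [hu.writheFrom_eq h, writheFrom_nil, zero_add],
      hL.curl ε _ _ (CurlMove.forget ⟨u, hu, hr⟩), ← mul_assoc, ← aPow_add]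
    congr 2
    ring
  · refine key ?_ (hL.reidemeister2 _ _ ⟨i, ε, h.forget⟩)
    rw [h.writhe_eq (k := 0) fun s t h _ => by rw [writheFrom_reidemeister2 h]; rfl, add_zero]
  · refine key ?_ (hL.reidemeister3 _ _ ⟨i, ε, h.forget⟩)
    rw [h.writhe_eq (k := 0) fun s t _ h => by rw [writheFrom_reidemeister3 h, add_zero], add_zero]
  · exact key h.writhe_eq (hL.tie _ _ h.forget)

end TiedLink

theorem mainTheorem5 :
    (∃! L : TiedLink.UnorientedDiagram → TiedLink.Coeff, TiedLink.IsTiedKauffman L) ∧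
    ∀ L : TiedLink.UnorientedDiagram → TiedLink.Coeff, TiedLink.IsTiedKauffman L →
      ∀ D D' : TiedLink.OrientedDiagram, TiedLink.AmbientTieIsotopic D D' →
        TiedLink.aPow (-TiedLink.writhe D) * L D.forget =
          TiedLink.aPow (-TiedLink.writhe D') * L D'.forget := by
  refine ⟨?_, fun L hL D D' h => ?_⟩
  · obtain ⟨L, hL⟩ := TiedLink.exists_isTiedKauffman
    exact ⟨L, hL, fun L' hL' => hL'.eq hL⟩
  · induction h with
    | rel D D' h => exact hL.normalized_eq h
    | refl D => rfl
    | symm D D' _ ih => exact ih.symm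
    | trans D D' D'' _ _ ih ih' => exact ih.trans ih'
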